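/- For $n\ge 1$ let $X=X_n$ be the number of (directed) Hamiltonian paths of $K_n$ (there are $n!$ of them, given by their vertex sequences) whose edges appear in increasing order in a uniformly random ordering of the edges of $K_n$. An edge-ordered triple $(A,B,C,\preceq)$ in $K_n$ consists of Hamiltonian paths $A,B,C$ and a total order $\preceq$ of the edge set $A\cup B\cup C$ with respect to which $A$, $B$ and $C$ are all increasing. Its common edge graph $G$ consists of the edges contained in at least two of the paths and the vertices incident to them; each edge is labelled by which of the three paths traverse it and in which directions, and the edges are ordered by $\preceq$. Its reduced common edge graph is obtained from $G$ by collapsing each maximal path, all of whose edges are contained in exactly the same ones of $A,B,C$, to a single edge, keeping labels and edge-ordering. Reduced common edge graphs are considered up to isomorphism (bijections of the vertices that preserve labels and edge-ordering). A reduced common edge graph is good if each of its components consists of a single edge which is common to precisely two of the paths. For a reduced common edge graph $\tilde G$ and $\bar c=(c_{AB},c_{AC},c_{BC},c_{ABC})$ a quadruple of non-negative integers, let $T_n(\tilde G,\bar c)$ be the number of edge-ordered triples in $K_n$ with reduced common edge graph $\tilde G$ and $|(A\cap B)\setminus C|=c_{AB}$, $|(A\cap C)\setminus B|=c_{AC}$,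 $|(B\cap C)\setminus A|=c_{BC}$, $|A\cap B\cap C|=c_{ABC}$, where the sets are sets of edges, and let $$t_n(\tilde G,\bar c)=\frac{T_n(\tilde G,\bar c)}{(3n-3-c_{AB}-c_{AC}-c_{BC}-2c_{ABC})!}$$ (understood as $0$ if $T_n(\tilde G,\bar c)=0$). Then $\mathbb{E}X^3=O(n^3)$ as $n\to\infty$. Moreover, for every $n\ge1$, $$\mathbb{E}X^3=\sum_{\tilde G}\sum_{\bar c}t_n(\tilde G,\bar c),$$ and there are constants $K_1,K_2$ and $\delta>0$ such that, for all integers $n\ge 1$ and $M\ge 0$, the contribution to this sum from all pairs $(\tilde G,\bar c)$ such that $\tilde G$ is not good or $c_{AB}+c_{AC}+c_{BC}>M$ is at most $K_1n^3e^{-\delta M}+K_2n^2$. -/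

import Mathlib

open Finset Filter Asymptotics

open scoped BigOperators

noncomputable section

namespace HamTriples

/-! ### Hamiltonian paths and edge-orderings of the complete graph on `Fin n` -/

/-- A (directed) Hamiltonian path in the complete graph on `Fin n`, given by its vertex sequence:
`P i` is the `i`-th vertex of the path. There are `n !` of them. -/
abbrev HamPath (n : ℕ) : Type := Equiv.Perm (Fin n)

/-- The path `P` visits `v` immediately after `u`, that is, it traverses the edge `s(u, v)` in the
direction from `u` to `v`. -/
def Traverses {n : ℕ} (P : HamPath n) (u v : Fin n) : Prop :=
  (P.symm u : ℕ) + 1 = (P.symm v : ℕ)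

open Classical in
/-- The set of the `n - 1` (undirected) edges of a path. -/
def pathEdges {n : ℕ} (P : HamPath n) : Finset (Sym2 (Fin n)) :=
  univ.filter fun e => ∃ u v, e = s(u, v) ∧ Traverses P u v

/-- An ordering of a finite set `S` of edges, given by the position of each edge in the order. -/
abbrev EdgeOrder {n : ℕ} (S : Finset (Sym2 (Fin n))) : Type := S ≃ Fin S.card

/-- The path `P` is increasing with respect to an ordering of a set `S` of edges (which contains
all edges of `P`): each edge of `P` is lower in the order than the edge traversed next. -/
def IsIncreasing {n : ℕ} (P : HamPath n) {S : Finset (Sym2 (Fin n))} (σ : EdgeOrder S) : Prop :=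
  ∀ (e f : S) (u v w : Fin n), Traverses P u v → Traverses P v w →
    (e : Sym2 (Fin n)) = s(u, v) → (f : Sym2 (Fin n)) = s(v, w) → σ e < σ f

/-- The edges of the complete graph on `Fin n`. -/
abbrev allEdges (n : ℕ) : Finset (Sym2 (Fin n)) := (⊤ : SimpleGraph (Fin n)).edgeFinset

open Classical in
/-- The number of increasing Hamiltonian paths with respect to an edge-ordering of the complete
graph. -/
def numIncreasing {n : ℕ} (ω : EdgeOrder (allEdges n)) : ℕ :=
  (univ.filter fun P : HamPath n => IsIncreasing P ω).card

/-- The third moment `E X ^ 3` of the number `X` of increasing Hamiltonian paths in a uniformly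
random edge-ordering of the complete graph on `n` vertices. -/
def thirdMoment (n : ℕ) : ℝ :=
  𝔼 ω : EdgeOrder (allEdges n), (numIncreasing ω : ℝ) ^ 3

/-! ### Edge-ordered triples -/

/-- An edge-ordered triple: three Hamiltonian paths `A`, `B`, `C` together with an ordering of the
edges of `A ∪ B ∪ C` with respect to which all three paths are increasing. -/
structure EdgeOrderedTriple (n : ℕ) where
  A : HamPath n
  B : HamPath n
  C : HamPath n
  order : EdgeOrder (pathEdges A ∪ pathEdges B ∪ pathEdges C)
  incA : IsIncreasing A order
  incB : IsIncreasing B order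
  incC : IsIncreasing C order

instance (n : ℕ) : Finite (EdgeOrderedTriple n) := by
  let F : EdgeOrderedTriple n → (Σ p : HamPath n × HamPath n × HamPath n,
      EdgeOrder (pathEdges p.1 ∪ pathEdges p.2.1 ∪ pathEdges p.2.2)) :=
    fun t => ⟨(t.A, t.B, t.C), t.order⟩
  refine Finite.of_injective F ?_
  rintro ⟨A, B, C, o, h1, h2, h3⟩ ⟨A', B', C', o', h1', h2', h3'⟩ h
  simp only [F, Sigma.mk.injEq, Prod.mk.injEq] at h
  obtain ⟨⟨rfl, rfl, rfl⟩, h⟩ := h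
  cases h
  rfl

/-- The numbers `c_AB`, `c_AC`, `c_BC`, `c_ABC`. -/
structure EdgeCounts where
  AB : ℕ
  AC : ℕ
  BC : ℕ
  ABC : ℕ

namespace EdgeOrderedTriple

variable {n : ℕ} (t : EdgeOrderedTriple n)

/-- The three paths of the triple, indexed by `0` (for `A`), `1` (for `B`) and `2` (for `C`). -/
def path : Fin 3 → HamPath n := ![t.A, t.B, t.C]

/-- The numbers of edges common to exactly `A` and `B`, to exactly `A` and `C`, to exactly `B` and
`C`, and to all three paths. -/
def counts : EdgeCounts where
  AB := ((pathEdges t.A ∩ pathEdges t.B) \ pathEdges t.C).card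
  AC := ((pathEdges t.A ∩ pathEdges t.C) \ pathEdges t.B).card
  BC := ((pathEdges t.B ∩ pathEdges t.C) \ pathEdges t.A).card
  ABC := (pathEdges t.A ∩ pathEdges t.B ∩ pathEdges t.C).card

/-- The edges contained in at least two of the three paths. -/
def commonEdges : Finset (Sym2 (Fin n)) :=
  (pathEdges t.A ∩ pathEdges t.B) ∪ (pathEdges t.A ∩ pathEdges t.C) ∪
    (pathEdges t.B ∩ pathEdges t.C)

end EdgeOrderedTriple

/-! ### Edge-ordered graphs whose edges carry labels -/

/-- A graph with edge labels and an edge-ordering. The label of an edge says which of the three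
paths traverse it and in which direction: `trav i u v` means that `s(u, v)` is an edge which the
path `i` traverses from `u` to `v`. The relation `before` is the (strict) edge-ordering. -/
structure LabelledGraph where
  V : Type
  trav : Fin 3 → V → V → Prop
  before : Sym2 V → Sym2 V → Prop

namespace LabelledGraph

/-- The underlying graph. -/
def graph (G : LabelledGraph) : SimpleGraph G.V :=
  SimpleGraph.fromRel fun u v => ∃ i, G.trav i u v

/-- The set of those of the three paths that contain the edge `e`. -/
def paths (G : LabelledGraph) (e : Sym2 G.V) : Set (Fin 3) :=
  {i | ∃ u v, e = s(u, v) ∧ G.trav i u v}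

/-- A path of positive length all of whose edges are contained in exactly the same ones of the three
Hamiltonian paths. -/
def IsUniform (G : LabelledGraph) {u v : G.V} (p : G.graph.Walk u v) : Prop :=
  p.IsPath ∧ 0 < p.length ∧ ∀ e ∈ p.edges, ∀ f ∈ p.edges, G.paths e = G.paths f

/-- `v` is an interior vertex of a uniform path. -/
def IsInterior (G : LabelledGraph) (v : G.V) : Prop :=
  ∃ (u w : G.V) (p : G.graph.Walk u w), G.IsUniform p ∧ v ∈ p.support ∧ v ≠ u ∧ v ≠ w

/-- The graph obtained by collapsing each maximal uniform path to a single edge, keeping edge labels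
and the edge-ordering. A uniform path is maximal when neither of its end-points is an interior
vertex. -/
def collapse (G : LabelledGraph) : LabelledGraph where
  V := {v : G.V // ¬ G.IsInterior v}
  trav i u v := ∃ p : G.graph.Walk u.1 v.1, G.IsUniform p ∧ ∀ d ∈ p.darts, G.trav i d.fst d.snd
  before e f := ∃ (u v x y : {v : G.V // ¬ G.IsInterior v})
    (p : G.graph.Walk u.1 v.1) (q : G.graph.Walk x.1 y.1),
    e = s(u, v) ∧ f = s(x, y) ∧ G.IsUniform p ∧ G.IsUniform q ∧
      ∀ a ∈ p.edges, ∀ b ∈ q.edges, G.before a b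

/-- Two edge-ordered labelled graphs are isomorphic if some bijection of the vertices preserves the
edges with their labels and the edge-ordering. -/
def Isomorphic (G H : LabelledGraph) : Prop :=
  ∃ g : G.V ≃ H.V, (∀ i u v, G.trav i u v ↔ H.trav i (g u) (g v)) ∧
    ∀ e f, G.before e f ↔ H.before (e.map g) (f.map g)

instance isoSetoid : Setoid LabelledGraph where
  r := Isomorphic
  iseqv := by
    refine ⟨fun G => ⟨Equiv.refl _, by simp, by simp⟩, ?_, ?_⟩
    · rintro G H ⟨g, h1, h2⟩
      refine ⟨g.symm, fun i u v => by simp [h1], fun e f => ?_⟩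
      rw [h2, Sym2.map_map, Sym2.map_map]
      simp
    · rintro G H K ⟨g, h1, h2⟩ ⟨k, k1, k2⟩
      refine ⟨g.trans k, fun i u v => by simp [h1, k1], fun e f => ?_⟩
      rw [h2, k2, Sym2.map_map, Sym2.map_map]
      rfl

/-- Each component consists of a single edge which is common to precisely two of the paths. -/
def IsGood (G : LabelledGraph) : Prop :=
  ∀ K : G.graph.ConnectedComponent, ∃ u v, G.graph.Adj u v ∧ K.supp = {u, v} ∧
    (G.paths s(u, v)).ncard = 2

theorem IsGood.of_isomorphic {G H : LabelledGraph} (h : G.Isomorphic H) (hG : G.IsGood) :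
    H.IsGood := by
  obtain ⟨g, h1, -⟩ := h
  let k : G.graph ≃g H.graph := ⟨g, by
    intro a b
    simp [graph, SimpleGraph.fromRel_adj, h1]⟩
  intro K
  obtain ⟨u, v, huv, hK, hc⟩ := hG (K.map k.symm.toHom)
  refine ⟨g u, g v, k.map_rel_iff.2 huv, ?_, ?_⟩
  · ext x
    have hx : x ∈ K.supp ↔ g.symm x ∈ (K.map k.symm.toHom).supp := by
      induction K using SimpleGraph.ConnectedComponent.ind with
      | h y =>
        simp only [SimpleGraph.ConnectedComponent.map_mk,
          SimpleGraph.ConnectedComponent.mem_supp_iff, SimpleGraph.ConnectedComponent.eq]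
        exact (SimpleGraph.Iso.reachable_iff (φ := k.symm)).symm
    rw [hx, hK]
    simp [Equiv.symm_apply_eq]
  · rw [← hc]
    congr 1
    ext i
    constructor
    · rintro ⟨a, b, hab, ht⟩
      refine ⟨g.symm a, g.symm b, ?_, by simpa [h1] using ht⟩
      have := congrArg (Sym2.map g.symm) hab
      simpa using this
    · rintro ⟨a, b, hab, ht⟩
      refine ⟨g a, g b, ?_, (h1 i a b).1 ht⟩
      have := congrArg (Sym2.map g) hab
      simpa using this

end LabelledGraph

/-- The common edge graph of an edge-ordered triple: the edges contained in at least two of the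
paths, and the vertices incident to them. -/
def EdgeOrderedTriple.commonEdgeGraph {n : ℕ} (t : EdgeOrderedTriple n) : LabelledGraph where
  V := {v : Fin n // ∃ e ∈ t.commonEdges, v ∈ e}
  trav i u v := s(u.1, v.1) ∈ t.commonEdges ∧ Traverses (t.path i) u.1 v.1
  before e f := e.map Subtype.val ∈ t.commonEdges ∧ f.map Subtype.val ∈ t.commonEdges ∧
    ∃ a b : (pathEdges t.A ∪ pathEdges t.B ∪ pathEdges t.C : Finset (Sym2 (Fin n))),
      a.1 = e.map Subtype.val ∧ b.1 = f.map Subtype.val ∧ t.order a < t.order b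

/-- The isomorphism class of the reduced common edge graph of an edge-ordered triple. -/
def EdgeOrderedTriple.reducedClass {n : ℕ} (t : EdgeOrderedTriple n) :
    Quotient LabelledGraph.isoSetoid :=
  Quotient.mk _ t.commonEdgeGraph.collapse

/-- Reduced common edge graphs, up to isomorphism. -/
def ReducedGraph : Type 1 :=
  {q : Quotient LabelledGraph.isoSetoid // ∃ (n : ℕ) (t : EdgeOrderedTriple n), t.reducedClass = q}

/-- Each component is a single edge which is common to precisely two of the paths. -/
def ReducedGraph.IsGood (G : ReducedGraph) : Prop :=
  Quotient.lift LabelledGraph.IsGood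
    (fun _ _ h => propext ⟨LabelledGraph.IsGood.of_isomorphic h,
      LabelledGraph.IsGood.of_isomorphic (Setoid.symm h)⟩) G.1

/-- The number of edge-ordered triples of Hamiltonian paths on `n` vertices that have reduced common
edge graph `G` and common edge counts `c`. -/
def tripleCount (n : ℕ) (G : ReducedGraph) (c : EdgeCounts) : ℕ :=
  Nat.card {t : EdgeOrderedTriple n // t.reducedClass = G.1 ∧ t.counts = c}

/-- The term `t_n(G, c)`: the number of triples divided by `|A ∪ B ∪ C| !`. (The natural-number
subtraction truncates only where the number of triples is zero.) -/
def term (n : ℕ) (G : ReducedGraph) (c : EdgeCounts) : ℝ :=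
  (tripleCount n G c : ℝ) /
    (Nat.factorial (3 * n - 3 - c.AB - c.AC - c.BC - 2 * c.ABC) : ℝ)

/-- The pairs `(G, c)` such that `G` is not good or `c_AB + c_AC + c_BC > M`. -/
def exceptionalPairs (M : ℕ) : Set (ReducedGraph × EdgeCounts) :=
  {p | ¬ p.1.IsGood ∨ M < p.2.AB + p.2.AC + p.2.BC}

end HamTriples

end

/-! The third moment is the sum over triples (A, B, C) of the probability `w3` that all three paths
are increasing. Since the restriction of a uniform order is uniform, the paths can be exposed one at
a time. The sum over A is at most n. Given an order u on the set H of edges exposed so far, it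
remains to bound the conditional expected number of increasing paths C, weighted by how C meets H;
such bounds multiply (`tsum3_le`).

For one exposure, paths are grouped by their trail, the list of directed edges of C that lie in H,
in the order of C. Suppose it has t edges, λ of which directly follow the previous one, so that it
has k = t - λ runs. A pair of C and an extension of u is determined by the multiset of slots of the
new edges among the edges of H, of which λ slots are forbidden, together with an arrangement of the
vertices off the trail (`sum_ext_trail_le`). When t is small the resulting weight `W` is about n,
times O(1/n) for each run, times a factor at most 7/10 for each link. Trails increase in u, so these
weights are summed by a transfer matrix with an explicit supersolution (`sum_chainWeight_le`,
`potential_trans`). A jump to a new run has O(n) targets of weight O(1/n). A link inside one of the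
two paths forming H has only one continuation.

The difficulty is that a trail in A ∪ B can switch between the two paths, where up to two further
continuations appear, too many for the factor 7/10. Each switch is therefore given a small weight x.
It has to be paid for elsewhere: the switches of C in A ∪ B number at most twice the runs of B in C
(`switches_le_runs`). Runs of B in C are visible only when C is exposed before B, so the exposure
orders A, B, C and C, B, A are combined by the inequality of arithmetic and geometric means: each
pays for the other's switches.

If all pairs overlap little and no switch is possible, a weight 11/10 per common edge gives the
exponential decay in M (`tsum3_far_le`). If a common edge of one pair touches a common edge of
another, the last path must hit a set of size O(|A ∩ B|), and a factor n is lost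
(`tsum3_far_bad_le`). For a pair with intermediate overlap an exponentially small binomial ratio
beats all losses (`tsum3_mid_le`). A pair agreeing in all but m edges costs only O(1) for its second
path, even with weight 4^(9m), which absorbs the branching caused by those m edges
(`tsum3_near_far_le`, `tsum3_near_near_le`).

Finally, if no common edges of different pairs touch, every component of the common edge graph is a
segment of one path, lies in exactly two of the paths, and collapses to a single edge
(`isGood_collapse`). So every exceptional triple is covered by these estimates. The finitely many
small n are absorbed by the constant K₂. -/

noncomputable section
namespace HamTriples

/-! ### Edges of a path -/

section PathEdges
variable {K : ℕ}

/-- The `k`-th directed edge of a path. -/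
def dedge (C : HamPath (K + 1)) (k : Fin K) : Fin (K + 1) × Fin (K + 1) :=
  (C k.castSucc, C k.succ)

/-- The `k`-th edge of a path. -/
def edge (C : HamPath (K + 1)) (k : Fin K) : Sym2 (Fin (K + 1)) :=
  s(C k.castSucc, C k.succ)

theorem traverses_iff {C : HamPath (K + 1)} {u v : Fin (K + 1)} :
    Traverses C u v ↔ ∃ k : Fin K, u = C k.castSucc ∧ v = C k.succ := by
  constructor
  · intro h
    have hv := (C.symm v).2
    unfold Traverses at h
    refine ⟨⟨C.symm u, by omega⟩, ?_, ?_⟩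
    · rw [← Equiv.symm_apply_eq]; ext; simp
    · rw [← Equiv.symm_apply_eq]; ext; simp [h]
  · rintro ⟨k, rfl, rfl⟩
    simp [Traverses]

theorem mem_pathEdges {C : HamPath (K + 1)} {e : Sym2 (Fin (K + 1))} :
    e ∈ pathEdges C ↔ ∃ k, edge C k = e := by
  simp only [pathEdges, mem_filter, mem_univ, true_and, traverses_iff, edge]
  constructor
  · rintro ⟨u, v, rfl, k, rfl, rfl⟩; exact ⟨k, rfl⟩
  · rintro ⟨k, rfl⟩; exact ⟨_, _, rfl, k, rfl, rfl⟩

theorem edge_mem (C : HamPath (K + 1)) (k : Fin K) : edge C k ∈ pathEdges C :=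
  mem_pathEdges.2 ⟨k, rfl⟩

theorem edge_injective (C : HamPath (K + 1)) : Function.Injective (edge C) := by
  intro i j h
  simp only [edge, Sym2.eq_iff, EmbeddingLike.apply_eq_iff_eq] at h
  rcases h with ⟨h, -⟩ | ⟨h1, h2⟩
  · exact Fin.castSucc_injective _ h
  · have a := congrArg Fin.val h1
    have b := congrArg Fin.val h2
    simp at a b
    omega

theorem pathEdges_eq_image (C : HamPath (K + 1)) : pathEdges C = univ.image (edge C) := by
  ext e; simp [mem_pathEdges]

theorem card_pathEdges (C : HamPath (K + 1)) : (pathEdges C).card = K := by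
  rw [pathEdges_eq_image, card_image_of_injective _ (edge_injective C)]; simp

theorem pathEdges_subset_allEdges (C : HamPath (K + 1)) : pathEdges C ⊆ allEdges (K + 1) := by
  intro e he
  obtain ⟨k, rfl⟩ := mem_pathEdges.1 he
  simp only [allEdges, SimpleGraph.mem_edgeFinset, edge, SimpleGraph.mem_edgeSet,
    SimpleGraph.top_adj]
  intro h
  exact Fin.castSucc_lt_succ.ne (C.injective h)

theorem isIncreasing_iff {C : HamPath (K + 1)} {S : Finset (Sym2 (Fin (K + 1)))}
    (hS : pathEdges C ⊆ S) (σ : EdgeOrder S) :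
    IsIncreasing C σ ↔ ∀ i j : Fin K, i < j →
      σ ⟨edge C i, hS (edge_mem C i)⟩ < σ ⟨edge C j, hS (edge_mem C j)⟩ := by
  constructor
  · intro h
    obtain _ | K := K
    · intro i; exact i.elim0
    have : StrictMono fun i : Fin (K + 1) => σ ⟨edge C i, hS (edge_mem C i)⟩ := by
      rw [Fin.strictMono_iff_lt_succ]
      intro i
      refine h _ _ (C i.castSucc.castSucc) (C i.castSucc.succ) (C i.succ.succ) ?_ ?_ rfl ?_
      · exact traverses_iff.2 ⟨_, rfl, rfl⟩
      · exact traverses_iff.2 ⟨i.succ, by rw [Fin.castSucc_succ], rfl⟩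
      · simp only [edge]; rw [Fin.castSucc_succ]
    intro i j hij
    exact this hij
  · intro h e f u v w huv hvw he hf
    obtain ⟨i, rfl, rfl⟩ := traverses_iff.1 huv
    obtain ⟨j, hj, rfl⟩ := traverses_iff.1 hvw
    have hij : i < j := by
      have := congrArg Fin.val (C.injective hj)
      simp at this
      exact Fin.lt_def.2 (by omega)
    have := h i j hij
    have h1 : e = ⟨edge C i, hS (edge_mem C i)⟩ := Subtype.ext he
    have h2 : f = ⟨edge C j, hS (edge_mem C j)⟩ := by
      refine Subtype.ext ?_
      rw [hf, hj]; rfl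
    rw [h1, h2]
    exact this

end PathEdges

/-! ### Restriction of orders -/

section Restrict

theorem exists_rank {α : Type*} [Fintype α] {k N : ℕ} (hk : Fintype.card α = k) (f : α → Fin N)
    (hf : Function.Injective f) : ∃ e : α ≃ Fin k, ∀ a b, e a < e b ↔ f a < f b := by
  classical
  have hc : (univ.image f).card = k := by
    rw [card_image_of_injective _ hf, card_univ, hk]
  let g : α ≃ (univ.image f) := Equiv.ofBijective (fun a => ⟨f a, mem_image_of_mem _ (mem_univ _)⟩)
    ⟨fun a b h => hf (congrArg Subtype.val h), by
      rintro ⟨b, hb⟩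
      obtain ⟨a, -, rfl⟩ := mem_image.1 hb
      exact ⟨a, rfl⟩⟩
  refine ⟨g.trans ((univ.image f).orderIsoOfFin hc).symm.toEquiv, fun a b => ?_⟩
  simp only [Equiv.trans_apply, RelIso.coe_fn_toEquiv, OrderIso.lt_iff_lt]
  exact Iff.rfl

theorem orderEquiv_unique {α : Type*} {k : ℕ} {e f : α ≃ Fin k}
    (h : ∀ a b, e a < e b ↔ f a < f b) : e = f := by
  let g : Fin k ≃o Fin k := (StrictMono.orderIsoOfSurjective (e.symm.trans f)
    (by intro a b hab; have := (h (e.symm a) (e.symm b)).1 (by simpa using hab); simpa using this)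
    (e.symm.trans f).surjective)
  have : g = OrderIso.refl _ := Subsingleton.elim _ _
  ext a
  have := DFunLike.congr_fun this (e a)
  simp [g] at this
  rw [this]

variable {n : ℕ} {H S : Finset (Sym2 (Fin n))}

theorem exists_restrict (h : H ⊆ S) (σ : EdgeOrder S) :
    ∃ u : EdgeOrder H, ∀ a b, u a < u b ↔ σ ⟨a.1, h a.2⟩ < σ ⟨b.1, h b.2⟩ :=
  exists_rank (by simp) (fun a : H => σ ⟨a.1, h a.2⟩) fun a b hab => by
    have := σ.injective hab
    exact Subtype.ext (congrArg (fun x : S => x.1) this)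

/-- The restriction of an edge-ordering to a subset. -/
def restrict (h : H ⊆ S) (σ : EdgeOrder S) : EdgeOrder H := (exists_restrict h σ).choose

theorem restrict_lt (h : H ⊆ S) (σ : EdgeOrder S) (a b : H) :
    restrict h σ a < restrict h σ b ↔ σ ⟨a.1, h a.2⟩ < σ ⟨b.1, h b.2⟩ :=
  (exists_restrict h σ).choose_spec a b

theorem eq_restrict (h : H ⊆ S) {σ : EdgeOrder S} {u : EdgeOrder H}
    (hu : ∀ a b, u a < u b ↔ σ ⟨a.1, h a.2⟩ < σ ⟨b.1, h b.2⟩) : restrict h σ = u :=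
  orderEquiv_unique fun a b => by rw [restrict_lt, hu]

theorem isIncreasing_restrict {K : ℕ} {H S : Finset (Sym2 (Fin (K + 1)))} {C : HamPath (K + 1)}
    (hC : pathEdges C ⊆ H) (h : H ⊆ S) (σ : EdgeOrder S) :
    IsIncreasing C (restrict h σ) ↔ IsIncreasing C σ := by
  rw [isIncreasing_iff hC, isIncreasing_iff (hC.trans h)]
  simp only [restrict_lt]

/-- Permuting the edges of `H` by `v.trans u.symm` and fixing the rest of `S` maps one fibre of the
restriction injectively into the other. As `u` and `v` are arbitrary, all fibres have the same size.
-/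
theorem card_fibre_restrict_le (h : H ⊆ S) (u v : EdgeOrder H) :
    (univ.filter fun σ : EdgeOrder S => restrict h σ = u).card ≤
      (univ.filter fun σ : EdgeOrder S => restrict h σ = v).card := by
  classical
  let g : Equiv.Perm H := v.trans u.symm
  let i : H ≃ {s : S // s.1 ∈ H} :=
    ⟨fun a => ⟨⟨a.1, h a.2⟩, a.2⟩, fun a => ⟨a.1.1, a.2⟩, fun _ => rfl, fun _ => rfl⟩
  let G : Equiv.Perm S := g.extendDomain i
  have hG : ∀ a : H, G ⟨a.1, h a.2⟩ = ⟨(g a).1, h (g a).2⟩ := fun a =>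
    Equiv.Perm.extendDomain_apply_image g i a
  refine card_le_card_of_injOn (fun σ => G.trans σ) ?_ ?_
  · intro σ hσ
    simp only [coe_filter, mem_univ, true_and, Set.mem_ofPred_eq] at hσ ⊢
    refine eq_restrict h fun a b => ?_
    simp only [Equiv.trans_apply, hG]
    rw [← restrict_lt h, hσ]
    simp [g]
  · intro σ _ τ _ hst
    ext x
    have := DFunLike.congr_fun hst (G.symm x)
    simpa using congrArg Fin.val this

/-- A uniformly random order restricts to a uniformly random order, because all fibres have a common
size `c`. Hence the probability of an event about `H` can be computed in any larger edge set. -/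
theorem card_filter_restrict (h : H ⊆ S) (U : EdgeOrder H → Prop) [DecidablePred U] :
    ((univ.filter fun σ : EdgeOrder S => U (restrict h σ)).card : ℝ) / (S.card.factorial : ℝ) =
      ((univ.filter U).card : ℝ) / (H.card.factorial : ℝ) := by
  classical
  obtain ⟨u₀⟩ : Nonempty (EdgeOrder H) := ⟨H.equivFin⟩
  set c := (univ.filter fun σ : EdgeOrder S => restrict h σ = u₀).card
  have hc : ∀ u, (univ.filter fun σ : EdgeOrder S => restrict h σ = u).card = c := fun u =>
    le_antisymm (card_fibre_restrict_le h _ _) (card_fibre_restrict_le h _ _)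
  have key : ∀ (U : EdgeOrder H → Prop) [DecidablePred U],
      (univ.filter fun σ : EdgeOrder S => U (restrict h σ)).card = (univ.filter U).card * c := by
    intro U _
    rw [card_eq_sum_card_fiberwise (f := restrict h) (t := univ.filter U)
      (by intro σ hσ; simpa using hσ)]
    rw [← smul_eq_mul, ← sum_const]
    refine sum_congr rfl fun u hu => ?_
    rw [← hc u, filter_filter]
    congr 1
    ext σ
    simp only [mem_filter, mem_univ, true_and, and_iff_right_iff_imp]
    rintro rfl
    simpa using hu
  have hall := key (fun _ => True)
  simp only [filter_true, card_univ] at hall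
  have e1 : Fintype.card (EdgeOrder S) = S.card.factorial := by
    rw [Fintype.card_equiv S.equivFin]; simp
  have e2 : Fintype.card (EdgeOrder H) = H.card.factorial := by
    rw [Fintype.card_equiv H.equivFin]; simp
  rw [e1, e2] at hall
  rw [key U, hall]
  have hH : (H.card.factorial : ℝ) ≠ 0 := by positivity
  have hc0 : (c : ℝ) ≠ 0 := by
    intro h0
    have h0' : c = 0 := by exact_mod_cast h0
    rw [h0', mul_zero] at hall
    exact Nat.factorial_ne_zero _ hall
  push_cast
  field_simp

end Restrict

/-! ### Weights of pairs and triples -/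

section Weights
variable {K : ℕ}
open Classical in
/-- The number of extensions of the order `u` to the edges of `C` for which `C` is increasing. -/
def ext {n : ℕ} {H : Finset (Sym2 (Fin n))} (u : EdgeOrder H) (C : HamPath n) : ℕ :=
  (univ.filter fun σ : EdgeOrder (H ∪ pathEdges C) =>
    restrict subset_union_left σ = u ∧ IsIncreasing C σ).card

open Classical in
/-- The probability that `A` is increasing. -/
def w1 {n : ℕ} (A : HamPath n) : ℝ :=
  ((univ.filter fun σ : EdgeOrder (pathEdges A) => IsIncreasing A σ).card : ℝ) /
    ((pathEdges A).card.factorial : ℝ)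

open Classical in
/-- The probability that `A` and `B` are increasing. -/
def w2 {n : ℕ} (A B : HamPath n) : ℝ :=
  ((univ.filter fun σ : EdgeOrder (pathEdges A ∪ pathEdges B) =>
    IsIncreasing A σ ∧ IsIncreasing B σ).card : ℝ) /
    ((pathEdges A ∪ pathEdges B).card.factorial : ℝ)

open Classical in
/-- The probability that `A`, `B` and `C` are increasing. -/
def w3 {n : ℕ} (A B C : HamPath n) : ℝ :=
  ((univ.filter fun σ : EdgeOrder (pathEdges A ∪ pathEdges B ∪ pathEdges C) =>
    IsIncreasing A σ ∧ IsIncreasing B σ ∧ IsIncreasing C σ).card : ℝ) /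
    ((pathEdges A ∪ pathEdges B ∪ pathEdges C).card.factorial : ℝ)

theorem w3_nonneg {n : ℕ} (A B C : HamPath n) : 0 ≤ w3 A B C := by unfold w3; positivity

theorem w3_swap_left {n : ℕ} (A B C : HamPath n) : w3 A B C = w3 B A C := by
  unfold w3
  rw [union_comm (pathEdges A) (pathEdges B)]
  congr 3
  ext σ
  simp only [mem_filter]
  tauto

theorem w3_swap_right {n : ℕ} (A B C : HamPath n) : w3 A B C = w3 A C B := by
  unfold w3
  rw [union_right_comm]
  congr 3
  ext σ
  simp only [mem_filter]
  tauto

/-- Only one order of its `K` edges makes a path increasing, and (K+1)! / K! = K+1. -/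
theorem sum_w1_le : ∑ A : HamPath (K + 1), w1 A ≤ (K + 1 : ℝ) := by
  classical
  have h : ∀ A : HamPath (K + 1), w1 A ≤ 1 / (K.factorial : ℝ) := by
    intro A
    have hK : ((pathEdges A).card.factorial : ℝ) = K.factorial := by rw [card_pathEdges]
    unfold w1
    rw [hK]
    gcongr
    have : (univ.filter fun σ : EdgeOrder (pathEdges A) => IsIncreasing A σ).card ≤ 1 := by
      rw [card_le_one]
      intro σ hσ τ hτ
      simp only [mem_filter, mem_univ, true_and] at hσ hτ
      rw [isIncreasing_iff subset_rfl] at hσ hτ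
      have lt_iff : ∀ ρ : EdgeOrder (pathEdges A), (∀ i j : Fin K, i < j →
          ρ ⟨edge A i, edge_mem A i⟩ < ρ ⟨edge A j, edge_mem A j⟩) → ∀ i j : Fin K,
          ρ ⟨edge A i, edge_mem A i⟩ < ρ ⟨edge A j, edge_mem A j⟩ ↔ i < j := by
        intro ρ hρ i j
        have : StrictMono fun i : Fin K => ρ ⟨edge A i, edge_mem A i⟩ := fun i j => hρ i j
        exact this.lt_iff_lt
      refine orderEquiv_unique ?_
      rintro ⟨a, ha⟩ ⟨b, hb⟩
      obtain ⟨i, rfl⟩ := mem_pathEdges.1 ha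
      obtain ⟨j, rfl⟩ := mem_pathEdges.1 hb
      rw [lt_iff σ hσ, lt_iff τ hτ]
    exact_mod_cast this
  calc ∑ A : HamPath (K + 1), w1 A ≤ ∑ _A : HamPath (K + 1), 1 / (K.factorial : ℝ) :=
        sum_le_sum fun A _ => h A
    _ = (K + 1 : ℝ) := by
        rw [sum_const, card_univ, Fintype.card_perm, Fintype.card_fin, Nat.factorial_succ]
        have : (K.factorial : ℝ) ≠ 0 := by positivity
        simp only [nsmul_eq_mul]
        push_cast
        field_simp

/-- Summing over the extensions of the orders of `H` in a set `U`. -/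
theorem card_extend {n : ℕ} {H : Finset (Sym2 (Fin n))} (U : EdgeOrder H → Prop) [DecidablePred U]
    (C : HamPath n) [DecidablePred fun σ : EdgeOrder (H ∪ pathEdges C) =>
      U (restrict subset_union_left σ) ∧ IsIncreasing C σ] :
    (univ.filter fun σ : EdgeOrder (H ∪ pathEdges C) =>
      U (restrict subset_union_left σ) ∧ IsIncreasing C σ).card =
      ∑ u ∈ univ.filter U, ext u C := by
  classical
  rw [card_eq_sum_card_fiberwise (f := restrict subset_union_left) (t := univ.filter U)
    (by intro σ hσ; simp at hσ; simp [hσ.1])]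
  refine sum_congr rfl fun u hu => ?_
  unfold ext
  rw [filter_filter]
  congr 1
  ext σ
  simp only [mem_filter, mem_univ, true_and] at hu ⊢
  constructor
  · tauto
  · rintro ⟨rfl, h⟩; exact ⟨⟨hu, h⟩, rfl⟩

/-- One exposure step: `B` bounds the conditional expectation for each order `u` of `H`, and
averaging over `U` multiplies it by the probability of `U`. -/
theorem sum_extend_le {n : ℕ} {H : Finset (Sym2 (Fin n))} (U : EdgeOrder H → Prop)
    [DecidablePred U] (F : HamPath n → ℝ) (B : ℝ)
    (hB : ∀ u : EdgeOrder H, ∑ C, F C * (ext u C * (H.card.factorial : ℝ) /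
      ((H ∪ pathEdges C).card.factorial : ℝ)) ≤ B) :
    ∑ C, F C * (((∑ u ∈ univ.filter U, ext u C : ℕ) : ℝ) /
      ((H ∪ pathEdges C).card.factorial : ℝ)) ≤
      ((univ.filter U).card : ℝ) / (H.card.factorial : ℝ) * B := by
  have hH : (0 : ℝ) < H.card.factorial := by positivity
  calc _ = ∑ u ∈ univ.filter U, (∑ C, F C * (ext u C * (H.card.factorial : ℝ) /
      ((H ∪ pathEdges C).card.factorial : ℝ))) / (H.card.factorial : ℝ) := by
        simp_rw [sum_div]
        rw [sum_comm]
        refine sum_congr rfl fun C _ => ?_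
        push_cast
        rw [sum_div, mul_sum]
        refine sum_congr rfl fun u _ => ?_
        field_simp
    _ ≤ ∑ u ∈ univ.filter U, B / (H.card.factorial : ℝ) := by
        refine sum_le_sum fun u _ => ?_
        gcongr
        exact hB u
    _ = _ := by rw [sum_const, nsmul_eq_mul]; ring

theorem sum_w2_le (A : HamPath (K + 1)) (F : HamPath (K + 1) → ℝ) (D : ℝ)
    (hD : ∀ u : EdgeOrder (pathEdges A), ∑ B, F B * (ext u B * ((pathEdges A).card.factorial : ℝ) /
      ((pathEdges A ∪ pathEdges B).card.factorial : ℝ)) ≤ D) :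
    ∑ B, w2 A B * F B ≤ w1 A * D := by
  classical
  have := sum_extend_le (fun u => IsIncreasing A u) F D hD
  unfold w1
  refine le_trans (le_of_eq ?_) this
  refine sum_congr rfl fun B _ => ?_
  rw [← card_extend]
  unfold w2
  simp only [isIncreasing_restrict subset_rfl]
  rw [mul_comm]

theorem sum_w3_le (A B : HamPath (K + 1)) (F : HamPath (K + 1) → ℝ) (D : ℝ)
    (hD : ∀ u : EdgeOrder (pathEdges A ∪ pathEdges B),
      ∑ C, F C * (ext u C * ((pathEdges A ∪ pathEdges B).card.factorial : ℝ) /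
      ((pathEdges A ∪ pathEdges B ∪ pathEdges C).card.factorial : ℝ)) ≤ D) :
    ∑ C, w3 A B C * F C ≤ w2 A B * D := by
  classical
  have := sum_extend_le (fun u => IsIncreasing A u ∧ IsIncreasing B u) F D hD
  unfold w2
  refine le_trans (le_of_eq ?_) this
  refine sum_congr rfl fun C _ => ?_
  rw [← card_extend]
  unfold w3
  simp only [isIncreasing_restrict subset_union_left, isIncreasing_restrict subset_union_right,
    and_assoc]
  rw [mul_comm]

/-- The cube expands into triples, and whether three paths are increasing depends only on the order
restricted to their union. -/
theorem thirdMoment_eq : thirdMoment (K + 1) =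
    ∑ A : HamPath (K + 1), ∑ B : HamPath (K + 1), ∑ C : HamPath (K + 1), w3 A B C := by
  classical
  unfold thirdMoment
  rw [Fintype.expect_eq_sum_div_card]
  have h1 : ∀ ω : EdgeOrder (allEdges (K + 1)), (numIncreasing ω : ℝ) ^ 3 =
      ∑ A : HamPath (K + 1), ∑ B : HamPath (K + 1), ∑ C : HamPath (K + 1),
        if IsIncreasing A ω ∧ IsIncreasing B ω ∧ IsIncreasing C ω then 1 else 0 := by
    intro ω
    unfold numIncreasing
    rw [card_filter]
    push_cast
    rw [pow_succ, pow_two, sum_mul_sum, sum_mul]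
    refine sum_congr rfl fun A _ => ?_
    rw [sum_mul_sum]
    refine sum_congr rfl fun B _ => sum_congr rfl fun C _ => ?_
    by_cases hA : IsIncreasing A ω <;> by_cases hB : IsIncreasing B ω <;>
      by_cases hC : IsIncreasing C ω <;> simp [hA, hB, hC]
  simp_rw [h1]
  have e1 : Fintype.card (EdgeOrder (allEdges (K + 1))) = (allEdges (K + 1)).card.factorial := by
    rw [Fintype.card_equiv (allEdges (K + 1)).equivFin, Fintype.card_coe]
  rw [e1, sum_comm, sum_div]
  refine sum_congr rfl fun A _ => ?_
  rw [sum_comm, sum_div]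
  refine sum_congr rfl fun B _ => ?_
  rw [sum_comm, sum_div]
  refine sum_congr rfl fun C _ => ?_
  have hsub : pathEdges A ∪ pathEdges B ∪ pathEdges C ⊆ allEdges (K + 1) :=
    union_subset (union_subset (pathEdges_subset_allEdges A) (pathEdges_subset_allEdges B))
      (pathEdges_subset_allEdges C)
  have := card_filter_restrict hsub
    (fun u => IsIncreasing A u ∧ IsIncreasing B u ∧ IsIncreasing C u)
  unfold w3
  rw [← this]
  simp only [isIncreasing_restrict (subset_union_left.trans subset_union_left),
    isIncreasing_restrict (subset_union_right.trans subset_union_left),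
    isIncreasing_restrict subset_union_right]
  rw [← sum_filter]
  simp

end Weights

/-! ### Linked consecutive pairs in a list of directed edges -/

section Links
variable {α : Type*} [DecidableEq α]

open Classical in
/-- The number of consecutive pairs `d, d'` in a list of directed edges for which `d'` starts where
`d` ends and `r d d'` holds. -/
def links (r : α × α → α × α → Prop) : List (α × α) → ℕ
  | [] => 0
  | [_] => 0
  | d :: d' :: l => (if d.2 = d'.1 ∧ r d d' then 1 else 0) + links r (d' :: l)

/-- All directed edges of the list are steps of a path (with positions `pos`), in the order of the
path. -/
def IsPathList (pos : α → ℕ) (l : List (α × α)) : Prop :=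
  (∀ d ∈ l, pos d.2 = pos d.1 + 1) ∧ l.Pairwise fun d d' => pos d.1 < pos d'.1

open Classical in
/-- The vertices at which an edge of the list is followed by an edge related to it. -/
def linkVerts (r : α × α → α × α → Prop) (l : List (α × α)) : Finset α :=
  (l.toFinset.filter fun d => ∃ d' ∈ l, d.2 = d'.1 ∧ r d d').image Prod.snd

theorem mem_linkVerts {r : α × α → α × α → Prop} {l : List (α × α)} {v : α} :
    v ∈ linkVerts r l ↔ ∃ d ∈ l, ∃ d' ∈ l, d.2 = v ∧ d'.1 = v ∧ r d d' := by
  classical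
  simp only [linkVerts, mem_image, mem_filter, List.mem_toFinset]
  constructor
  · rintro ⟨d, ⟨hd, d', hd', h, hr⟩, rfl⟩; exact ⟨d, hd, d', hd', rfl, h.symm, hr⟩
  · rintro ⟨d, hd, d', hd', rfl, h, hr⟩; exact ⟨d, ⟨hd, d', hd', h.symm, hr⟩, rfl⟩

theorem IsPathList.eq_of_fst {pos : α → ℕ} {l : List (α × α)} (h : IsPathList pos l)
    {d d' : α × α} (hd : d ∈ l) (hd' : d' ∈ l) (e : pos d.1 = pos d'.1) : d = d' := by
  by_contra hne
  have : Std.Symm fun d d' : α × α => pos d.1 ≠ pos d'.1 := ⟨fun _ _ h => h.symm⟩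
  exact (h.2.imp (S := fun d d' => pos d.1 ≠ pos d'.1) fun h => h.ne).forall hd hd' hne e

/-- Edges with `d.2 = d'.1` occupy consecutive positions of the path, so they are neighbours in the
sorted list, and no vertex ends two edges. Links can therefore be counted as vertices, independently
of the order of the list. -/
theorem IsPathList.links_eq {pos : α → ℕ} (r : α × α → α × α → Prop) :
    ∀ {l : List (α × α)}, IsPathList pos l → links r l = (linkVerts r l).card
  | [], _ => by simp [links, linkVerts]
  | [d], h => by
      have := h.1 d (by simp)
      rw [links, eq_comm, card_eq_zero, eq_empty_iff_forall_notMem]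
      intro v hv
      obtain ⟨a, ha, b, hb, h1, h2, -⟩ := mem_linkVerts.1 hv
      simp only [List.mem_singleton] at ha hb
      subst ha; subst hb; subst h1
      rw [h2] at this; omega
  | d :: d' :: l, h => by
      classical
      have hd := h.1 d (by simp)
      have htail : IsPathList pos (d' :: l) :=
        ⟨fun e he => h.1 e (List.mem_cons_of_mem _ he), (List.pairwise_cons.1 h.2).2⟩
      have h1 := (List.pairwise_cons.1 h.2).1
      have h2 := (List.pairwise_cons.1 htail.2).1
      have key : linkVerts r (d :: d' :: l) =
          (if d.2 = d'.1 ∧ r d d' then {d.2} else ∅) ∪ linkVerts r (d' :: l) := by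
        ext v
        rw [mem_union, mem_linkVerts, mem_linkVerts]
        constructor
        · rintro ⟨a, ha, b, hb, rfl, hv, hr⟩
          have hb' : b ∈ d' :: l := by
            rcases List.mem_cons.1 hb with rfl | hb
            · exfalso
              have ha1 := h.1 a ha
              rw [← hv] at ha1
              rcases List.mem_cons.1 ha with rfl | ha
              · omega
              · have := h1 a ha; omega
            · exact hb
          rcases List.mem_cons.1 ha with rfl | ha
          · left
            have : b = d' := by
              rcases List.mem_cons.1 hb' with rfl | hb'
              · rfl
              · exfalso
                have q1 := h2 b hb'
                have q2 := h1 d' (by simp)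
                rw [hv] at q1
                omega
            subst this
            simp [hv, hr]
          · right; exact ⟨a, ha, b, hb', rfl, hv, hr⟩
        · rintro (hv | ⟨a, ha, b, hb, hh⟩)
          · split_ifs at hv with hc
            · simp only [mem_singleton] at hv
              exact ⟨d, by simp, d', by simp, hv.symm, by rw [hv, hc.1], hc.2⟩
            · simp at hv
          · exact ⟨a, List.mem_cons_of_mem _ ha, b, List.mem_cons_of_mem _ hb, hh⟩
      have hdisj : Disjoint (if d.2 = d'.1 ∧ r d d' then ({d.2} : Finset α) else ∅)
          (linkVerts r (d' :: l)) := by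
        rw [disjoint_left]
        intro v hv hv'
        split_ifs at hv with hc
        · simp only [mem_singleton] at hv
          obtain ⟨a, ha, b, hb, h3, -⟩ := mem_linkVerts.1 hv'
          have q1 := h.1 a (List.mem_cons_of_mem _ ha)
          have q2 := h1 a ha
          rw [h3, hv] at q1
          omega
        · simp at hv
      rw [links, key, card_union_of_disjoint hdisj, htail.links_eq]
      congr 1
      split_ifs <;> simp

end Links

/-! ### The trail of a path in a set of edges -/

section Trail
variable {K : ℕ}

open Classical in
/-- The directed edges of `C` that lie in `H`, in the order of `C`. -/
def trail (H : Finset (Sym2 (Fin (K + 1)))) (C : HamPath (K + 1)) :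
    List (Fin (K + 1) × Fin (K + 1)) :=
  ((List.finRange K).filter fun k => edge C k ∈ H).map (dedge C)

variable {H : Finset (Sym2 (Fin (K + 1)))} {C : HamPath (K + 1)}

theorem mem_trail {d : Fin (K + 1) × Fin (K + 1)} :
    d ∈ trail H C ↔ ∃ k, edge C k ∈ H ∧ dedge C k = d := by
  simp [trail]

theorem isPathList_trail : IsPathList (fun v => (C.symm v : ℕ)) (trail H C) := by
  constructor
  · intro d hd
    obtain ⟨k, -, rfl⟩ := mem_trail.1 hd
    simp [dedge]
  · rw [trail, List.pairwise_map]
    refine List.Pairwise.imp ?_ ((List.pairwise_lt_finRange K).filter _)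
    intro i j hij
    simpa [dedge] using hij

theorem dedge_injective (C : HamPath (K + 1)) : Function.Injective (dedge C) := by
  intro i j h
  have := congrArg (fun d => s(d.1, d.2)) h
  exact edge_injective C this

theorem nodup_trail : (trail H C).Nodup :=
  List.Nodup.map (dedge_injective C) ((List.nodup_finRange K).filter _)

theorem card_filter_fin (p : Fin K → Prop) [DecidablePred p] :
    (univ.filter p).card = ((List.finRange K).filter p).length := by
  rw [← List.toFinset_card_of_nodup ((List.nodup_finRange K).filter _)]
  congr 1
  ext; simp

open Classical in
theorem length_trail : (trail H C).length = (univ.filter fun k => edge C k ∈ H).card := by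
  rw [card_filter_fin, trail, List.length_map]

theorem length_trail_eq : (trail H C).length = (pathEdges C ∩ H).card := by
  classical
  rw [length_trail, ← card_image_of_injective _ (edge_injective C)]
  congr 1
  ext e
  simp only [mem_image, mem_filter, mem_univ, true_and, mem_inter, mem_pathEdges]
  constructor
  · rintro ⟨k, h, rfl⟩; exact ⟨⟨k, rfl⟩, h⟩
  · rintro ⟨⟨k, rfl⟩, h⟩; exact ⟨k, h, rfl⟩

theorem length_trail_le : (trail H C).length ≤ K := by
  rw [length_trail_eq]
  exact (card_le_card inter_subset_left).trans (card_pathEdges C).le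

open Classical in
theorem card_filter_notMem : (univ.filter fun k => edge C k ∉ H).card = K - (trail H C).length := by
  have := card_filter_add_card_filter_not (s := (univ : Finset (Fin K))) (fun k => edge C k ∈ H)
  rw [← length_trail, card_univ, Fintype.card_fin] at this
  omega

theorem card_union_pathEdges :
    (H ∪ pathEdges C).card = H.card + (K - (trail H C).length) := by
  have h1 := card_union_add_card_inter H (pathEdges C)
  rw [inter_comm, ← length_trail_eq, card_pathEdges] at h1
  have := length_trail_le (H := H) (C := C)
  omega

open Classical in
/-- The position of an edge in an order (`0` for edges outside). -/
def idx (u : EdgeOrder H) (e : Sym2 (Fin (K + 1))) : ℕ := if h : e ∈ H then u ⟨e, h⟩ else 0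

theorem idx_of_mem (u : EdgeOrder H) {e : Sym2 (Fin (K + 1))} (h : e ∈ H) :
    idx u e = u ⟨e, h⟩ := dif_pos h

theorem idx_lt (u : EdgeOrder H) {e : Sym2 (Fin (K + 1))} (h : e ∈ H) : idx u e < H.card := by
  rw [idx_of_mem u h]; exact (u _).2

theorem idx_inj (u : EdgeOrder H) {e f : Sym2 (Fin (K + 1))} (he : e ∈ H) (hf : f ∈ H)
    (h : idx u e = idx u f) : e = f := by
  rw [idx_of_mem u he, idx_of_mem u hf] at h
  simpa using u.injective (Fin.ext h)

/-- Compatible orders: an order on `H ∪ C` that extends `u` and makes `C` increasing. -/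
def Compat (u : EdgeOrder H) (C : HamPath (K + 1)) (σ : EdgeOrder (H ∪ pathEdges C)) : Prop :=
  restrict subset_union_left σ = u ∧ IsIncreasing C σ

/-- The value of an edge of `H` in the order. -/
abbrev hv (C : HamPath (K + 1)) (σ : EdgeOrder (H ∪ pathEdges C)) (h : H) :
    Fin (H ∪ pathEdges C).card := σ ⟨h.1, mem_union_left _ h.2⟩

/-- The value of an edge of `C` in the order. -/
abbrev cv (C : HamPath (K + 1)) (σ : EdgeOrder (H ∪ pathEdges C)) (k : Fin K) :
    Fin (H ∪ pathEdges C).card := σ ⟨edge C k, mem_union_right _ (edge_mem C k)⟩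

variable {u : EdgeOrder H} {σ : EdgeOrder (H ∪ pathEdges C)}

theorem Compat.hv_lt (h : Compat u C σ) (a b : H) : hv C σ a < hv C σ b ↔ u a < u b := by
  rw [← h.1, restrict_lt]

theorem Compat.strictMono (h : Compat u C σ) : StrictMono (cv C σ) := fun i j =>
  (isIncreasing_iff subset_union_right σ).1 h.2 i j

theorem hv_eq_cv {k : Fin K} (hk : edge C k ∈ H) : hv C σ ⟨edge C k, hk⟩ = cv C σ k := rfl

theorem Compat.pairwise (h : Compat u C σ) :
    (trail H C).Pairwise fun d d' => idx u s(d.1, d.2) < idx u s(d'.1, d'.2) := by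
  have : (trail H C).Pairwise fun d d' => d ∈ trail H C ∧ d' ∈ trail H C ∧
      C.symm d.1 < C.symm d'.1 :=
    List.Pairwise.imp_of_mem (fun ha hb h => ⟨ha, hb, h⟩) isPathList_trail.2
  refine this.imp ?_
  rintro d d' ⟨hd, hd', hlt⟩
  obtain ⟨i, hi, rfl⟩ := mem_trail.1 hd
  obtain ⟨j, hj, rfl⟩ := mem_trail.1 hd'
  have hij : i < j := by simpa [dedge] using hlt
  change idx u (edge C i) < idx u (edge C j)
  rw [idx_of_mem u hi, idx_of_mem u hj]
  have := (h.hv_lt ⟨_, hi⟩ ⟨_, hj⟩).1 (h.strictMono hij)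
  exact this

open Classical in
/-- The number of edges of `H` below the `k`-th edge of `C`. -/
def slot (C : HamPath (K + 1)) (σ : EdgeOrder (H ∪ pathEdges C)) (k : Fin K) : ℕ :=
  (univ.filter fun a : H => hv C σ a < cv C σ k).card

theorem slot_le (k : Fin K) : slot C σ k ≤ H.card := by
  classical
  unfold slot
  exact (card_le_univ _).trans (by simp)

theorem slot_mono (h : Compat u C σ) : Monotone (slot C σ) := by
  classical
  intro i j hij
  refine card_le_card fun a ha => ?_
  simp only [mem_filter, mem_univ, true_and] at ha ⊢
  exact ha.trans_le (h.strictMono.monotone hij)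

theorem card_below (u : EdgeOrder H) (a : H) [DecidablePred fun b : H => u b < u a] :
    (univ.filter fun b : H => u b < u a).card = idx u a.1 := by
  classical
  rw [idx_of_mem u a.2, ← card_map u.toEmbedding]
  have : (univ.filter fun b : H => u b < u a).map u.toEmbedding = Finset.Iio (u a) := by
    ext x
    simp only [Finset.mem_map, mem_filter, mem_univ, true_and, Equiv.coe_toEmbedding, mem_Iio]
    constructor
    · rintro ⟨b, hb, rfl⟩; exact hb
    · intro hx; exact ⟨u.symm x, by simpa using hx, by simp⟩
  rw [this, Fin.card_Iio]

/-- An edge of `C` outside `H` is below an edge of `H` iff its slot is at most the position of the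
latter. -/
theorem Compat.slot_le_iff (h : Compat u C σ) {k : Fin K} (hk : edge C k ∉ H) (a : H) :
    slot C σ k ≤ idx u a.1 ↔ cv C σ k < hv C σ a := by
  classical
  have hne : cv C σ k ≠ hv C σ a := by
    intro he
    have := σ.injective he
    simp only [Subtype.mk.injEq] at this
    exact hk (this ▸ a.2)
  rw [← card_below u a]
  constructor
  · intro hle
    by_contra hlt
    have hlt' : hv C σ a < cv C σ k := lt_of_le_of_ne (not_lt.1 hlt) hne.symm
    have : (univ.filter fun b : H => u b < u a) ⊂ univ.filter fun b : H => hv C σ b < cv C σ k := by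
      rw [ssubset_iff_of_subset]
      · exact ⟨a, by simp [hlt'], by simp⟩
      · intro b hb
        simp only [mem_filter, mem_univ, true_and] at hb ⊢
        exact ((h.hv_lt b a).2 hb).trans hlt'
    have := card_lt_card this
    unfold slot at hle
    omega
  · intro hlt
    unfold slot
    refine card_le_card fun b hb => ?_
    simp only [mem_filter, mem_univ, true_and] at hb ⊢
    exact (h.hv_lt b a).1 (hb.trans hlt)

open Classical in
/-- The multiset of slots of the edges of `C` outside `H`. -/
def slots (C : HamPath (K + 1)) (σ : EdgeOrder (H ∪ pathEdges C)) : Multiset ℕ :=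
  (univ.filter fun k => edge C k ∉ H).val.map (slot C σ)

open Classical in
theorem countP_slots (i : ℕ) : (slots C σ).countP (fun a => a ≤ i) =
    (univ.filter fun k => edge C k ∉ H ∧ slot C σ k ≤ i).card := by
  rw [slots, Multiset.countP_map, ← filter_filter, card_def]
  rfl

/-- An earlier edge of `C` is either in the trail, and then `u` shows that it is earlier, or outside
`H`, and then its slot shows it. So the trail and the multiset of slots determine where the trail
edges sit on `C`. -/
theorem Compat.position (h : Compat u C σ) {k : Fin K} (hk : edge C k ∈ H) :
    (k : ℕ) = (trail H C).countP (fun d => idx u s(d.1, d.2) < idx u (edge C k)) +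
      (slots C σ).countP (fun a => a ≤ idx u (edge C k)) := by
  classical
  have h1 : (trail H C).countP (fun d => idx u s(d.1, d.2) < idx u (edge C k)) =
      (univ.filter fun j => edge C j ∈ H ∧ j < k).card := by
    rw [trail, List.countP_map, List.countP_eq_length_filter, List.filter_filter, card_filter_fin]
    congr 2
    ext j
    simp only [Function.comp, Bool.decide_and]
    by_cases hj : edge C j ∈ H
    · have : idx u (edge C j) < idx u (edge C k) ↔ j < k := by
        rw [idx_of_mem u hj, idx_of_mem u hk, ← h.strictMono.lt_iff_lt]
        exact (h.hv_lt ⟨_, hj⟩ ⟨_, hk⟩).symm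
      have e : s((dedge C j).1, (dedge C j).2) = edge C j := rfl
      simp [hj, this, e]
    · simp [hj]
  have h2 : (slots C σ).countP (fun a => a ≤ idx u (edge C k)) =
      (univ.filter fun j => edge C j ∉ H ∧ j < k).card := by
    rw [countP_slots]
    congr 1
    ext j
    simp only [mem_filter, mem_univ, true_and, and_congr_right_iff]
    intro hj
    rw [h.slot_le_iff hj ⟨_, hk⟩, hv_eq_cv, h.strictMono.lt_iff_lt]
  rw [h1, h2]
  have h3 := card_filter_add_card_filter_not (s := univ.filter fun j : Fin K => j < k)
    (fun j => edge C j ∈ H)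
  rw [filter_filter, filter_filter] at h3
  simp only [and_comm] at h3 ⊢
  rw [h3]
  have : (univ.filter fun j : Fin K => j < k) = Finset.Iio k := by ext; simp
  rw [this, Fin.card_Iio]

/-- Slots increase weakly along `C`, so the new edges lying below `a` form an initial segment of the
new edges. The multiset of slots gives its length. -/
theorem Compat.lt_iff_countP (h : Compat u C σ) {k : Fin K} (hk : edge C k ∉ H) (a : H) :
    cv C σ k < hv C σ a ↔ (univ.filter fun j => edge C j ∉ H ∧ j < k).card <
      (slots C σ).countP (fun x => x ≤ idx u a.1) := by
  classical
  rw [← h.slot_le_iff hk, countP_slots]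
  constructor
  · intro hle
    refine card_lt_card ?_
    rw [ssubset_iff_of_subset]
    · exact ⟨k, by simp [hk, hle], by simp⟩
    · intro j hj
      simp only [mem_filter, mem_univ, true_and] at hj ⊢
      exact ⟨hj.1, (slot_mono h hj.2.le).trans hle⟩
  · intro hlt
    by_contra hle
    refine absurd hlt (not_lt.2 (card_le_card fun j hj => ?_))
    simp only [mem_filter, mem_univ, true_and] at hj ⊢
    refine ⟨hj.1, ?_⟩
    by_contra hjk
    exact hle ((slot_mono h (not_lt.1 hjk)).trans hj.2)

/-- Comparisons within `H` are given by `u`, those within `C` by monotonicity, and the mixed ones by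
the slots. -/
theorem Compat.eq_of_slots {τ : EdgeOrder (H ∪ pathEdges C)} (h : Compat u C σ) (h' : Compat u C τ)
    (hs : slots C σ = slots C τ) : σ = τ := by
  have key : ∀ x : (H ∪ pathEdges C : Finset _), (∃ a : H, x = ⟨a.1, mem_union_left _ a.2⟩) ∨
      ∃ k, edge C k ∉ H ∧ x = ⟨edge C k, mem_union_right _ (edge_mem C k)⟩ := by
    rintro ⟨x, hx⟩
    by_cases hxH : x ∈ H
    · exact Or.inl ⟨⟨x, hxH⟩, rfl⟩
    · obtain ⟨k, rfl⟩ := mem_pathEdges.1 ((mem_union.1 hx).resolve_left hxH)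
      exact Or.inr ⟨k, hxH, rfl⟩
  have swap : ∀ ρ : EdgeOrder (H ∪ pathEdges C), ∀ (a : H) (k : Fin K), edge C k ∉ H →
      (hv C ρ a < cv C ρ k ↔ ¬ cv C ρ k < hv C ρ a) := by
    intro ρ a k hk
    have hne : hv C ρ a ≠ cv C ρ k := by
      intro he
      have := ρ.injective he
      simp only [Subtype.mk.injEq] at this
      exact hk (this ▸ a.2)
    rw [not_lt]
    exact ⟨le_of_lt, fun h => lt_of_le_of_ne h hne⟩
  refine orderEquiv_unique fun x y => ?_
  rcases key x with ⟨a, rfl⟩ | ⟨k, hk, rfl⟩ <;> rcases key y with ⟨b, rfl⟩ | ⟨j, hj, rfl⟩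
  · exact (h.hv_lt a b).trans (h'.hv_lt a b).symm
  · refine (swap σ a j hj).trans (Iff.trans ?_ (swap τ a j hj).symm)
    rw [h.lt_iff_countP hj, h'.lt_iff_countP hj, hs]
  · exact (h.lt_iff_countP hk b).trans (by rw [hs]; exact (h'.lt_iff_countP hk b).symm)
  · exact h.strictMono.lt_iff_lt.trans h'.strictMono.lt_iff_lt.symm

/-- Between two consecutive edges of `C` in `H` there is no slot for other edges of `C`. -/
theorem Compat.slot_ne (h : Compat u C σ) {d d' : Fin (K + 1) × Fin (K + 1)} (hd : d ∈ trail H C)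
    (hd' : d' ∈ trail H C) (hdd : d.2 = d'.1) {k : Fin K} (hk : edge C k ∉ H) :
    slot C σ k ≠ idx u s(d'.1, d'.2) := by
  classical
  obtain ⟨i, hi, rfl⟩ := mem_trail.1 hd
  obtain ⟨j, hj, rfl⟩ := mem_trail.1 hd'
  have hij : (i : ℕ) + 1 = j := by
    have := congrArg Fin.val (C.injective hdd)
    simpa using this
  intro he
  have e : s((dedge C j).1, (dedge C j).2) = edge C j := rfl
  rw [e] at he
  have h1 := (h.slot_le_iff hk ⟨_, hj⟩).1 he.le
  rw [hv_eq_cv, h.strictMono.lt_iff_lt] at h1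
  have hji : idx u (edge C i) < idx u (edge C j) := by
    rw [idx_of_mem u hi, idx_of_mem u hj]
    exact (h.hv_lt ⟨_, hi⟩ ⟨_, hj⟩).1 (h.strictMono (Fin.lt_def.2 (by omega)))
  have h2 : ¬ slot C σ k ≤ idx u (edge C i) := by omega
  rw [h.slot_le_iff hk ⟨_, hi⟩, hv_eq_cv, h.strictMono.lt_iff_lt] at h2
  have h3 : k ≠ i := fun e => hk (e ▸ hi)
  have h4 : (k : ℕ) ≠ i := fun e => h3 (Fin.ext e)
  simp only [Fin.lt_def] at h1 h2
  omega

end Trail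

/-! ### Counting the paths with a given trail -/

theorem card_perm_agree_le {n : ℕ} (C₀ : Equiv.Perm (Fin n)) (T : Finset (Fin n)) :
    (univ.filter fun C : Equiv.Perm (Fin n) => ∀ v ∈ T, C.symm v = C₀.symm v).card ≤
      (n - T.card).factorial := by
  classical
  have h : Fintype.card {f : Equiv.Perm (Fin n) // ∀ a, ¬ a ∉ T → f a = a} =
      (n - T.card).factorial := by
    rw [← Fintype.card_congr (Equiv.Perm.subtypeEquivSubtypePerm fun a => a ∉ T),
      Fintype.card_perm]
    simp
  rw [← h, Fintype.card_subtype]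
  refine card_le_card_of_injOn (fun C => C.symm.trans C₀) ?_ ?_
  · intro C hC
    simp only [coe_filter, mem_univ, true_and, Set.mem_ofPred_eq, not_not] at hC ⊢
    intro a ha
    simp [hC a ha]
  · intro C _ C' _ hCC
    have : C.symm = C'.symm := by
      ext x
      have := DFunLike.congr_fun hCC x
      simp only [Equiv.trans_apply, EmbeddingLike.apply_eq_iff_eq] at this
      rw [this]
    simpa using congrArg Equiv.symm this

theorem card_multisets (G : Finset ℕ) (m : ℕ)
    (𝒮 : Finset (Multiset ℕ)) (h1 : ∀ s ∈ 𝒮, Multiset.card s = m) (h2 : ∀ s ∈ 𝒮, ∀ a ∈ s, a ∈ G) :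
    𝒮.card ≤ (G.card + m - 1).choose m := by
  classical
  have e : Fintype.card (Sym G m) = (G.card + m - 1).choose m := by
    rw [Sym.card_sym_eq_choose, Fintype.card_coe]
  rw [← e, ← card_univ]
  have hsub : 𝒮 ⊆ (univ : Finset (Sym G m)).image fun s => s.1.map Subtype.val := by
    intro s hs
    rw [mem_image]
    refine ⟨⟨s.attach.map fun a => ⟨a.1, h2 s hs a.1 a.2⟩, by simp [h1 s hs]⟩, mem_univ _, ?_⟩
    simp [Multiset.map_map]
  exact (card_le_card hsub).trans card_image_le

section Count
variable {K : ℕ} {H : Finset (Sym2 (Fin (K + 1)))}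

/-- The vertices on the edges of a list. -/
def listVerts {α : Type*} [DecidableEq α] (l : List (α × α)) : Finset α :=
  l.toFinset.image Prod.fst ∪ l.toFinset.image Prod.snd

theorem IsPathList.card_image_fst {α : Type*} [DecidableEq α] {pos : α → ℕ} {l : List (α × α)}
    (h : IsPathList pos l) (hn : l.Nodup) : (l.toFinset.image Prod.fst).card = l.length := by
  rw [card_image_of_injOn, List.toFinset_card_of_nodup hn]
  intro a ha b hb hab
  exact h.eq_of_fst (by simpa using ha) (by simpa using hb) (congrArg pos hab)

theorem IsPathList.card_image_snd {α : Type*} [DecidableEq α] {pos : α → ℕ} {l : List (α × α)}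
    (h : IsPathList pos l) (hn : l.Nodup) : (l.toFinset.image Prod.snd).card = l.length := by
  rw [card_image_of_injOn, List.toFinset_card_of_nodup hn]
  intro a ha b hb hab
  have ha' : a ∈ l := by simpa using ha
  have hb' : b ∈ l := by simpa using hb
  refine h.eq_of_fst ha' hb' ?_
  have h1 := h.1 a ha'
  have h2 := h.1 b hb'
  have h3 : pos a.2 = pos b.2 := congrArg pos hab
  omega

/-- There are `l.length` starting points and as many end points, and they overlap exactly in the
link vertices. -/
theorem IsPathList.card_listVerts {α : Type*} [DecidableEq α] {pos : α → ℕ} {l : List (α × α)}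
    (h : IsPathList pos l) (hn : l.Nodup) :
    (listVerts l).card + links (fun _ _ => True) l = 2 * l.length := by
  have h1 := card_union_add_card_inter (l.toFinset.image Prod.fst) (l.toFinset.image Prod.snd)
  have h2 : l.toFinset.image Prod.fst ∩ l.toFinset.image Prod.snd =
      linkVerts (fun _ _ => True) l := by
    ext v
    rw [mem_linkVerts]
    simp only [mem_inter, mem_image, List.mem_toFinset, and_true]
    constructor
    · rintro ⟨⟨a, ha, rfl⟩, b, hb, hv⟩; exact ⟨b, hb, a, ha, hv, rfl⟩
    · rintro ⟨b, hb, a, ha, rfl, hv⟩; exact ⟨⟨a, ha, hv⟩, b, hb, rfl⟩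
  rw [h2, ← h.links_eq, h.card_image_fst hn, h.card_image_snd hn] at h1
  unfold listVerts
  omega

open Classical in
/-- The number of compatible pairs with a given trail. -/
theorem sum_ext_trail_le (u : EdgeOrder H) (l : List (Fin (K + 1) × Fin (K + 1))) :
    ∑ C ∈ univ.filter (fun C => trail H C = l), ext u C ≤
      (K + 1 - (2 * l.length - links (fun _ _ => True) l)).factorial *
        (H.card - links (fun _ _ => True) l + (K - l.length)).choose (K - l.length) := by
  set lam := links (fun _ _ => True) l with hlam
  -- If the sum is nonzero there is a compatible pair; it shows that `l` is a duplicate-free path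
  -- list in `H` that increases in `u`.
  rcases eq_or_ne (∑ C ∈ univ.filter (fun C => trail H C = l), ext u C) 0 with h0 | h0
  · rw [h0]; exact Nat.zero_le _
  have hex : ∃ C₀ σ₀, trail H C₀ = l ∧ Compat u C₀ σ₀ := by
    by_contra hno
    push Not at hno
    apply h0
    refine sum_eq_zero fun C hC => ?_
    unfold ext
    rw [card_eq_zero, filter_eq_empty_iff]
    intro σ _ hσ
    exact hno C σ (by simpa using hC) hσ
  obtain ⟨C₀, σ₀, hC₀, hσ₀⟩ := hex
  have hpl : IsPathList (fun v => (C₀.symm v : ℕ)) l := hC₀ ▸ isPathList_trail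
  have hnd : l.Nodup := hC₀ ▸ nodup_trail
  have hlH : ∀ d ∈ l, s(d.1, d.2) ∈ H := by
    intro d hd
    rw [← hC₀] at hd
    obtain ⟨k, hk, rfl⟩ := mem_trail.1 hd
    exact hk
  have hlen : l.length ≤ K := hC₀ ▸ length_trail_le
  have hpw : l.Pairwise fun d d' => idx u s(d.1, d.2) < idx u s(d'.1, d'.2) := hC₀ ▸ hσ₀.pairwise
  -- The slot immediately below the second edge of a link is forbidden: no edge of `C` fits between
  -- two consecutive edges of `C`. This leaves |H| + 1 - `lam` slots.
  set forb : Finset ℕ := (l.toFinset.filter fun d => d.1 ∈ linkVerts (fun _ _ => True) l).image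
    fun d => idx u s(d.1, d.2) with hforb
  have hforbcard : forb.card = lam := by
    rw [hforb, card_image_of_injOn, hlam, hpl.links_eq,
      ← card_image_of_injOn (f := Prod.fst)]
    · congr 1
      ext v
      simp only [mem_image, mem_filter, List.mem_toFinset]
      constructor
      · rintro ⟨a, ⟨_, h⟩, rfl⟩; exact h
      · intro hv
        obtain ⟨_, _, a, ha, _, rfl, _⟩ := mem_linkVerts.1 hv
        exact ⟨a, ⟨ha, hv⟩, rfl⟩
    · intro a ha b hb hab
      simp only [coe_filter, List.mem_toFinset, Set.mem_ofPred_eq] at ha hb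
      exact hpl.eq_of_fst ha.1 hb.1 (by rw [hab])
    · intro a ha b hb hab
      simp only [coe_filter, List.mem_toFinset, Set.mem_ofPred_eq] at ha hb
      by_contra hne
      have : Std.Symm fun d d' : Fin (K + 1) × Fin (K + 1) =>
        idx u s(d.1, d.2) ≠ idx u s(d'.1, d'.2) := ⟨fun _ _ h => h.symm⟩
      exact (hpw.imp (S := fun d d' => idx u s(d.1, d.2) ≠ idx u s(d'.1, d'.2))
        fun h => h.ne).forall ha.1 hb.1 hne hab
  have hforbsub : forb ⊆ range H.card := by
    intro a ha
    obtain ⟨d, hd, rfl⟩ := mem_image.1 ha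
    simp only [mem_filter, List.mem_toFinset] at hd
    exact mem_range.2 (idx_lt u (hlH d hd.1))
  have hlamle : lam ≤ H.card := by
    rw [← hforbcard, ← card_range H.card]; exact card_le_card hforbsub
  set G : Finset ℕ := range (H.card + 1) \ forb with hG
  have hGcard : G.card = H.card + 1 - lam := by
    rw [hG, card_sdiff_of_subset (hforbsub.trans (range_subset_range.2 (Nat.le_succ _))), card_range,
      hforbcard]
  let PS : Finset (Σ C : HamPath (K + 1), EdgeOrder (H ∪ pathEdges C)) :=
    (univ.filter fun C => trail H C = l).sigma fun C => univ.filter fun σ => Compat u C σ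
  have hsum : ∑ C ∈ univ.filter (fun C => trail H C = l), ext u C = PS.card := by
    rw [card_sigma]
    refine sum_congr rfl fun C _ => ?_
    unfold ext Compat
    congr!
  have hmem : ∀ x ∈ PS, trail H x.1 = l ∧ Compat u x.1 x.2 := by
    intro x hx
    simpa [PS] using hx
  let f : (Σ C : HamPath (K + 1), EdgeOrder (H ∪ pathEdges C)) → Multiset ℕ := fun x => slots x.1 x.2
  have himg : (PS.image f).card ≤ (G.card + (K - l.length) - 1).choose (K - l.length) := by
    refine card_multisets G _ _ ?_ ?_
    · intro s hs
      obtain ⟨x, hx, rfl⟩ := mem_image.1 hs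
      simp only [f, slots, Multiset.card_map]
      rw [← (hmem x hx).1, ← card_filter_notMem]
      rfl
    · intro s hs a ha
      obtain ⟨x, hx, rfl⟩ := mem_image.1 hs
      simp only [f, slots, Multiset.mem_map, mem_val, mem_filter, mem_univ, true_and] at ha
      obtain ⟨k, hk, rfl⟩ := ha
      rw [hG, Finset.mem_sdiff, mem_range, Nat.lt_succ_iff]
      refine ⟨slot_le k, ?_⟩
      intro hin
      obtain ⟨d', hd', he⟩ := mem_image.1 hin
      simp only [mem_filter, List.mem_toFinset] at hd'
      obtain ⟨d, hd, e, _, h1, _, _⟩ := mem_linkVerts.1 hd'.2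
      obtain ⟨hx1, hx2⟩ := hmem x hx
      exact hx2.slot_ne (hx1 ▸ hd) (hx1 ▸ hd'.1) h1 hk he.symm
  have hcardV : (listVerts l).card = 2 * l.length - lam := by
    have := hpl.card_listVerts hnd
    omega
  -- For given slots the positions of all trail vertices are fixed (`Compat.position`) and only the
  -- other vertices can be permuted. The order is then recovered from `C` and the slots.
  have hfib : ∀ b ∈ PS.image f, (PS.filter fun x => f x = b).card ≤
      (K + 1 - (2 * l.length - lam)).factorial := by
    intro b hb
    obtain ⟨x₀, hx₀, rfl⟩ := mem_image.1 hb
    rw [← hcardV]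
    refine le_trans ?_ (card_perm_agree_le x₀.1 (listVerts l))
    refine card_le_card_of_injOn Sigma.fst ?_ ?_
    · intro x hx
      simp only [coe_filter, Set.mem_ofPred_eq, mem_univ, true_and] at hx ⊢
      obtain ⟨hx1, hx2⟩ := hmem x hx.1
      obtain ⟨h01, h02⟩ := hmem x₀ hx₀
      have hd : ∀ d ∈ l, x.1.symm d.1 = x₀.1.symm d.1 ∧ x.1.symm d.2 = x₀.1.symm d.2 := by
        intro d hd
        obtain ⟨i, hi, hid⟩ := mem_trail.1 (hx1 ▸ hd)
        obtain ⟨j, hj, hjd⟩ := mem_trail.1 (h01 ▸ hd)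
        have e : edge x.1 i = edge x₀.1 j := by
          change s((dedge x.1 i).1, (dedge x.1 i).2) = s((dedge x₀.1 j).1, (dedge x₀.1 j).2)
          rw [hid, hjd]
        have p1 := hx2.position hi
        have p2 := h02.position hj
        have hf : slots x.1 x.2 = slots x₀.1 x₀.2 := hx.2
        rw [hx1, hf, e] at p1
        rw [h01] at p2
        have hij : i = j := Fin.ext (p1.trans p2.symm)
        subst hij
        constructor
        · conv_lhs => rw [← hid]
          conv_rhs => rw [← hjd]
          simp [dedge]
        · conv_lhs => rw [← hid]
          conv_rhs => rw [← hjd]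
          simp [dedge]
      intro v hv
      simp only [listVerts, mem_union, mem_image, List.mem_toFinset] at hv
      rcases hv with ⟨d, hdl, rfl⟩ | ⟨d, hdl, rfl⟩
      · exact (hd d hdl).1
      · exact (hd d hdl).2
    · rintro ⟨C, σ⟩ hx ⟨C', σ'⟩ hx' hCC
      simp only [coe_filter, Set.mem_ofPred_eq] at hx hx'
      obtain rfl : C = C' := hCC
      have := (hmem _ hx.1).2.eq_of_slots (hmem _ hx'.1).2 (hx.2.trans hx'.2.symm)
      simp only at this
      rw [this]
  rw [hsum]
  have := card_le_mul_card_image (f := f) PS _ hfib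
  refine this.trans (Nat.mul_le_mul le_rfl (himg.trans (le_of_eq ?_)))
  congr 1
  omega

/-- The weight of a trail with `t` edges of which `lam` are linked to the previous one, in a set of
`L` edges. -/
def W (K L t lam : ℕ) : ℝ :=
  ((K + 1 - (2 * t - lam)).factorial : ℝ) * ((L - lam + (K - t)).choose (K - t) : ℝ) *
    (L.factorial : ℝ) / ((L + (K - t)).factorial : ℝ)

/-- The number of linked pairs. -/
abbrev nlinks {α : Type*} [DecidableEq α] (l : List (α × α)) : ℕ := links (fun _ _ => True) l

open Classical in
-- Both `F` and the number of new edges depend on `C` only through its trail, so each trail costs at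
-- most one `W`. Paths without a compatible order contribute zero and are dropped, which guarantees
-- that the surviving trails are increasing in `u`.
theorem sum_trail_le (u : EdgeOrder H) (𝒞 : Finset (HamPath (K + 1)))
    (F : List (Fin (K + 1) × Fin (K + 1)) → ℝ) (hF : ∀ l, 0 ≤ F l) :
    ∑ C ∈ 𝒞, F (trail H C) * (ext u C * (H.card.factorial : ℝ) /
      ((H ∪ pathEdges C).card.factorial : ℝ)) ≤
    ∑ l ∈ (𝒞.filter fun C => ∃ σ, Compat u C σ).image (trail H),
      F l * W K H.card l.length (nlinks l) := by
  have h1 : ∑ C ∈ 𝒞, F (trail H C) * (ext u C * (H.card.factorial : ℝ) /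
      ((H ∪ pathEdges C).card.factorial : ℝ)) =
      ∑ C ∈ 𝒞.filter (fun C => ∃ σ, Compat u C σ), F (trail H C) *
        (ext u C * (H.card.factorial : ℝ) / ((H ∪ pathEdges C).card.factorial : ℝ)) := by
    rw [sum_filter_of_ne]
    intro C _ hne
    by_contra hno
    push Not at hno
    apply hne
    have : ext u C = 0 := by
      unfold ext
      rw [card_eq_zero, filter_eq_empty_iff]
      intro σ _ hσ
      exact hno σ hσ
    simp [this]
  rw [h1, ← sum_fiberwise_of_maps_to (g := trail H) (fun C hC => mem_image_of_mem _ hC)]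
  refine sum_le_sum fun l _ => ?_
  calc _ = ∑ C ∈ (𝒞.filter fun C => ∃ σ, Compat u C σ).filter (fun C => trail H C = l),
        F l * (ext u C * (H.card.factorial : ℝ) / ((H.card + (K - l.length)).factorial : ℝ)) := by
        refine sum_congr rfl fun C hC => ?_
        rw [card_union_pathEdges, (mem_filter.1 hC).2]
    _ = F l * ((∑ C ∈ (𝒞.filter fun C => ∃ σ, Compat u C σ).filter (fun C => trail H C = l),
          ext u C : ℕ) : ℝ) * (H.card.factorial : ℝ) / ((H.card + (K - l.length)).factorial : ℝ) := by
        push_cast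
        rw [mul_sum, sum_mul, sum_div]
        exact sum_congr rfl fun C _ => by ring
    _ ≤ F l * (((K + 1 - (2 * l.length - nlinks l)).factorial *
        (H.card - nlinks l + (K - l.length)).choose (K - l.length) : ℕ) : ℝ) *
          (H.card.factorial : ℝ) / ((H.card + (K - l.length)).factorial : ℝ) := by
        gcongr
        · exact hF l
        · refine le_trans ?_ (sum_ext_trail_le u l)
          exact sum_le_sum_of_subset fun C hC => by
            simp only [mem_filter, mem_univ, true_and] at hC ⊢
            exact hC.2
    _ = _ := by unfold W; push_cast; ring

end Count

/-! ### Weighted sums over chains -/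

section Chains
variable {D : Type*}

/-- The weight of a list that follows `d`: the product of the transition weights, and of a final
weight. -/
def chainWeight (M : D → D → ℝ) (E : D → ℝ) : D → List D → ℝ
  | d, [] => E d
  | d, d' :: l => M d d' * chainWeight M E d' l

/-- Lists are split by their first element. The term `g []` is counted whether or not the empty list
belongs to `S`, hence the sign condition on it. -/
theorem sum_lists_le [DecidableEq D] (S : Finset (List D)) (U : Finset D) (g : List D → ℝ) (hg : 0 ≤ g [])
    (hU : ∀ d l, d :: l ∈ S → d ∈ U) :
    ∑ l ∈ S, g l ≤ g [] + ∑ d ∈ U, ∑ l ∈ (S.filter fun l => l.head? = some d).image List.tail,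
      g (d :: l) := by
  have h1 : ∀ d, ∑ l ∈ (S.filter fun l => l.head? = some d).image List.tail, g (d :: l) =
      ∑ l ∈ S.filter (fun l => l.head? = some d), g l := by
    intro d
    rw [sum_image]
    · refine sum_congr rfl fun l hl => ?_
      rw [mem_filter] at hl
      rw [List.cons_head?_tail hl.2]
    · intro l hl l' hl' h
      simp only [coe_filter, Set.mem_ofPred_eq] at hl hl'
      rw [← List.cons_head?_tail hl.2, ← List.cons_head?_tail hl'.2, h]
  simp_rw [h1]
  have h2 : ∑ l ∈ S, g l = ∑ l ∈ S.filter (fun l => l = []), g l +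
      ∑ l ∈ S.filter (fun l => ¬ l = []), g l := (sum_filter_add_sum_filter_not _ _ _).symm
  have h3 : ∑ l ∈ S.filter (fun l => l = []), g l ≤ g [] := by
    rw [← sum_singleton g []]
    refine sum_le_sum_of_subset_of_nonneg (fun l hl => by simpa using (mem_filter.1 hl).2) ?_
    intro l hl _
    rw [mem_singleton.1 hl]
    exact hg
  have h4 : ∑ l ∈ S.filter (fun l => ¬ l = []), g l =
      ∑ d ∈ U, ∑ l ∈ S.filter (fun l => l.head? = some d), g l := by
    rw [← sum_biUnion]
    · refine sum_congr ?_ fun _ _ => rfl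
      ext l
      simp only [mem_filter, mem_biUnion]
      constructor
      · rintro ⟨hl, hne⟩
        obtain ⟨d, l', rfl⟩ := List.exists_cons_of_ne_nil hne
        exact ⟨d, hU d l' hl, hl, rfl⟩
      · rintro ⟨d, -, hl, hd⟩
        refine ⟨hl, ?_⟩
        rintro rfl
        simp at hd
    · intro d _ d' _ hne
      rw [Function.onFun, disjoint_left]
      intro l hl hl'
      simp only [mem_filter] at hl hl'
      exact hne (Option.some_injective _ (hl.2.symm.trans hl'.2))
  rw [h2, h4]
  gcongr

theorem mem_image_tail [DecidableEq D] {S : Finset (List D)} {d : D} {l : List D} :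
    l ∈ (S.filter fun l => l.head? = some d).image List.tail ↔ d :: l ∈ S := by
  simp only [mem_image, mem_filter]
  constructor
  · rintro ⟨l', ⟨h1, h2⟩, rfl⟩
    rwa [List.cons_head?_tail h2]
  · intro h; exact ⟨_, ⟨h, rfl⟩, rfl⟩

variable (U : Finset D) (ix : D → ℕ)

/-- A list of elements of `U` along which `ix` increases. -/
def IsChainIn (l : List D) : Prop := (∀ d ∈ l, d ∈ U) ∧ l.Pairwise fun d d' => ix d < ix d'

variable {U ix}

theorem IsChainIn.tail {d : D} {l : List D} (h : IsChainIn U ix (d :: l)) : IsChainIn U ix l :=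
  ⟨fun e he => h.1 e (List.mem_cons_of_mem _ he), (List.pairwise_cons.1 h.2).2⟩

/-- A supersolution `V` of the transfer recursion dominates the total weight of all continuations.
The induction runs on `k`, a bound for the number of values of `ix` still available, so the base
case is vacuous. -/
theorem sum_chainWeight_le [DecidableEq D] {M : D → D → ℝ} {E V : D → ℝ} (hM : ∀ d d', 0 ≤ M d d')
    (hE : ∀ d, 0 ≤ E d)
    (hV : ∀ d ∈ U, E d + ∑ d' ∈ U.filter (fun d' => ix d < ix d'), M d d' * V d' ≤ V d) (L : ℕ)
    (hL : ∀ d ∈ U, ix d < L) :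
    ∀ (k : ℕ) (d : D), d ∈ U → L ≤ ix d + k → ∀ S : Finset (List D),
      (∀ l ∈ S, IsChainIn U ix (d :: l)) → ∑ l ∈ S, chainWeight M E d l ≤ V d := by
  intro k
  induction k with
  | zero =>
    intro d hd hk
    have := hL d hd
    omega
  | succ k ih =>
    intro d hd hk S hS
    refine le_trans ?_ (hV d hd)
    refine (sum_lists_le S (U.filter fun d' => ix d < ix d') _ (hE d) ?_).trans ?_
    · intro d' l hl
      have := hS _ hl
      rw [mem_filter]
      exact ⟨this.1 d' (by simp), (List.pairwise_cons.1 this.2).1 d' (by simp)⟩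
    · refine add_le_add le_rfl (sum_le_sum fun d' hd' => ?_)
      rw [mem_filter] at hd'
      simp only [chainWeight]
      rw [← mul_sum]
      refine mul_le_mul_of_nonneg_left (ih d' hd'.1 (by omega) _ ?_) (hM d d')
      intro l hl
      exact (hS _ (mem_image_tail.1 hl)).tail

/-- A chain meeting `Q` is cut at its first element in `Q`. From there on all continuations are
bounded by `V`, the source term of the recursion for `T`; before that only transition weights occur.
-/
theorem sum_chainWeight_touch_le [DecidableEq D] {M : D → D → ℝ} {E V T : D → ℝ} (hM : ∀ d d', 0 ≤ M d d')
    (hE : ∀ d, 0 ≤ E d)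
    (hV : ∀ d ∈ U, E d + ∑ d' ∈ U.filter (fun d' => ix d < ix d'), M d d' * V d' ≤ V d) (L : ℕ)
    (hL : ∀ d ∈ U, ix d < L) (Q : Finset D) (hT0 : ∀ d, 0 ≤ T d)
    (hT : ∀ d ∈ U, T d = (if d ∈ Q then V d else 0) +
      ∑ d' ∈ U.filter (fun d' => ix d < ix d'), M d d' * T d') :
    ∀ (k : ℕ) (d : D), d ∈ U → L ≤ ix d + k → ∀ S : Finset (List D),
      (∀ l ∈ S, IsChainIn U ix (d :: l) ∧ ∃ q ∈ d :: l, q ∈ Q) →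
      ∑ l ∈ S, chainWeight M E d l ≤ T d := by
  intro k
  induction k with
  | zero =>
    intro d hd hk
    have := hL d hd
    omega
  | succ k ih =>
    intro d hd hk S hS
    rw [hT d hd]
    by_cases hQ : d ∈ Q
    · rw [if_pos hQ]
      have := sum_chainWeight_le hM hE hV L hL (k + 1) d hd hk S fun l hl => (hS l hl).1
      refine this.trans (le_add_of_nonneg_right (sum_nonneg fun d' _ => ?_))
      exact mul_nonneg (hM _ _) (hT0 _)
    · rw [if_neg hQ]
      -- A chain that has not met `Q` cannot stop at `d`, so the end weight `E d` is removed.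
      set g : List D → ℝ := fun l => if l = [] then 0 else chainWeight M E d l with hg
      have hS' : ∀ l ∈ S, l ≠ [] := by
        rintro l hl rfl
        obtain ⟨-, q, hq, hqQ⟩ := hS _ hl
        simp only [List.mem_singleton] at hq
        exact hQ (hq ▸ hqQ)
      have h1 : ∑ l ∈ S, chainWeight M E d l = ∑ l ∈ S, g l :=
        sum_congr rfl fun l hl => by simp [hg, hS' l hl]
      rw [h1]
      refine (sum_lists_le S (U.filter fun d' => ix d < ix d') g (by simp [hg]) ?_).trans ?_
      · intro d' l hl
        have := (hS _ hl).1
        rw [mem_filter]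
        exact ⟨this.1 d' (by simp), (List.pairwise_cons.1 this.2).1 d' (by simp)⟩
      · refine add_le_add (by simp [hg]) (sum_le_sum fun d' hd' => ?_)
        rw [mem_filter] at hd'
        simp only [hg, chainWeight, List.cons_ne_nil, if_false]
        rw [← mul_sum]
        refine mul_le_mul_of_nonneg_left (ih d' hd'.1 (by omega) _ ?_) (hM d d')
        intro l hl
        have := hS _ (mem_image_tail.1 hl)
        refine ⟨this.1.tail, ?_⟩
        obtain ⟨q, hq, hqQ⟩ := this.2
        rcases List.mem_cons.1 hq with rfl | hq
        · exact absurd hqQ hQ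
        · exact ⟨q, hq, hqQ⟩

/-- Solving the triangular system for the weights of chains meeting a set. -/
theorem exists_triangular {M : D → D → ℝ} (hM : ∀ d d', 0 ≤ M d d') {g : D → ℝ}
    (hg : ∀ d, 0 ≤ g d) (L : ℕ) (hL : ∀ d ∈ U, ix d < L) :
    ∃ T : D → ℝ, (∀ d, 0 ≤ T d) ∧ ∀ d ∈ U, T d = g d +
      ∑ d' ∈ U.filter (fun d' => ix d < ix d'), M d d' * T d' := by
  have key : ∀ k : ℕ, ∃ T : D → ℝ, (∀ d, 0 ≤ T d) ∧ ∀ d ∈ U, L ≤ ix d + k → T d = g d +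
      ∑ d' ∈ U.filter (fun d' => ix d < ix d'), M d d' * T d' := by
    intro k
    induction k with
    | zero =>
      refine ⟨fun _ => 0, fun _ => le_rfl, fun d hd h => ?_⟩
      have := hL d hd
      omega
    | succ k ih =>
      obtain ⟨T, hT0, hT⟩ := ih
      refine ⟨fun d => g d + ∑ d' ∈ U.filter (fun d' => ix d < ix d'), M d d' * T d', fun d =>
        add_nonneg (hg d) (sum_nonneg fun d' _ => mul_nonneg (hM _ _) (hT0 _)), ?_⟩
      intro d hd hk
      simp only
      congr 1
      refine sum_congr rfl fun d' hd' => ?_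
      rw [mem_filter] at hd'
      rw [← hT d' hd'.1 (by omega)]
  obtain ⟨T, h0, hT⟩ := key L
  exact ⟨T, h0, fun d hd => hT d hd (by omega)⟩

/-- Bounding the solution of the triangular system by column weights. -/
theorem sum_triangular_le {M : D → D → ℝ} {g T ω : D → ℝ} {θ : ℝ}
    (hT0 : ∀ d, 0 ≤ T d) (hT : ∀ d ∈ U, T d = g d +
      ∑ d' ∈ U.filter (fun d' => ix d < ix d'), M d d' * T d')
    (hcol : ∀ d' ∈ U, ∑ d ∈ U.filter (fun d => ix d < ix d'), ω d * M d d' ≤ θ * ω d') :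
    (1 - θ) * ∑ d ∈ U, ω d * T d ≤ ∑ d ∈ U, ω d * g d := by
  -- Exchanging the sums lets the transition matrix act on the weights `ω` instead of on `T`; the
  -- column condition then makes it a contraction by `θ`.
  have h1 : ∑ d ∈ U, ω d * T d = ∑ d ∈ U, ω d * g d +
      ∑ d' ∈ U, (∑ d ∈ U.filter (fun d => ix d < ix d'), ω d * M d d') * T d' := by
    have : ∑ d' ∈ U, (∑ d ∈ U.filter (fun d => ix d < ix d'), ω d * M d d') * T d' =
        ∑ d ∈ U, ∑ d' ∈ U.filter (fun d' => ix d < ix d'), ω d * (M d d' * T d') := by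
      simp_rw [sum_mul, sum_filter]
      rw [sum_comm]
      refine sum_congr rfl fun d _ => sum_congr rfl fun d' _ => ?_
      split_ifs <;> ring
    rw [this, ← sum_add_distrib]
    refine sum_congr rfl fun d hd => ?_
    conv_lhs => rw [hT d hd]
    rw [mul_add, mul_sum]
  have h2 : ∑ d' ∈ U, (∑ d ∈ U.filter (fun d => ix d < ix d'), ω d * M d d') * T d' ≤
      θ * ∑ d ∈ U, ω d * T d := by
    rw [mul_sum]
    refine sum_le_sum fun d' hd' => ?_
    rw [← mul_assoc]
    exact mul_le_mul_of_nonneg_right (hcol d' hd') (hT0 d')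
  linarith

end Chains

/-! ### Chains of directed edges -/

section EdgeChains
variable {K : ℕ}

/-- The directed edges of `H`. -/
def dedges (H : Finset (Sym2 (Fin (K + 1)))) : Finset (Fin (K + 1) × Fin (K + 1)) :=
  univ.filter fun d => s(d.1, d.2) ∈ H

/-- Exactly one of the two edges is in `P`. -/
def Sw (P : Finset (Sym2 (Fin (K + 1)))) (d d' : Fin (K + 1) × Fin (K + 1)) : Prop :=
  ¬ (s(d.1, d.2) ∈ P ↔ s(d'.1, d'.2) ∈ P)

/-- Each vertex is on at most two edges of `H ∩ P` and on at most two edges of `H \ P`. -/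
def TwoClasses (H P : Finset (Sym2 (Fin (K + 1)))) : Prop :=
  ∀ v, (H.filter fun e => v ∈ e ∧ e ∈ P).card ≤ 2 ∧ (H.filter fun e => v ∈ e ∧ e ∉ P).card ≤ 2

variable {H P : Finset (Sym2 (Fin (K + 1)))} {u : EdgeOrder H}

theorem mem_dedges {d : Fin (K + 1) × Fin (K + 1)} : d ∈ dedges H ↔ s(d.1, d.2) ∈ H := by
  simp [dedges]

/-- The position of a directed edge. -/
abbrev dix (u : EdgeOrder H) (d : Fin (K + 1) × Fin (K + 1)) : ℕ := idx u s(d.1, d.2)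

open Classical in
theorem card_out_le (S : Finset (Fin (K + 1) × Fin (K + 1))) (T : Finset (Sym2 (Fin (K + 1))))
    (v : Fin (K + 1)) (hS : ∀ d ∈ S, d.1 = v ∧ s(d.1, d.2) ∈ T) : S.card ≤ T.card := by
  refine card_le_card_of_injOn (fun d => s(d.1, d.2)) (fun d hd => (hS d hd).2) ?_
  intro d hd d' hd' h
  have h1 := (hS d hd).1
  have h2 := (hS d' hd').1
  simp only [h1, h2, Sym2.eq_iff] at h
  refine Prod.ext (h1.trans h2.symm) ?_
  rcases h with ⟨_, h⟩ | ⟨h, h'⟩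
  · exact h
  · rw [h', h]

open Classical in
theorem card_in_le (S : Finset (Fin (K + 1) × Fin (K + 1))) (T : Finset (Sym2 (Fin (K + 1))))
    (v : Fin (K + 1)) (hS : ∀ d ∈ S, d.2 = v ∧ s(d.1, d.2) ∈ T) : S.card ≤ T.card := by
  refine card_le_card_of_injOn (fun d => s(d.1, d.2)) (fun d hd => (hS d hd).2) ?_
  intro d hd d' hd' h
  have h1 := (hS d hd).1
  have h2 := (hS d' hd').1
  simp only [h1, h2, Sym2.eq_iff] at h
  refine Prod.ext ?_ (h1.trans h2.symm)
  rcases h with ⟨h, _⟩ | ⟨h, h'⟩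
  · exact h
  · rw [h, h']

open Classical in
-- Of the at most two edges of the class of `d` at `v`, one is `d` itself. This is why a linked
-- trail that does not switch has only one continuation.
theorem card_class_le (hP : TwoClasses H P) {d : Fin (K + 1) × Fin (K + 1)} (hd : d ∈ dedges H)
    {v : Fin (K + 1)} (hv : v ∈ s(d.1, d.2)) :
    ((H.filter fun e => v ∈ e ∧ (e ∈ P ↔ s(d.1, d.2) ∈ P)).erase s(d.1, d.2)).card ≤ 1 ∧
      (H.filter fun e => v ∈ e ∧ ¬ (e ∈ P ↔ s(d.1, d.2) ∈ P)).card ≤ 2 := by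
  obtain ⟨h1, h2⟩ := hP v
  rw [mem_dedges] at hd
  rw [card_erase_of_mem (by simp [hd, hv])]
  by_cases hdP : s(d.1, d.2) ∈ P
  · simp only [hdP, iff_true]
    exact ⟨by omega, h2⟩
  · simp only [hdP, iff_false, not_not]
    exact ⟨by omega, h1⟩

open Classical in
/-- The transition weights: `a` for non-linked pairs, `q` for linked ones, with a factor `x` for
switches. -/
def trans (P : Finset (Sym2 (Fin (K + 1)))) (a q x : ℝ) (d d' : Fin (K + 1) × Fin (K + 1)) : ℝ :=
  if d.2 = d'.1 then q * (if Sw P d d' then x else 1) else a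

open Classical in
theorem sum_linked_le (S : Finset (Fin (K + 1) × Fin (K + 1))) (x : ℝ) (hx : 0 ≤ x)
    (g : Fin (K + 1) × Fin (K + 1) → ℝ) (G : ℝ) (hG : 0 ≤ G) (hg : ∀ d ∈ S, g d ≤ G)
    (R : Fin (K + 1) × Fin (K + 1) → Prop)
    (h1 : (S.filter fun d => ¬ R d).card ≤ 1) (h2 : (S.filter R).card ≤ 2) :
    ∑ d ∈ S, (if R d then x else 1) * g d ≤ (1 + 2 * x) * G := by
  rw [← sum_filter_add_sum_filter_not S R]
  have e1 : ∑ d ∈ S.filter R, (if R d then x else 1) * g d ≤ 2 * (x * G) := by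
    calc _ ≤ ∑ d ∈ S.filter R, x * G := by
          refine sum_le_sum fun d hd => ?_
          rw [mem_filter] at hd
          rw [if_pos hd.2]
          exact mul_le_mul_of_nonneg_left (hg d hd.1) hx
      _ = (S.filter R).card * (x * G) := by rw [sum_const, nsmul_eq_mul]
      _ ≤ 2 * (x * G) := by
          gcongr
          exact_mod_cast h2
  have e2 : ∑ d ∈ S.filter (fun d => ¬ R d), (if R d then x else 1) * g d ≤ 1 * G := by
    calc _ ≤ ∑ d ∈ S.filter (fun d => ¬ R d), G := by
          refine sum_le_sum fun d hd => ?_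
          rw [mem_filter] at hd
          rw [if_neg hd.2, one_mul]
          exact hg d hd.1
      _ = (S.filter fun d => ¬ R d).card * G := by rw [sum_const, nsmul_eq_mul]
      _ ≤ 1 * G := by
          gcongr
          exact_mod_cast h1
  linarith

open Classical in
-- The factor 2 counts the two directions of the edge at each position.
theorem sum_dedges_le (J : Finset ℕ) (S : Finset (Fin (K + 1) × Fin (K + 1)))
    (hS : ∀ d ∈ S, d ∈ dedges H ∧ dix u d ∈ J) (g : ℕ → ℝ) (hg : ∀ i, 0 ≤ g i) :
    ∑ d ∈ S, g (dix u d) ≤ 2 * ∑ j ∈ J, g j := by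
  rw [← sum_fiberwise_of_maps_to (fun d hd => (hS d hd).2), mul_sum]
  refine sum_le_sum fun j _ => ?_
  have hc : (S.filter fun d => dix u d = j).card ≤ 2 := by
    rcases (S.filter fun d => dix u d = j).eq_empty_or_nonempty with h | ⟨d₀, hd₀⟩
    · rw [h]; simp
    · refine le_trans (card_le_card (t := {d₀, d₀.swap}) ?_) card_le_two
      intro d hd
      rw [mem_filter] at hd hd₀
      have := idx_inj u (mem_dedges.1 (hS d hd.1).1) (mem_dedges.1 (hS d₀ hd₀.1).1)
        (hd.2.trans hd₀.2.symm)
      rw [Sym2.eq_iff] at this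
      simp only [mem_insert, mem_singleton, Prod.ext_iff, Prod.fst_swap, Prod.snd_swap]
      exact this
  calc ∑ d ∈ S.filter (fun d => dix u d = j), g (dix u d) =
      ∑ d ∈ S.filter (fun d => dix u d = j), g j :=
        sum_congr rfl fun d hd => by rw [(mem_filter.1 hd).2]
    _ = (S.filter fun d => dix u d = j).card * g j := by rw [sum_const, nsmul_eq_mul]
    _ ≤ 2 * g j := mul_le_mul_of_nonneg_right (by exact_mod_cast hc) (hg j)

open Classical in
-- Linked successors number at most one without a switch and two with a switch, which gives 1 + 2x;
-- all other successors are bounded by two directed edges for every later position.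
theorem sum_trans_succ_le (hP : TwoClasses H P) {a q x : ℝ} (ha : 0 ≤ a) (hq : 0 ≤ q) (hx : 0 ≤ x)
    {d : Fin (K + 1) × Fin (K + 1)} (hd : d ∈ dedges H) (g : ℕ → ℝ) (hg : ∀ i, 0 ≤ g i) (G : ℝ)
    (hG : ∀ j, dix u d < j → j < H.card → g j ≤ G) (hG0 : 0 ≤ G) :
    ∑ d' ∈ (dedges H).filter (fun d' => dix u d < dix u d'), trans P a q x d d' * g (dix u d') ≤
      q * ((1 + 2 * x) * G) + a * (2 * ∑ j ∈ Ioo (dix u d) H.card, g j) := by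
  set S := (dedges H).filter (fun d' => dix u d < dix u d')
  have hS : ∀ d' ∈ S, d' ∈ dedges H ∧ dix u d < dix u d' := fun d' h => mem_filter.1 h
  have hSH : ∀ d' ∈ S, dix u d' < H.card := fun d' h => idx_lt u (mem_dedges.1 (hS d' h).1)
  rw [← sum_filter_add_sum_filter_not S (fun d' => d.2 = d'.1)]
  refine add_le_add ?_ ?_
  · calc _ = q * ∑ d' ∈ S.filter (fun d' => d.2 = d'.1),
          (if Sw P d d' then x else 1) * g (dix u d') := by
          rw [mul_sum]
          refine sum_congr rfl fun d' hd' => ?_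
          rw [trans, if_pos (mem_filter.1 hd').2]; ring
      _ ≤ _ := by
          refine mul_le_mul_of_nonneg_left ?_ hq
          obtain ⟨c1, c2⟩ := card_class_le hP hd (v := d.2) (by simp)
          refine sum_linked_le _ x hx _ G hG0 ?_ _ ?_ ?_
          · intro d' hd'
            have := (mem_filter.1 hd').1
            exact hG _ (hS d' this).2 (hSH d' this)
          · refine le_trans (card_out_le _ _ d.2 fun d' hd' => ?_) c1
            simp only [mem_filter, Sw, not_not] at hd'
            obtain ⟨⟨h1, h2⟩, h3⟩ := hd'
            refine ⟨h2.symm, mem_erase.2 ⟨fun e => ?_, mem_filter.2 ⟨mem_dedges.1 (hS d' h1).1, ?_, h3.symm⟩⟩⟩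
            -- The reversal of `d` also starts at `d.2`, but it has the same position as `d` and so
            -- is not a successor.
            · have := (hS d' h1).2
              rw [dix, dix, e] at this
              omega
            · rw [h2]; simp
          · refine le_trans (card_out_le _ _ d.2 fun d' hd' => ?_) c2
            simp only [mem_filter, Sw] at hd'
            obtain ⟨⟨h1, h2⟩, h3⟩ := hd'
            refine ⟨h2.symm, mem_filter.2 ⟨mem_dedges.1 (hS d' h1).1, ?_, fun h => h3 h.symm⟩⟩
            rw [h2]; simp
  · calc _ = a * ∑ d' ∈ S.filter (fun d' => ¬ d.2 = d'.1), g (dix u d') := by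
          rw [mul_sum]
          refine sum_congr rfl fun d' hd' => ?_
          rw [trans, if_neg (mem_filter.1 hd').2]
      _ ≤ _ := by
          refine mul_le_mul_of_nonneg_left (sum_dedges_le _ _ ?_ g hg) ha
          intro d' hd'
          have := (mem_filter.1 hd').1
          exact ⟨(hS d' this).1, mem_Ioo.2 ⟨(hS d' this).2, hSH d' this⟩⟩

open Classical in
theorem sum_trans_pred_le (hP : TwoClasses H P) {a q x : ℝ} (ha : 0 ≤ a) (hq : 0 ≤ q) (hx : 0 ≤ x)
    {d' : Fin (K + 1) × Fin (K + 1)} (hd' : d' ∈ dedges H) (g : ℕ → ℝ) (hg : ∀ i, 0 ≤ g i) (G : ℝ)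
    (hG : ∀ j, j < dix u d' → g j ≤ G) (hG0 : 0 ≤ G) :
    ∑ d ∈ (dedges H).filter (fun d => dix u d < dix u d'), g (dix u d) * trans P a q x d d' ≤
      q * ((1 + 2 * x) * G) + a * (2 * ∑ j ∈ range (dix u d'), g j) := by
  set S := (dedges H).filter (fun d => dix u d < dix u d')
  have hS : ∀ d ∈ S, d ∈ dedges H ∧ dix u d < dix u d' := fun d h => mem_filter.1 h
  rw [← sum_filter_add_sum_filter_not S (fun d => d.2 = d'.1)]
  refine add_le_add ?_ ?_
  · calc _ = q * ∑ d ∈ S.filter (fun d => d.2 = d'.1),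
          (if Sw P d d' then x else 1) * g (dix u d) := by
          rw [mul_sum]
          refine sum_congr rfl fun d hd => ?_
          rw [trans, if_pos (mem_filter.1 hd).2]; ring
      _ ≤ _ := by
          refine mul_le_mul_of_nonneg_left ?_ hq
          obtain ⟨c1, c2⟩ := card_class_le hP hd' (v := d'.1) (by simp)
          refine sum_linked_le _ x hx _ G hG0 ?_ _ ?_ ?_
          · intro d hd
            exact hG _ (hS d (mem_filter.1 hd).1).2
          · refine le_trans (card_in_le _ _ d'.1 fun d hd => ?_) c1
            obtain ⟨hd, h3⟩ := mem_filter.1 hd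
            obtain ⟨h1, h2⟩ := mem_filter.1 hd
            have h3 := not_not.1 h3
            refine ⟨h2, mem_erase.2 ⟨fun e => ?_, mem_filter.2 ⟨mem_dedges.1 (hS d h1).1, ?_, h3⟩⟩⟩
            · have := (hS d h1).2
              rw [dix, dix, e] at this
              omega
            · rw [← h2]; simp
          · refine le_trans (card_in_le _ _ d'.1 fun d hd => ?_) c2
            obtain ⟨hd, h3⟩ := mem_filter.1 hd
            obtain ⟨h1, h2⟩ := mem_filter.1 hd
            refine ⟨h2, mem_filter.2 ⟨mem_dedges.1 (hS d h1).1, ?_, h3⟩⟩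
            rw [← h2]; simp
  · calc _ = a * ∑ d ∈ S.filter (fun d => ¬ d.2 = d'.1), g (dix u d) := by
          rw [mul_sum]
          refine sum_congr rfl fun d hd => ?_
          rw [trans, if_neg (mem_filter.1 hd).2]; ring
      _ ≤ _ := by
          refine mul_le_mul_of_nonneg_left (sum_dedges_le _ _ ?_ g hg) ha
          intro d hd
          have := (mem_filter.1 hd).1
          exact ⟨(hS d this).1, mem_range.2 (hS d this).2⟩

theorem links_cons_cons {α : Type*} [DecidableEq α] (r : α × α → α × α → Prop) (d d' : α × α)
    (l : List (α × α)) [Decidable (d.2 = d'.1 ∧ r d d')] : links r (d :: d' :: l) =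
      (if d.2 = d'.1 ∧ r d d' then 1 else 0) + links r (d' :: l) := by
  rw [links]
  congr!

open Classical in
theorem links_le_length {α : Type*} [DecidableEq α] (r : α × α → α × α → Prop) :
    ∀ (d : α × α) (l : List (α × α)), links r (d :: l) ≤ l.length
  | d, [] => by simp [links]
  | d, d' :: l => by
      have := links_le_length r d' l
      rw [links, List.length_cons]
      split_ifs <;> omega

open Classical in
theorem chainWeight_trans (a q x : ℝ) : ∀ (d : Fin (K + 1) × Fin (K + 1)) (l : List _),
    chainWeight (trans P a q x) (fun _ => 1) d l =
      a ^ (l.length - nlinks (d :: l)) * q ^ nlinks (d :: l) * x ^ links (Sw P) (d :: l)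
  | d, [] => by simp [chainWeight, links]
  | d, d' :: l => by
      have h := links_le_length (fun _ _ => True) d' l
      rw [chainWeight, chainWeight_trans a q x d' l, trans]
      simp only [nlinks]
      rw [links_cons_cons, links_cons_cons]
      by_cases h1 : d.2 = d'.1
      · have e : (d' :: l).length - (1 + links (fun _ _ => True) (d' :: l)) = l.length - links (fun _ _ => True) (d' :: l) := by
          rw [List.length_cons]; omega
        by_cases h2 : Sw P d d'
        · simp only [h1, h2, if_true, and_self, e]
          ring
        · simp only [h1, h2, if_true, if_false, and_true, and_false, e]
          ring
      · have e : (d' :: l).length - (0 + links (fun _ _ => True) (d' :: l)) = l.length - links (fun _ _ => True) (d' :: l) + 1 := by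
          rw [List.length_cons]; omega
        simp only [h1, if_false, false_and, e]
        ring

/-- The weight of a list: `a` for each maximal linked run, `q` for each link, `x` for each
switch. -/
def listWeight (P : Finset (Sym2 (Fin (K + 1)))) (a q x : ℝ)
    (l : List (Fin (K + 1) × Fin (K + 1))) : ℝ :=
  a ^ (l.length - nlinks l) * q ^ nlinks l * x ^ links (Sw P) l

theorem listWeight_cons (a q x : ℝ) (d : Fin (K + 1) × Fin (K + 1)) (l : List _) :
    listWeight P a q x (d :: l) = a * chainWeight (trans P a q x) (fun _ => 1) d l := by
  have h := links_le_length (fun _ _ => True) d l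
  rw [chainWeight_trans, listWeight]
  have e : (d :: l).length - nlinks (d :: l) = l.length - nlinks (d :: l) + 1 := by
    rw [List.length_cons]; simp only [nlinks] at h ⊢; omega
  rw [e]; ring

theorem trans_nonneg {a q x : ℝ} (ha : 0 ≤ a) (hq : 0 ≤ q) (hx : 0 ≤ x)
    (d d' : Fin (K + 1) × Fin (K + 1)) : 0 ≤ trans P a q x d d' := by
  unfold trans; split_ifs <;> simp [ha, hq, hx, mul_nonneg]

theorem mul_sum_pow_range (s : ℝ) (k : ℕ) : s * ∑ j ∈ range k, (1 + s) ^ j = (1 + s) ^ k - 1 := by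
  have := mul_geom_sum (1 + s) k
  simpa using this

theorem mul_sum_pow_Ioo {s : ℝ} (hs : 0 ≤ s) {i L : ℕ} (hi : i < L) :
    s * ∑ j ∈ Ioo i L, (1 + s) ^ (L - j) ≤ (1 + s) ^ (L - i) - 1 := by
  rw [← mul_sum_pow_range]
  refine mul_le_mul_of_nonneg_left ?_ hs
  rw [← sum_image (f := fun j => (1 + s) ^ j) (s := Ioo i L) (g := fun j => L - j)]
  · refine sum_le_sum_of_subset_of_nonneg ?_ fun _ _ _ => by positivity
    intro k hk
    obtain ⟨j, hj, rfl⟩ := mem_image.1 hk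
    rw [mem_Ioo] at hj
    rw [mem_range]
    omega
  · intro j hj j' hj' h
    simp only [coe_Ioo, Set.mem_Ioo] at hj hj' h
    omega

/-! ### Geometric potentials for the transition weights -/

section Universal
variable {a q x s : ℝ}

/-- A link advances by at least one position and loses a factor 1 + s of the potential. The jumps
form a geometric sum that telescopes; its missing last term pays for the end weight 1. The two
shares are the summands of `hpar`. -/
theorem potential_trans (hP : TwoClasses H P) (ha : 0 < a) (hq : 0 ≤ q) (hx : 0 ≤ x) (hs : 0 < s)
    (hpar : q * (1 + 2 * x) / (1 + s) + 2 * a / s ≤ 1) {d : Fin (K + 1) × Fin (K + 1)}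
    (hd : d ∈ dedges H) :
    1 + ∑ d' ∈ (dedges H).filter (fun d' => dix u d < dix u d'),
      trans P a q x d d' * (s / (2 * a) * (1 + s) ^ (H.card - dix u d')) ≤
      s / (2 * a) * (1 + s) ^ (H.card - dix u d) := by
  have hi : dix u d < H.card := idx_lt u (mem_dedges.1 hd)
  have h := sum_trans_succ_le (u := u) hP ha.le hq hx hd
    (fun j => s / (2 * a) * (1 + s) ^ (H.card - j)) (fun i => by positivity)
    (s / (2 * a) * ((1 + s) ^ (H.card - dix u d) / (1 + s))) ?_ (by positivity)
  · rw [← mul_sum] at h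
    have h2 := mul_sum_pow_Ioo hs.le hi
    set Z := (1 + s) ^ (H.card - dix u d)
    set Y := ∑ j ∈ Ioo (dix u d) H.card, (1 + s) ^ (H.card - j)
    have e : a * (2 * (s / (2 * a) * Y)) = s * Y := by field_simp
    rw [e] at h
    have hZ : 0 < Z := by positivity
    have h3 : q * ((1 + 2 * x) * (s / (2 * a) * (Z / (1 + s)))) =
        s / (2 * a) * Z * (q * (1 + 2 * x) / (1 + s)) := by field_simp
    have h4 : s / (2 * a) * Z * (q * (1 + 2 * x) / (1 + s)) ≤
        s / (2 * a) * Z * (1 - 2 * a / s) := by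
      refine mul_le_mul_of_nonneg_left (by linarith) (by positivity)
    have h5 : s / (2 * a) * Z * (1 - 2 * a / s) = s / (2 * a) * Z - Z := by field_simp
    linarith
  · intro j hj _
    refine mul_le_mul_of_nonneg_left ?_ (by positivity)
    rw [le_div_iff₀ (by positivity), ← pow_succ]
    exact pow_le_pow_right₀ (by linarith) (by omega)

theorem sum_listWeight_le (hP : TwoClasses H P) (ha : 0 < a) (hq : 0 ≤ q) (hx : 0 ≤ x) (hs : 0 < s)
    (hpar : q * (1 + 2 * x) / (1 + s) + 2 * a / s ≤ 1) (S : Finset (List _))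
    (hS : ∀ l ∈ S, IsChainIn (dedges H) (dix u) l) :
    ∑ l ∈ S, listWeight P a q x l ≤ (1 + s) ^ (H.card + 1) := by
  classical
  have h0 : listWeight P a q x [] = 1 := by simp [listWeight, links]
  refine (sum_lists_le S (dedges H) _ (by rw [h0]; exact zero_le_one)
    fun d l hl => (hS _ hl).1 d (by simp)).trans ?_
  simp only [listWeight_cons, h0, ← mul_sum]
  have h1 : ∑ d ∈ dedges H, ∑ l ∈ (S.filter fun l => l.head? = some d).image List.tail,
      chainWeight (trans P a q x) (fun _ => 1) d l ≤
      ∑ d ∈ dedges H, s / (2 * a) * (1 + s) ^ (H.card - dix u d) := by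
    refine sum_le_sum fun d hd => ?_
    refine sum_chainWeight_le (trans_nonneg ha.le hq hx) (fun _ => zero_le_one)
      (fun d hd => potential_trans hP ha hq hx hs hpar hd) H.card
      (fun d hd => idx_lt u (mem_dedges.1 hd)) H.card d hd (by omega) _ ?_
    intro l hl
    exact hS _ (mem_image_tail.1 hl)
  have h2 := sum_dedges_le (u := u) (range H.card) (dedges H)
    (fun d hd => ⟨hd, mem_range.2 (idx_lt u (mem_dedges.1 hd))⟩)
    (fun j => s / (2 * a) * (1 + s) ^ (H.card - j)) (fun i => by positivity)
  rw [← mul_sum (range H.card)] at h2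
  have h3 : ∑ j ∈ range H.card, (1 + s) ^ (H.card - j) =
      (1 + s) * ∑ j ∈ range H.card, (1 + s) ^ j := by
    rw [← sum_range_reflect, mul_sum]
    refine sum_congr rfl fun j hj => ?_
    rw [mem_range] at hj
    rw [← pow_succ']
    congr 1
    omega
  rw [h3] at h2
  have h4 := mul_sum_pow_range s H.card
  set Y := ∑ j ∈ range H.card, (1 + s) ^ j
  have h5 : a * ∑ d ∈ dedges H, ∑ l ∈ (S.filter fun l => l.head? = some d).image List.tail,
      chainWeight (trans P a q x) (fun _ => 1) d l ≤ a * (2 * (s / (2 * a) * ((1 + s) * Y))) :=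
    mul_le_mul_of_nonneg_left (h1.trans h2) ha.le
  have h6 : a * (2 * (s / (2 * a) * ((1 + s) * Y))) = (1 + s) * (s * Y) := by field_simp
  rw [h6, h4] at h5
  rw [pow_succ]
  nlinarith [hs.le]

/-- The part of a chain after its first visit to `Q` is summed by the potential of
`potential_trans`, the part before it by the column weights (1+s)^i. Their product (1+s)^L does not
depend on the place of the visit, so only |Q| enters, where a sum over all starting edges would give
a factor of order L. -/
theorem sum_listWeight_touch_le (hP : TwoClasses H P) (ha : 0 < a) (hq : 0 ≤ q) (hx : 0 ≤ x)
    (hs : 0 < s) {θ : ℝ} (hθ : θ < 1)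
    (hpar : q * (1 + 2 * x) / (1 + s) + 2 * a / s ≤ θ) (S : Finset (List _))
    (hS : ∀ l ∈ S, IsChainIn (dedges H) (dix u) l) (Q : Finset (Sym2 (Fin (K + 1)))) (hQ : Q ⊆ H)
    (hSQ : ∀ l ∈ S, ∃ d ∈ l, s(d.1, d.2) ∈ Q) :
    ∑ l ∈ S, listWeight P a q x l ≤ Q.card * (s * (1 + s) ^ H.card / (1 - θ)) := by
  classical
  have hL : ∀ d ∈ dedges H, dix u d < H.card := fun d hd => idx_lt u (mem_dedges.1 hd)
  obtain ⟨T, hT0, hT⟩ := exists_triangular (U := dedges H) (ix := dix u)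
    (M := trans P a q x) (trans_nonneg ha.le hq hx)
    (g := fun d => if d ∈ dedges Q then s / (2 * a) * (1 + s) ^ (H.card - dix u d) else 0)
    (fun d => by split_ifs <;> positivity) H.card hL
  have hnil : [] ∉ S := by
    intro h
    obtain ⟨d, hd, -⟩ := hSQ _ h
    simp at hd
  set g : List (Fin (K + 1) × Fin (K + 1)) → ℝ :=
    fun l => if l = [] then 0 else listWeight P a q x l with hg
  have hg1 : ∑ l ∈ S, listWeight P a q x l = ∑ l ∈ S, g l := by
    refine sum_congr rfl fun l hl => ?_
    rw [hg]
    simp only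
    rw [if_neg]
    rintro rfl
    exact hnil hl
  rw [hg1]
  refine (sum_lists_le S (dedges H) g (by simp [hg]) fun d l hl => (hS _ hl).1 d (by simp)).trans ?_
  simp only [hg, List.cons_ne_nil, if_false, if_true, zero_add, listWeight_cons, ← mul_sum]
  have h1 : ∑ d ∈ dedges H, ∑ l ∈ (S.filter fun l => l.head? = some d).image List.tail,
      chainWeight (trans P a q x) (fun _ => 1) d l ≤ ∑ d ∈ dedges H, T d := by
    refine sum_le_sum fun d hd => ?_
    refine sum_chainWeight_touch_le (trans_nonneg ha.le hq hx) (fun _ => zero_le_one)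
      (fun d hd => potential_trans hP ha hq hx hs (hpar.trans hθ.le) hd) H.card hL
      (dedges Q) hT0 hT H.card d hd (by omega) _ ?_
    intro l hl
    rw [mem_image_tail] at hl
    refine ⟨hS _ hl, ?_⟩
    obtain ⟨d', hd', hdQ⟩ := hSQ _ hl
    exact ⟨d', hd', mem_dedges.2 hdQ⟩
  have h2 : ∑ d ∈ dedges H, T d ≤ ∑ d ∈ dedges H, (1 + s) ^ dix u d * T d := by
    refine sum_le_sum fun d _ => le_mul_of_one_le_left (hT0 d) (one_le_pow₀ (by linarith))
  have h3 := sum_triangular_le (ω := fun d => (1 + s) ^ dix u d) (θ := θ) hT0 hT ?_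
  · have h4 : ∑ d ∈ dedges H, (1 + s) ^ dix u d *
        (if d ∈ dedges Q then s / (2 * a) * (1 + s) ^ (H.card - dix u d) else 0) =
        (dedges Q).card * (s / (2 * a) * (1 + s) ^ H.card) := by
      simp only [mul_ite, mul_zero]
      rw [← sum_filter]
      have : (dedges H).filter (fun d => d ∈ dedges Q) = dedges Q := by
        ext d
        simp only [mem_filter, mem_dedges, and_iff_right_iff_imp]
        exact fun h => hQ h
      rw [this, ← nsmul_eq_mul, ← sum_const]
      refine sum_congr rfl fun d hd => ?_
      have : (1 + s) ^ H.card = (1 + s) ^ dix u d * (1 + s) ^ (H.card - dix u d) := by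
        rw [← pow_add]
        congr 1
        have := hL d (mem_dedges.2 (hQ (mem_dedges.1 hd)))
        omega
      rw [this]; ring
    rw [h4] at h3
    have h5 : ((dedges Q).card : ℝ) ≤ 2 * Q.card := by
      have := sum_dedges_le (u := u) (Q.image (idx u)) (dedges Q) (fun d hd =>
        ⟨mem_dedges.2 (hQ (mem_dedges.1 hd)), mem_image_of_mem _ (mem_dedges.1 hd)⟩)
        (fun _ => 1) (fun _ => zero_le_one)
      simp only [sum_const, nsmul_eq_mul, mul_one] at this
      refine this.trans ?_
      gcongr
      exact_mod_cast card_image_le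
    have h6 : (1 - θ) * ∑ d ∈ dedges H, (1 + s) ^ dix u d * T d ≤
        2 * Q.card * (s / (2 * a) * (1 + s) ^ H.card) := by
      refine h3.trans ?_
      gcongr
    have hθ' : 0 < 1 - θ := by linarith
    calc _ ≤ a * ∑ d ∈ dedges H, (1 + s) ^ dix u d * T d :=
          mul_le_mul_of_nonneg_left (h1.trans h2) ha.le
      _ ≤ a * (2 * Q.card * (s / (2 * a) * (1 + s) ^ H.card) / (1 - θ)) := by
          refine mul_le_mul_of_nonneg_left ?_ ha.le
          rw [le_div_iff₀ hθ']
          linarith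
      _ = _ := by field_simp
  · intro d' hd'
    have h := sum_trans_pred_le (u := u) hP ha.le hq hx hd' (fun j => (1 + s) ^ j)
      (fun i => by positivity) ((1 + s) ^ dix u d' / (1 + s)) ?_ (by positivity)
    · refine h.trans ?_
      have h4 := mul_sum_pow_range s (dix u d')
      set Z := (1 + s) ^ dix u d'
      set Y := ∑ j ∈ range (dix u d'), (1 + s) ^ j
      have hZ : 0 < Z := by positivity
      have hY : Y ≤ Z / s := by
        rw [le_div_iff₀ hs]
        linarith
      calc q * ((1 + 2 * x) * (Z / (1 + s))) + a * (2 * Y) ≤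
          q * ((1 + 2 * x) * (Z / (1 + s))) + a * (2 * (Z / s)) := by gcongr
        _ = (q * (1 + 2 * x) / (1 + s) + 2 * a / s) * Z := by field_simp
        _ ≤ θ * Z := mul_le_mul_of_nonneg_right hpar hZ.le
    · intro j hj
      rw [le_div_iff₀ (by positivity), ← pow_succ]
      exact pow_le_pow_right₀ (by linarith) (by omega)

end Universal

end EdgeChains

/-! ### Bounds for the weights of trails -/

section WBounds

/-- Lowering the upper index from k+m+1 to k+m multiplies the binomial by (k+1)/(k+m+1). This is at
most L/(L+m), hence at most `ρ`, as long as k+1 ≤ L. -/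
theorem choose_ratio_le {ρ : ℝ} (hρ : 0 ≤ ρ) {L m : ℕ} (hL : (L : ℝ) ≤ ρ * (L + m)) :
    ∀ lam ≤ L, ((L - lam + m).choose m : ℝ) ≤ ρ ^ lam * ((L + m).choose m : ℝ) := by
  intro lam
  induction lam with
  | zero => intro _; simp
  | succ lam ih =>
    intro h
    have ih := ih (by omega)
    obtain ⟨k, hk⟩ : ∃ k, L = lam + 1 + k := ⟨L - (lam + 1), by omega⟩
    have e1 : L - (lam + 1) + m = k + m := by omega
    have e2 : L - lam + m = k + m + 1 := by omega
    rw [e1]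
    rw [e2] at ih
    have h1 := Nat.choose_mul_succ_eq (k + m) m
    have e3 : k + m + 1 - m = k + 1 := by omega
    rw [e3] at h1
    have h1' : ((k + m).choose m : ℝ) * (k + m + 1) = ((k + m + 1).choose m : ℝ) * (k + 1) := by
      exact_mod_cast h1
    have h2 : (k + 1 : ℝ) ≤ ρ * (k + m + 1) := by
      rw [hk] at hL
      push_cast at hL
      by_cases hr : ρ ≤ 1
      · nlinarith [Nat.cast_nonneg (α := ℝ) lam]
      · push Not at hr
        nlinarith [Nat.cast_nonneg (α := ℝ) k, Nat.cast_nonneg (α := ℝ) m]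
    have h3 : (0 : ℝ) < k + m + 1 := by positivity
    have h4 : ((k + m).choose m : ℝ) ≤ ρ * ((k + m + 1).choose m : ℝ) := by
      rw [← mul_le_mul_iff_left₀ h3, h1']
      have : (0 : ℝ) ≤ ((k + m + 1).choose m : ℝ) := by positivity
      nlinarith
    calc ((k + m).choose m : ℝ) ≤ ρ * ((k + m + 1).choose m : ℝ) := h4
      _ ≤ ρ * (ρ ^ lam * ((L + m).choose m : ℝ)) := by gcongr
      _ = _ := by ring

theorem choose_mul_factorial_div (L m : ℕ) :
    ((L + m).choose m : ℝ) * (L.factorial : ℝ) / ((L + m).factorial : ℝ) =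
      1 / (m.factorial : ℝ) := by
  have h : (L + m).choose m * m.factorial * L.factorial = (L + m).factorial := by
    have := Nat.choose_mul_factorial_mul_factorial (n := L + m) (k := m) (by omega)
    simpa using this
  have h' : ((L + m).choose m : ℝ) * m.factorial * L.factorial = (L + m).factorial := by
    exact_mod_cast h
  have h1 : (m.factorial : ℝ) ≠ 0 := by positivity
  have h2 : ((L + m).factorial : ℝ) ≠ 0 := by positivity
  field_simp
  linarith

/-- The numerical data of a trail: length, number of links, in a set of `L` edges. -/
structure TrailData (K L t lam : ℕ) : Prop where
  le_K : t ≤ K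
  le_L : t ≤ L
  verts : 2 * t ≤ lam + (K + 1)
  links_le : lam ≤ t
  links_lt : t = 0 ∨ lam < t

variable {K L t lam : ℕ}

theorem W_le_ratio (h : TrailData K L t lam) {ρ : ℝ} (hρ : 0 ≤ ρ)
    (hL : (L : ℝ) ≤ ρ * (L + (K - t : ℕ))) :
    W K L t lam ≤ ((K + 1 - (2 * t - lam)).factorial : ℝ) / ((K - t).factorial : ℝ) * ρ ^ lam := by
  have h1 := choose_ratio_le hρ hL lam (h.links_le.trans h.le_L)
  have h2 := choose_mul_factorial_div L (K - t)
  unfold W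
  calc _ ≤ ((K + 1 - (2 * t - lam)).factorial : ℝ) *
      (ρ ^ lam * ((L + (K - t)).choose (K - t) : ℝ)) * (L.factorial : ℝ) /
        ((L + (K - t)).factorial : ℝ) := by gcongr
    _ = ((K + 1 - (2 * t - lam)).factorial : ℝ) * ρ ^ lam *
      (((L + (K - t)).choose (K - t) : ℝ) * (L.factorial : ℝ) /
        ((L + (K - t)).factorial : ℝ)) := by ring
    _ = _ := by rw [h2]; ring

theorem W_far_le (h : TrailData K L t lam) (hL : L ≤ 2 * K) (ht : 20 * t ≤ K + 1) :
    W K L t lam ≤ (K + 1) * (2 / (K + 1 : ℝ)) ^ (t - lam) * (7 / 10) ^ lam := by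
  -- The ratio 7/10 is available because 3L ≤ 6K ≤ 7(K-t) when t is at most a twentieth of K+1. It
  -- is only slightly above 2/3, its value for L = 2K and t = 0.
  refine (W_le_ratio h (ρ := 7 / 10) (by norm_num) ?_).trans ?_
  · have : 3 * L ≤ 7 * (K - t) := by omega
    have : (3 : ℝ) * L ≤ 7 * ((K - t : ℕ) : ℝ) := by exact_mod_cast this
    linarith
  · refine mul_le_mul_of_nonneg_right ?_ (by positivity)
    have hn : (0 : ℝ) < K + 1 := by positivity
    rcases h.links_lt with h0 | hlt
    · subst h0
      have := h.links_le
      have e : lam = 0 := by omega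
      subst e
      simp only [mul_zero, Nat.sub_zero, pow_zero, mul_one, Nat.factorial_succ]
      rw [div_le_iff₀ (by positivity)]
      push_cast
      exact le_rfl
    · obtain ⟨l, hl⟩ : ∃ l, t - lam = l + 1 := ⟨t - lam - 1, by omega⟩
      obtain ⟨r, hr⟩ : ∃ r, K + 1 - (2 * t - lam) = r := ⟨_, rfl⟩
      have e : K - t = r + l := by omega
      -- At least half of the vertices are off the trail, so each factor of (r+l)!/r! is at least
      -- (K+1)/2. There are only l = k-1 such factors for k runs, which produces the leading K+1.
      have h2 : K + 1 ≤ 2 * (r + 1) := by omega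
      rw [hl, hr, e]
      have h3 := Nat.factorial_mul_pow_le_factorial (m := r) (n := l)
      have h3' : (r.factorial : ℝ) * (r + 1) ^ l ≤ ((r + l).factorial : ℝ) := by exact_mod_cast h3
      have h4 : ((K + 1 : ℝ) / 2) ^ l ≤ (r + 1 : ℝ) ^ l := by
        refine pow_le_pow_left₀ (by positivity) ?_ l
        have : (K + 1 : ℝ) ≤ 2 * (r + 1) := by exact_mod_cast h2
        linarith
      rw [div_le_iff₀ (by positivity)]
      have e5 : (K + 1 : ℝ) * (2 / (K + 1)) ^ (l + 1) = 2 * (2 / (K + 1)) ^ l := by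
        rw [pow_succ]; field_simp
      rw [e5]
      have e6 : (2 / (K + 1 : ℝ)) ^ l * ((K + 1 : ℝ) / 2) ^ l = 1 := by
        rw [← mul_pow]; field_simp; simp
      calc (r.factorial : ℝ) = (2 / (K + 1 : ℝ)) ^ l * (r.factorial * ((K + 1 : ℝ) / 2) ^ l) := by
            rw [mul_left_comm, e6, mul_one]
        _ ≤ (2 / (K + 1 : ℝ)) ^ l * ((r + l).factorial : ℝ) := by
            gcongr
            exact (mul_le_mul_of_nonneg_left h4 (by positivity)).trans h3'
        _ ≤ 2 * (2 / (K + 1 : ℝ)) ^ l * ((r + l).factorial : ℝ) := by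
            have : 0 ≤ (2 / (K + 1 : ℝ)) ^ l * ((r + l).factorial : ℝ) := by positivity
            linarith

/-- The two factorials r! and (k-1)! with r + (k-1) = K - t have a product at most (K-t)!. -/
theorem factorial_ratio_le (h : TrailData K L t lam) (hlt : lam < t) :
    ((K + 1 - (2 * t - lam)).factorial : ℝ) / ((K - t).factorial : ℝ) ≤
      1 / ((t - lam - 1).factorial : ℝ) := by
  have hv := h.verts
  have hK := h.le_K
  have h1 := Nat.le_of_dvd (Nat.factorial_pos _)
    (Nat.factorial_mul_factorial_dvd_factorial_add (K + 1 - (2 * t - lam)) (t - lam - 1))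
  have e : K + 1 - (2 * t - lam) + (t - lam - 1) = K - t := by omega
  rw [e] at h1
  rw [div_le_div_iff₀ (by positivity) (by positivity), one_mul]
  exact_mod_cast h1

theorem pow_div_factorial_pred_le {w : ℝ} (hw : 0 ≤ w) {l : ℕ} (hl : 0 < l) :
    w ^ l * (1 / ((l - 1).factorial : ℝ)) ≤ w * Real.exp w := by
  obtain ⟨k, rfl⟩ : ∃ k, l = k + 1 := ⟨l - 1, by omega⟩
  have h := Real.pow_div_factorial_le_exp w hw k
  calc w ^ (k + 1) * (1 / ((k + 1 - 1).factorial : ℝ)) = w * (w ^ k / (k.factorial : ℝ)) := by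
        simp only [Nat.add_sub_cancel]; rw [pow_succ]; ring
    _ ≤ _ := by gcongr

/-- A bound valid for all trails. -/
theorem W_le_general (h : TrailData K L t lam) {y η : ℝ} (hy : 0 ≤ y) (hη : 0 < η) :
    y ^ (t - lam) * W K L t lam ≤
      (K + 1) * (1 + y / η * Real.exp (y / η)) * η ^ (t - lam) := by
  -- Nothing is gained from links here. The factor 1/(k-1)! alone turns y^k into η^k for arbitrarily
  -- small η, at the price of a constant depending on y/η.
  have h1 := W_le_ratio h (ρ := 1) zero_le_one (by
    have : (0 : ℝ) ≤ ((K - t : ℕ) : ℝ) := by positivity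
    linarith)
  rw [one_pow, mul_one] at h1
  have hw : 0 ≤ y / η := by positivity
  have he : 0 ≤ y / η * Real.exp (y / η) := by positivity
  rcases h.links_lt with h0 | hlt
  · subst h0
    have := h.links_le
    have e : lam = 0 := by omega
    subst e
    simp only [mul_zero, Nat.sub_zero, pow_zero, mul_one, one_mul] at h1 ⊢
    have e2 : ((K + 1).factorial : ℝ) / (K.factorial : ℝ) = K + 1 := by
      rw [Nat.factorial_succ]
      have : (K.factorial : ℝ) ≠ 0 := by positivity
      push_cast
      field_simp
    rw [e2] at h1
    have : (0 : ℝ) ≤ K + 1 := by positivity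
    nlinarith
  · have h2 := factorial_ratio_le h hlt
    have h3 := pow_div_factorial_pred_le hw (l := t - lam) (by omega)
    have hK : (1 : ℝ) ≤ K + 1 := by
      have : (0 : ℝ) ≤ K := by positivity
      linarith
    calc y ^ (t - lam) * W K L t lam ≤ y ^ (t - lam) * (1 / ((t - lam - 1).factorial : ℝ)) := by
          gcongr
          exact h1.trans h2
      _ = ((y / η) ^ (t - lam) * (1 / ((t - lam - 1).factorial : ℝ))) * η ^ (t - lam) := by
          rw [div_pow]; field_simp
      _ ≤ (y / η * Real.exp (y / η)) * η ^ (t - lam) := by gcongr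
      _ ≤ _ := by
          refine mul_le_mul_of_nonneg_right ?_ (by positivity)
          nlinarith

theorem four_pow_le_choose (m : ℕ) : (4 : ℝ) ^ m ≤ (2 * m + 1) * ((2 * m).choose m : ℝ) := by
  have h := Nat.four_pow_le_two_mul_self_mul_centralBinom
  rcases Nat.eq_zero_or_pos m with rfl | hm
  · simp
  · have := h m hm
    have h2 : (4 : ℝ) ^ m ≤ 2 * m * ((2 * m).choose m : ℝ) := by
      have h3 : 4 ^ m ≤ 2 * m * (2 * m).choose m := this
      exact_mod_cast h3
    have : (0 : ℝ) ≤ ((2 * m).choose m : ℝ) := by positivity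
    linarith

/-- Factor by factor, (K+j)/(m+j) ≥ (K+m)/(2m) for 1 ≤ j ≤ m ≤ K, and the latter is at least `β`
when m > 0. -/
theorem pow_mul_choose_le {K m : ℕ} {β : ℝ} (hβ0 : 0 ≤ β) (hβ : β * (2 * m) ≤ K + m) (hm : m ≤ K) :
    β ^ m * ((2 * m).choose m : ℝ) ≤ ((K + m).choose m : ℝ) := by
  have key : ∀ j ≤ m, β ^ j * ((m + j).choose j : ℝ) ≤ ((K + j).choose j : ℝ) := by
    intro j
    induction j with
    | zero => intro _; simp
    | succ j ih =>
      intro hj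
      have ih := ih (by omega)
      have a1 := Nat.add_one_mul_choose_eq (m + j) j
      have a2 := Nat.add_one_mul_choose_eq (K + j) j
      have a1' : (m + j + 1 : ℝ) * ((m + j).choose j : ℝ) =
          ((m + (j + 1)).choose (j + 1) : ℝ) * (j + 1) := by exact_mod_cast a1
      have a2' : (K + j + 1 : ℝ) * ((K + j).choose j : ℝ) =
          ((K + (j + 1)).choose (j + 1) : ℝ) * (j + 1) := by exact_mod_cast a2
      have hb : β * (m + j + 1) ≤ K + j + 1 := by
        have hj' : (j + 1 : ℝ) ≤ m := by exact_mod_cast hj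
        have hm' : (m : ℝ) ≤ K := by exact_mod_cast hm
        by_cases hb1 : β ≤ 1
        · have : (0 : ℝ) ≤ m + j + 1 := by positivity
          nlinarith
        · push Not at hb1
          nlinarith
      have hpos : (0 : ℝ) < j + 1 := by positivity
      rw [← mul_le_mul_iff_left₀ hpos, ← a2', mul_assoc, ← a1', pow_succ]
      calc β ^ j * β * ((m + j + 1 : ℝ) * ((m + j).choose j : ℝ)) =
          (β * (m + j + 1)) * (β ^ j * ((m + j).choose j : ℝ)) := by ring
        _ ≤ (K + j + 1) * ((K + j).choose j : ℝ) := by gcongr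
  have := key m le_rfl
  rwa [← two_mul] at this

/-- A bound for trails in a single path when the number `m` of remaining edges is in the middle
range. -/
theorem W_mid_le (h : TrailData K K t lam) {y η β : ℝ} (hy : 0 ≤ y) (hη : 0 < η) (hβ0 : 0 < β)
    (hlt : lam < t) (hβ : β * (2 * (K - t : ℕ)) ≤ K + (K - t : ℕ)) :
    y ^ (t - lam) * W K K t lam ≤ (2 * (K + 1)) * β⁻¹ ^ (K - t) *
      (2 * y / η * Real.exp (2 * y / η)) * η ^ (t - lam) := by
  set m := K - t with hm
  have hK := h.le_K
  have e1 : K - lam + m = 2 * m + (t - lam) := by omega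
  -- Since K = m + t, the upper index is 2m + k. The forbidden slots thus bring the binomial down to
  -- about 4^m, while the unrestricted one exceeds the central binomial by the factor β^m.
  have h1 : ((K - lam + m).choose m : ℝ) ≤ 4 ^ m * 2 ^ (t - lam) := by
    rw [e1]
    have : (2 * m + (t - lam)).choose m ≤ 2 ^ (2 * m + (t - lam)) := Nat.choose_le_two_pow _ _
    have h' : ((2 * m + (t - lam)).choose m : ℝ) ≤ 2 ^ (2 * m + (t - lam)) := by exact_mod_cast this
    rw [pow_add, pow_mul] at h'
    norm_num at h'
    exact h'
  have h2 := factorial_ratio_le h hlt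
  have h3 := choose_mul_factorial_div K m
  have h4 := pow_mul_choose_le hβ0.le hβ (by omega : m ≤ K)
  have h5 := four_pow_le_choose m
  have hc : (0 : ℝ) < ((K + m).choose m : ℝ) := by
    exact_mod_cast Nat.choose_pos (by omega)
  have h6 : (4 : ℝ) ^ m / ((K + m).choose m : ℝ) ≤ (2 * (K + 1)) * β⁻¹ ^ m := by
    rw [div_le_iff₀ hc]
    have hb : (0 : ℝ) < β ^ m := by positivity
    have e : β⁻¹ ^ m * β ^ m = 1 := by rw [← mul_pow, inv_mul_cancel₀ hβ0.ne', one_pow]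
    have hmK : (m : ℝ) ≤ K := by exact_mod_cast (by omega : m ≤ K)
    calc (4 : ℝ) ^ m ≤ (2 * m + 1) * ((2 * m).choose m : ℝ) := h5
      _ = (2 * m + 1) * (β⁻¹ ^ m * (β ^ m * ((2 * m).choose m : ℝ))) := by
          rw [← mul_assoc (β⁻¹ ^ m), e, one_mul]
      _ ≤ (2 * (K + 1)) * (β⁻¹ ^ m * ((K + m).choose m : ℝ)) := by
          gcongr
          linarith
      _ = _ := by ring
  have hWeq : W K K t lam = ((K + 1 - (2 * t - lam)).factorial : ℝ) / (m.factorial : ℝ) *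
      (((K - lam + m).choose m : ℝ) / ((K + m).choose m : ℝ)) := by
    unfold W
    rw [← hm]
    have e : (K.factorial : ℝ) / ((K + m).factorial : ℝ) =
        1 / ((m.factorial : ℝ) * ((K + m).choose m : ℝ)) := by
      rw [← div_div, ← h3]; field_simp
    rw [mul_div_assoc, e]
    have : (m.factorial : ℝ) ≠ 0 := by positivity
    field_simp
  have hw : 0 ≤ 2 * y / η := by positivity
  have h7 := pow_div_factorial_pred_le hw (l := t - lam) (by omega)
  rw [hWeq]
  calc _ ≤ y ^ (t - lam) * (1 / ((t - lam - 1).factorial : ℝ) *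
        (4 ^ m * 2 ^ (t - lam) / ((K + m).choose m : ℝ))) := by gcongr
    _ = (4 ^ m / ((K + m).choose m : ℝ)) * ((2 * y / η) ^ (t - lam) *
        (1 / ((t - lam - 1).factorial : ℝ))) * η ^ (t - lam) := by
        rw [div_pow, mul_pow]; field_simp
    _ ≤ ((2 * (K + 1)) * β⁻¹ ^ m) * (2 * y / η * Real.exp (2 * y / η)) * η ^ (t - lam) := by
        gcongr

end WBounds

/-! ### Sums over paths -/

section PathSums
variable {K : ℕ} {H P : Finset (Sym2 (Fin (K + 1)))}

theorem trailData (H : Finset (Sym2 (Fin (K + 1)))) (C : HamPath (K + 1)) :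
    TrailData K H.card (trail H C).length (nlinks (trail H C)) := by
  have h := isPathList_trail (H := H) (C := C)
  have hlt : (trail H C).length = 0 ∨ nlinks (trail H C) < (trail H C).length := by
    rcases hl : trail H C with _ | ⟨d, l⟩
    · simp
    · right
      have := links_le_length (fun _ _ => True) d l
      rw [List.length_cons]
      simp only [nlinks]
      omega
  refine ⟨length_trail_le, ?_, ?_, ?_, hlt⟩
  · rw [length_trail_eq]; exact card_le_card inter_subset_right
  · rw [← h.card_listVerts nodup_trail]
    have := card_le_univ (listVerts (trail H C))
    rw [Fintype.card_fin] at this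
    simp only [nlinks]
    omega
  · rcases hlt with h0 | h1
    · have hv := h.card_listVerts nodup_trail
      simp only [nlinks]
      omega
    · exact h1.le

/-- The expected number of ways in which `C` extends the order `u`. -/
def extWeight (u : EdgeOrder H) (C : HamPath (K + 1)) : ℝ :=
  ext u C * (H.card.factorial : ℝ) / ((H ∪ pathEdges C).card.factorial : ℝ)

theorem extWeight_nonneg (u : EdgeOrder H) (C : HamPath (K + 1)) : 0 ≤ extWeight u C := by
  unfold extWeight; positivity

/-- The number of edges of `C` in `H`. -/
def common (H : Finset (Sym2 (Fin (K + 1)))) (C : HamPath (K + 1)) : ℕ := (trail H C).length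

/-- The number of maximal linked runs of the trail of `C` in `H`. -/
def runs (H : Finset (Sym2 (Fin (K + 1)))) (C : HamPath (K + 1)) : ℕ :=
  (trail H C).length - nlinks (trail H C)

/-- The number of switches of the trail of `C` in `H`. -/
def switches (H P : Finset (Sym2 (Fin (K + 1)))) (C : HamPath (K + 1)) : ℕ :=
  links (Sw P) (trail H C)

open Classical in
-- The common frame of the exposure bounds: a pointwise comparison of `F * W` with a list weight
-- `G`, and a bound for the sum of `G` over increasing chains that are trails of paths in `𝒞`.
theorem sum_paths_le (u : EdgeOrder H) (𝒞 : Finset (HamPath (K + 1)))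
    (F : List (Fin (K + 1) × Fin (K + 1)) → ℝ) (hF : ∀ l, 0 ≤ F l)
    (G : List (Fin (K + 1) × Fin (K + 1)) → ℝ) (B : ℝ)
    (hFG : ∀ C ∈ 𝒞, IsChainIn (dedges H) (dix u) (trail H C) →
      F (trail H C) * W K H.card (trail H C).length (nlinks (trail H C)) ≤ G (trail H C))
    (hG : ∀ S : Finset (List (Fin (K + 1) × Fin (K + 1))),
      (∀ l ∈ S, IsChainIn (dedges H) (dix u) l ∧ ∃ C ∈ 𝒞, trail H C = l) → ∑ l ∈ S, G l ≤ B) :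
    ∑ C ∈ 𝒞, F (trail H C) * extWeight u C ≤ B := by
  have hchain : ∀ C, (∃ σ, Compat u C σ) → IsChainIn (dedges H) (dix u) (trail H C) := by
    rintro C ⟨σ, hσ⟩
    refine ⟨fun d hd => ?_, hσ.pairwise⟩
    obtain ⟨k, hk, rfl⟩ := mem_trail.1 hd
    exact mem_dedges.2 hk
  refine (sum_trail_le u 𝒞 F hF).trans ?_
  refine le_trans (sum_le_sum fun l hl => ?_) (hG _ ?_)
  · obtain ⟨C, hC, rfl⟩ := mem_image.1 hl
    rw [mem_filter] at hC
    exact hFG C hC.1 (hchain C hC.2)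
  · intro l hl
    obtain ⟨C, hC, rfl⟩ := mem_image.1 hl
    rw [mem_filter] at hC
    exact ⟨hchain C hC.2, C, hC.1, rfl⟩

/-! ### Exposing a path: few edges in `H`, general position, and the middle range -/

theorem one_add_pow_le_exp {s : ℝ} (hs : 0 ≤ s) (k : ℕ) : (1 + s) ^ k ≤ Real.exp (s * k) := by
  have h := Real.add_one_le_exp s
  calc (1 + s) ^ k ≤ Real.exp s ^ k := by gcongr; linarith
    _ = _ := by rw [← Real.exp_nat_mul]; ring_nf

/-- The weight for far paths. -/
def farF (P : Finset (Sym2 (Fin (K + 1)))) (l : List (Fin (K + 1) × Fin (K + 1))) : ℝ :=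
  (1 / 30) ^ links (Sw P) l * (11 / 10) ^ l.length * 900 ^ (l.length - nlinks l)

theorem farF_nonneg (l : List (Fin (K + 1) × Fin (K + 1))) : 0 ≤ farF P l := by
  unfold farF; positivity

/-- A run carries 1980/(K+1) with 1980 = (11/10)·900·2, and a link carries 77/100 = (11/10)·(7/10).
-/
theorem farF_mul_W_le (hL : H.card ≤ 2 * K) {C : HamPath (K + 1)}
    (hC : 20 * (trail H C).length ≤ K + 1) :
    farF P (trail H C) * W K H.card (trail H C).length (nlinks (trail H C)) ≤
      (K + 1) * listWeight P (1980 / (K + 1)) (77 / 100) (1 / 30) (trail H C) := by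
  have hd := trailData H C
  have h := W_far_le hd hL hC
  set t := (trail H C).length
  set lam := nlinks (trail H C)
  set b := links (Sw P) (trail H C) with hb
  have e : farF P (trail H C) = (1 / 30) ^ b * (11 / 10) ^ t * 900 ^ (t - lam) := rfl
  have e2 : listWeight P (1980 / (K + 1)) (77 / 100) (1 / 30) (trail H C) =
    (1980 / (K + 1)) ^ (t - lam) * (77 / 100) ^ lam * (1 / 30) ^ b := rfl
  rw [e, e2]
  have e3 : (11 / 10 : ℝ) ^ t = (11 / 10) ^ (t - lam) * (11 / 10) ^ lam := by
    rw [← pow_add, Nat.sub_add_cancel hd.links_le]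
  calc _ ≤ (1 / 30) ^ b * (11 / 10) ^ t * 900 ^ (t - lam) *
      ((K + 1) * (2 / (K + 1 : ℝ)) ^ (t - lam) * (7 / 10) ^ lam) := by gcongr
    _ = (K + 1) * ((11 / 10 * 900 * (2 / (K + 1 : ℝ))) ^ (t - lam) * (11 / 10 * (7 / 10)) ^ lam *
        (1 / 30) ^ b) := by rw [e3]; simp only [mul_pow]; ring
    _ = _ := by
        have e4 : 11 / 10 * 900 * (2 / (K + 1 : ℝ)) = 1980 / (K + 1) := by ring
        rw [e4]; norm_num

/-- The constant in the bounds for far paths. -/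
def farConst : ℝ := Real.exp 158400

/-- The choice s = 40a makes the share of the jumps 1/20. The share of the links is at most
(77/100)(16/15) < 0.83, so that 1/10 remains for the touching estimate. -/
theorem far_params (K : ℕ) : (77 / 100 : ℝ) * (1 + 2 * (1 / 30)) / (1 + 79200 / (K + 1)) +
    2 * (1980 / (K + 1)) / (79200 / (K + 1)) ≤ 9 / 10 := by
  have hn : (0 : ℝ) < K + 1 := by positivity
  have h1 : (77 / 100 : ℝ) * (1 + 2 * (1 / 30)) / (1 + 79200 / (K + 1)) ≤
      (77 / 100 : ℝ) * (1 + 2 * (1 / 30)) := by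
    refine div_le_self (by norm_num) ?_
    have : (0 : ℝ) ≤ 79200 / (K + 1) := by positivity
    linarith
  have h2 : 2 * (1980 / (K + 1 : ℝ)) / (79200 / (K + 1)) = 1 / 20 := by
    field_simp; norm_num
  rw [h2]
  norm_num at h1 ⊢
  linarith

/-- With s = 79200/(K+1) and at most 2(K+1) factors, the growth is bounded by exp(2·79200). -/
theorem far_pow_le (hL : H.card ≤ 2 * K) {k : ℕ} (hk : k ≤ H.card + 1) :
    (1 + 79200 / (K + 1 : ℝ)) ^ k ≤ farConst := by
  have hn : (0 : ℝ) < K + 1 := by positivity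
  refine (one_add_pow_le_exp (by positivity) k).trans (Real.exp_le_exp.2 ?_)
  rw [div_mul_eq_mul_div, div_le_iff₀ hn]
  have : (k : ℝ) ≤ 2 * (K + 1) := by exact_mod_cast (by omega : k ≤ 2 * (K + 1))
  linarith

theorem sum_far_le (hP : TwoClasses H P) (hL : H.card ≤ 2 * K) (u : EdgeOrder H)
    (𝒞 : Finset (HamPath (K + 1))) (h𝒞 : ∀ C ∈ 𝒞, 20 * common H C ≤ K + 1) :
    ∑ C ∈ 𝒞, farF P (trail H C) * extWeight u C ≤ farConst * (K + 1) := by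
  have hn : (0 : ℝ) < K + 1 := by positivity
  refine sum_paths_le u 𝒞 (farF P) farF_nonneg
    (fun l => (K + 1) * listWeight P (1980 / (K + 1)) (77 / 100) (1 / 30) l) _ ?_ ?_
  · intro C hC _
    exact farF_mul_W_le hL (h𝒞 C hC)
  · intro S hS
    rw [← mul_sum, mul_comm]
    refine mul_le_mul_of_nonneg_right ?_ hn.le
    exact (sum_listWeight_le (u := u) hP (by positivity) (by norm_num) (by norm_num) (by positivity)
      ((far_params K).trans (by norm_num)) S fun l hl => (hS l hl).1).trans (far_pow_le hL le_rfl)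

theorem sum_far_touch_le (hP : TwoClasses H P) (hL : H.card ≤ 2 * K) (u : EdgeOrder H)
    (𝒞 : Finset (HamPath (K + 1))) (h𝒞 : ∀ C ∈ 𝒞, 20 * common H C ≤ K + 1)
    (Q : Finset (Sym2 (Fin (K + 1)))) (hQ : Q ⊆ H) (hQC : ∀ C ∈ 𝒞, ∃ e ∈ Q, e ∈ pathEdges C) :
    ∑ C ∈ 𝒞, farF P (trail H C) * extWeight u C ≤ 792000 * farConst * Q.card := by
  have hn : (0 : ℝ) < K + 1 := by positivity
  refine sum_paths_le u 𝒞 (farF P) farF_nonneg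
    (fun l => (K + 1) * listWeight P (1980 / (K + 1)) (77 / 100) (1 / 30) l) _ ?_ ?_
  · intro C hC _
    exact farF_mul_W_le hL (h𝒞 C hC)
  · intro S hS
    rw [← mul_sum]
    have h := sum_listWeight_touch_le (u := u) (s := 79200 / (K + 1)) hP (by positivity)
      (by norm_num) (by norm_num) (by positivity) (θ := 9 / 10) (by norm_num) (far_params K) S
      (fun l hl => (hS l hl).1) Q hQ ?_
    · have h2 := far_pow_le (k := H.card) hL (by omega)
      calc _ ≤ (K + 1 : ℝ) * (Q.card * (79200 / (K + 1) * farConst / (1 - 9 / 10))) := by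
            refine mul_le_mul_of_nonneg_left (h.trans ?_) hn.le
            gcongr
        _ = _ := by field_simp; ring
    · intro l hl
      obtain ⟨C, hC, rfl⟩ := (hS l hl).2
      obtain ⟨e, heQ, heC⟩ := hQC C hC
      obtain ⟨k, rfl⟩ := mem_pathEdges.1 heC
      exact ⟨dedge C k, mem_trail.2 ⟨k, hQ heQ, rfl⟩, heQ⟩

/-- The weight used for paths in general position. -/
def genF (P : Finset (Sym2 (Fin (K + 1)))) (x y : ℝ) (l : List (Fin (K + 1) × Fin (K + 1))) : ℝ :=
  x ^ links (Sw P) l * y ^ (l.length - nlinks l)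

theorem genF_nonneg {x y : ℝ} (hx : 0 ≤ x) (hy : 0 ≤ y) (l : List (Fin (K + 1) × Fin (K + 1))) :
    0 ≤ genF P x y l := by
  unfold genF; positivity

/-- Here links have weight 1, so the only slack is the growth rate 1 + h; the switch weight h/12 and
the run weight h²/16 are small enough to fit into it. -/
theorem gen_params {h : ℝ} (h0 : 0 < h) (h1 : h ≤ 1) :
    1 * (1 + 2 * (h / 12)) / (1 + h) + 2 * (h ^ 2 / 16) / h ≤ 1 := by
  have e : 2 * (h ^ 2 / 16) / h = h / 8 := by field_simp; ring
  have : 1 * (1 + 2 * (h / 12)) / (1 + h) ≤ 1 - h / 8 := by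
    rw [div_le_iff₀ (by linarith)]
    nlinarith
  linarith

/-- The constant in the bounds for paths in general position. -/
def genConst (h y : ℝ) : ℝ := 1 + y / (h ^ 2 / 16) * Real.exp (y / (h ^ 2 / 16))

theorem one_le_genConst {h y : ℝ} (hh : 0 < h) (hy : 0 ≤ y) : 1 ≤ genConst h y := by
  unfold genConst
  have : 0 ≤ y / (h ^ 2 / 16) * Real.exp (y / (h ^ 2 / 16)) := by positivity
  linarith

theorem sum_gen_le (hP : TwoClasses H P) (u : EdgeOrder H) {h y : ℝ} (h0 : 0 < h) (h1 : h ≤ 1)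
    (hy : 0 ≤ y) (𝒞 : Finset (HamPath (K + 1))) :
    ∑ C ∈ 𝒞, genF P (h / 12) y (trail H C) * extWeight u C ≤
      (K + 1) * genConst h y * (1 + h) ^ (H.card + 1) := by
  have hη : 0 < h ^ 2 / 16 := by positivity
  have hc : 0 ≤ genConst h y := zero_le_one.trans (one_le_genConst h0 hy)
  refine sum_paths_le u 𝒞 (genF P (h / 12) y) (genF_nonneg (by positivity) hy)
    (fun l => (K + 1) * genConst h y * listWeight P (h ^ 2 / 16) 1 (h / 12) l) _ ?_ ?_
  · intro C _ _
    have := W_le_general (trailData H C) hy hη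
    rw [genF, listWeight, one_pow, mul_one, mul_assoc]
    calc _ ≤ (h / 12) ^ links (Sw P) (trail H C) * ((K + 1) * genConst h y *
        (h ^ 2 / 16) ^ ((trail H C).length - nlinks (trail H C))) := by
          refine mul_le_mul_of_nonneg_left this (by positivity)
      _ = _ := by ring
  · intro S hS
    rw [← mul_sum]
    refine mul_le_mul_of_nonneg_left ?_ (by positivity)
    exact sum_listWeight_le (u := u) hP hη zero_le_one (by positivity) h0 (gen_params h0 h1) S
      fun l hl => (hS l hl).1

theorem sum_mid_le (hP : TwoClasses H H) (hH : H.card = K) (u : EdgeOrder H) {h y β r : ℝ}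
    (h0 : 0 < h) (h1 : h ≤ 1) (hy : 0 ≤ y) (hβ : 0 < β) (hr : 0 ≤ r) (𝒞 : Finset (HamPath (K + 1)))
    (h𝒞 : ∀ C ∈ 𝒞, 0 < common H C ∧ β * (2 * (K - common H C : ℕ)) ≤ K + (K - common H C : ℕ) ∧
      β⁻¹ ^ (K - common H C) ≤ r) :
    ∑ C ∈ 𝒞, genF H (h / 12) y (trail H C) * extWeight u C ≤
      2 * (K + 1) * r * genConst h (2 * y) * (1 + h) ^ (K + 1) := by
  have hη : 0 < h ^ 2 / 16 := by positivity
  have hc : 0 ≤ genConst h (2 * y) := zero_le_one.trans (one_le_genConst h0 (by positivity))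
  refine sum_paths_le u 𝒞 (genF H (h / 12) y) (genF_nonneg (by positivity) hy)
    (fun l => 2 * (K + 1) * r * genConst h (2 * y) * listWeight H (h ^ 2 / 16) 1 (h / 12) l) _ ?_ ?_
  · intro C hC _
    obtain ⟨hC1, hC2, hC3⟩ := h𝒞 C hC
    have hd := trailData H C
    rw [hH] at hd ⊢
    have hlt : nlinks (trail H C) < (trail H C).length := by
      rcases hd.links_lt with h0 | h0
      · unfold common at hC1; omega
      · exact h0
    have := W_mid_le hd hy hη hβ hlt hC2
    rw [genF, listWeight, one_pow, mul_one, mul_assoc]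
    have hE : 2 * y / (h ^ 2 / 16) * Real.exp (2 * y / (h ^ 2 / 16)) ≤ genConst h (2 * y) := by
      unfold genConst; linarith
    calc _ ≤ (h / 12) ^ links (Sw H) (trail H C) * ((2 * (K + 1)) * r *
          (genConst h (2 * y)) *
          (h ^ 2 / 16) ^ ((trail H C).length - nlinks (trail H C))) := by
          refine mul_le_mul_of_nonneg_left (this.trans ?_) (by positivity)
          unfold common at hC3
          gcongr
      _ = _ := by ring
  · intro S hS
    rw [← mul_sum]
    refine mul_le_mul_of_nonneg_left ?_ (by positivity)
    have := sum_listWeight_le (u := u) hP hη zero_le_one (by positivity) h0 (gen_params h0 h1) S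
      fun l hl => (hS l hl).1
    rwa [hH] at this

end PathSums

/-! ### Paths with few edges outside a set -/

section Near
variable {K : ℕ} {H P : Finset (Sym2 (Fin (K + 1)))}

/-- Each of the m = K-t new edges brings a factor 1/(K+1), while the r free vertices bring at most
(m+1)^r with r = m-(k-1). Since m is tiny compared with K, the product leaves 1/2 for every edge of
`H` off the trail, and 16D/(K+1) for each run but the first. -/
theorem W_near_le {L t lam : ℕ} (h : TrailData K L t lam) (hlt : lam < t) {N D : ℕ}
    (hL : L = K + N) (hD : 1 ≤ D) (hm : 16 * D * (K - t + 1) ≤ K + 1) :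
    (D : ℝ) ^ (K - t) * W K L t lam ≤
      2 * 4 ^ N * ((1 / 2) ^ (L - t) * (16 * D / (K + 1)) ^ (t - lam - 1)) := by
  have hK := h.le_K
  have hv := h.verts
  obtain ⟨m, hm'⟩ : ∃ m, K - t = m := ⟨_, rfl⟩
  obtain ⟨j, hj⟩ : ∃ j, t - lam - 1 = j := ⟨_, rfl⟩
  obtain ⟨r, hr⟩ : ∃ r, K + 1 - (2 * t - lam) = r := ⟨_, rfl⟩
  have hmr : m = r + j := by omega
  have e1 : L - lam + m = 2 * m + N + (j + 1) := by omega
  have e2 : L - t = m + N := by omega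
  rw [hm'] at hm
  unfold W
  rw [hm', hj, hr, e1, e2]
  have hn : (0 : ℝ) < K + 1 := by positivity
  have hDr : (1 : ℝ) ≤ D := by exact_mod_cast hD
  have a1 : ((2 * m + N + (j + 1)).choose m : ℝ) ≤ 2 * 8 ^ m * 2 ^ N := by
    have : (2 * m + N + (j + 1)).choose m ≤ 2 ^ (3 * m + N + 1) :=
      (Nat.choose_le_two_pow _ _).trans (Nat.pow_le_pow_right (by norm_num) (by omega))
    have h' : ((2 * m + N + (j + 1)).choose m : ℝ) ≤ 2 ^ (3 * m + N + 1) := by exact_mod_cast this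
    rw [pow_add, pow_add, pow_mul] at h'
    norm_num at h'
    linarith
  have a2 : (L.factorial : ℝ) / ((L + m).factorial : ℝ) ≤ (1 / (K + 1)) ^ m := by
    have h3 := Nat.factorial_mul_pow_le_factorial (m := L) (n := m)
    have h3' : (L.factorial : ℝ) * (L + 1) ^ m ≤ ((L + m).factorial : ℝ) := by exact_mod_cast h3
    have h4 : (K + 1 : ℝ) ^ m ≤ (L + 1 : ℝ) ^ m := by
      refine pow_le_pow_left₀ hn.le ?_ m
      rw [hL]; push_cast; linarith [Nat.cast_nonneg (α := ℝ) N]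
    rw [div_pow, one_pow, div_le_div_iff₀ (by positivity) (by positivity), one_mul]
    exact (mul_le_mul_of_nonneg_left h4 (by positivity)).trans h3'
  have a3 : (r.factorial : ℝ) ≤ (m + 1 : ℝ) ^ r := by
    have : r.factorial ≤ (m + 1) ^ r :=
      (Nat.factorial_le_pow r).trans (Nat.pow_le_pow_left (by omega) r)
    exact_mod_cast this
  -- This absorbs the r free vertices together with 8^m, D^m and an extra 2^m, which is the source
  -- of the factor (1/2)^m.
  have a4 : (16 * D * (m + 1) / (K + 1) : ℝ) ^ r ≤ 1 := by
    refine pow_le_one₀ (by positivity) ?_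
    rw [div_le_one hn]
    exact_mod_cast hm
  calc (D : ℝ) ^ m * ((r.factorial : ℝ) * ((2 * m + N + (j + 1)).choose m : ℝ) * (L.factorial : ℝ) /
        ((L + m).factorial : ℝ))
      = (D : ℝ) ^ m * ((r.factorial : ℝ) * ((2 * m + N + (j + 1)).choose m : ℝ) *
        ((L.factorial : ℝ) / ((L + m).factorial : ℝ))) := by rw [mul_div_assoc]
    _ ≤ (D : ℝ) ^ m * ((m + 1 : ℝ) ^ r * (2 * 8 ^ m * 2 ^ N) * (1 / (K + 1)) ^ m) := by gcongr
    _ = 2 * 2 ^ N * (1 / 2) ^ m * (16 * D * (m + 1) / (K + 1) : ℝ) ^ r *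
        (16 * D / (K + 1)) ^ j := by
        have e16 : (16 : ℝ) = 8 * 2 := by norm_num
        have h2 : (1 / 2 : ℝ) ^ m * 2 ^ m = 1 := by rw [← mul_pow]; norm_num
        rw [e16]
        rw [hmr] at h2 ⊢
        simp only [div_pow, mul_pow, pow_add, one_pow] at h2 ⊢
        field_simp
    _ ≤ 2 * 2 ^ N * (1 / 2) ^ m * 1 * (16 * D / (K + 1)) ^ j := by gcongr
    _ = _ := by
        have h2 : (4 : ℝ) ^ N * (1 / 2) ^ N = 2 ^ N := by rw [← mul_pow]; norm_num
        rw [pow_add, ← h2]; ring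

open Classical in
/-- The vertices on edges of `H` outside `P`. -/
def branchVerts (H P : Finset (Sym2 (Fin (K + 1)))) : Finset (Fin (K + 1)) :=
  univ.filter fun v => ∃ e ∈ H, e ∉ P ∧ v ∈ e

theorem card_branchVerts_le : (branchVerts H P).card ≤ 2 * (H \ P).card := by
  classical
  have : branchVerts H P ⊆ (H \ P).biUnion fun e => e.toFinset := by
    intro v hv
    simp only [branchVerts, mem_filter, mem_univ, true_and] at hv
    obtain ⟨e, he, heP, hve⟩ := hv
    rw [mem_biUnion]
    exact ⟨e, Finset.mem_sdiff.2 ⟨he, heP⟩, by simpa using hve⟩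
  refine (card_le_card this).trans ?_
  rw [mul_comm]
  refine card_biUnion_le_card_mul _ _ _ fun e _ => ?_
  by_cases h : e.IsDiag
  · rw [Sym2.card_toFinset_of_isDiag e h]; norm_num
  · rw [Sym2.card_toFinset_of_not_isDiag e h]

open Classical in
theorem card_incident_le (hP : TwoClasses H P) (B : Finset (Fin (K + 1))) :
    (H.filter fun e => ∃ v ∈ B, v ∈ e).card ≤ 4 * B.card := by
  have : (H.filter fun e => ∃ v ∈ B, v ∈ e) ⊆ B.biUnion fun v => H.filter fun e => v ∈ e := by
    intro e he
    simp only [mem_filter, mem_biUnion] at he ⊢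
    obtain ⟨h, v, hv, hve⟩ := he
    exact ⟨v, hv, h, hve⟩
  refine (card_le_card this).trans ?_
  rw [mul_comm]
  refine card_biUnion_le_card_mul _ _ _ fun v _ => ?_
  obtain ⟨h1, h2⟩ := hP v
  rw [← card_filter_add_card_filter_not (s := H.filter fun e => v ∈ e) (fun e => e ∈ P),
    filter_filter, filter_filter]
  omega

variable {u : EdgeOrder H}

open Classical in
/-- The positions of the edges of `H` that touch an edge outside `P`. -/
def branchIdx (P : Finset (Sym2 (Fin (K + 1)))) (u : EdgeOrder H) : Finset ℕ :=
  (H.filter fun e => ∃ v ∈ branchVerts H P, v ∈ e).image (idx u)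

theorem card_branchIdx_le (hP : TwoClasses H P) :
    (branchIdx P u).card ≤ 8 * (H \ P).card := by
  classical
  refine card_image_le.trans ((card_incident_le hP _).trans ?_)
  have := card_branchVerts_le (H := H) (P := P)
  omega

open Classical in
/-- The transition weights for near paths. -/
def nearTrans (P : Finset (Sym2 (Fin (K + 1)))) (u : EdgeOrder H) (c : ℝ)
    (d d' : Fin (K + 1) × Fin (K + 1)) : ℝ :=
  trans P c 1 1 d d' * (1 / 2) ^ (dix u d' - dix u d - 1)

/-- The final weights for near paths. -/
def nearEnd (u : EdgeOrder H) (d : Fin (K + 1) × Fin (K + 1)) : ℝ :=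
  (1 / 2) ^ (H.card - 1 - dix u d)

theorem chain_length_le : ∀ {l : List (Fin (K + 1) × Fin (K + 1))}
    {d : Fin (K + 1) × Fin (K + 1)}, IsChainIn (dedges H) (dix u) (d :: l) →
    dix u d + l.length + 1 ≤ H.card
  | [], d, h => by
      have : dix u d < H.card := idx_lt u (mem_dedges.1 (h.1 d (by simp)))
      simp only [List.length_nil]
      omega
  | d' :: l, d, h => by
      have h1 := chain_length_le h.tail
      have h2 := (List.pairwise_cons.1 h.2).1 d' (by simp)
      rw [List.length_cons]
      omega

/-- The halves collected between consecutive positions and at the end count exactly the edges of `H`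
skipped after `d`. -/
theorem chainWeight_near (c : ℝ) : ∀ (d : Fin (K + 1) × Fin (K + 1)) (l : List _),
    IsChainIn (dedges H) (dix u) (d :: l) →
    chainWeight (nearTrans P u c) (nearEnd u) d l =
      chainWeight (trans P c 1 1) (fun _ => 1) d l * (1 / 2) ^ (H.card - 1 - dix u d - l.length)
  | d, [], _ => by simp [chainWeight, nearEnd]
  | d, d' :: l, h => by
      have h1 := chain_length_le h.tail
      have h2 := (List.pairwise_cons.1 h.2).1 d' (by simp)
      rw [chainWeight, chainWeight, chainWeight_near c d' l h.tail, nearTrans]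
      have e : H.card - 1 - dix u d - (d' :: l).length =
          (dix u d' - dix u d - 1) + (H.card - 1 - dix u d' - l.length) := by
        rw [List.length_cons]; omega
      rw [e, pow_add]
      ring

theorem not_sw_of_notMem_branchVerts {d d' : Fin (K + 1) × Fin (K + 1)} (hd : d ∈ dedges H)
    (hd' : d' ∈ dedges H) (hlink : d.2 = d'.1) (hv : d.2 ∉ branchVerts H P) : ¬ Sw P d d' := by
  simp only [branchVerts, mem_filter, mem_univ, true_and, not_exists, not_and] at hv
  have h1 : s(d.1, d.2) ∈ P := by
    by_contra h
    exact hv _ (mem_dedges.1 hd) h (by simp)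
  have h2 : s(d'.1, d'.2) ∈ P := by
    by_contra h
    exact hv _ (mem_dedges.1 hd') h (by simp [hlink])
  simp [Sw, h1, h2]

open Classical in
/-- The growth factor of the potential at position `k`. -/
def nearG (P : Finset (Sym2 (Fin (K + 1)))) (u : EdgeOrder H) (c : ℝ) (k : ℕ) : ℝ :=
  1 + 4 * c + if k ∈ branchIdx P u then 2 else 0

/-- The potential for near paths. -/
def nearV (P : Finset (Sym2 (Fin (K + 1)))) (u : EdgeOrder H) (c : ℝ) (i : ℕ) : ℝ :=
  (∏ k ∈ Ico i H.card, nearG P u c k) * (2 - (1 / 2) ^ (H.card - 1 - i))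

theorem one_le_nearG {c : ℝ} (hc : 0 ≤ c) (k : ℕ) : 1 ≤ nearG P u c k := by
  unfold nearG; split_ifs <;> linarith

theorem one_le_nearS (i : ℕ) : (1 : ℝ) ≤ 2 - (1 / 2) ^ (H.card - 1 - i) := by
  have : (1 / 2 : ℝ) ^ (H.card - 1 - i) ≤ 1 := pow_le_one₀ (by norm_num) (by norm_num)
  linarith

theorem one_le_prod_nearG {c : ℝ} (hc : 0 ≤ c) (s : Finset ℕ) : 1 ≤ ∏ k ∈ s, nearG P u c k :=
  prod_induction _ (fun x => 1 ≤ x) (fun _ _ => one_le_mul_of_one_le_of_one_le) le_rfl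
    fun k _ => one_le_nearG hc k

theorem nearV_nonneg {c : ℝ} (hc : 0 ≤ c) (i : ℕ) : 0 ≤ nearV P u c i :=
  mul_nonneg (zero_le_one.trans (one_le_prod_nearG hc _)) (zero_le_one.trans (one_le_nearS i))

theorem nearV_anti {c : ℝ} (hc : 0 ≤ c) {i j : ℕ} (hij : i ≤ j) :
    nearV P u c j ≤ nearV P u c i := by
  unfold nearV
  have h1 : ∏ k ∈ Ico j H.card, nearG P u c k ≤ ∏ k ∈ Ico i H.card, nearG P u c k := by
    rw [← prod_sdiff (Ico_subset_Ico_left (b := H.card) hij)]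
    exact le_mul_of_one_le_left (zero_le_one.trans (one_le_prod_nearG hc _))
      (one_le_prod_nearG hc _)
  have h2 : (1 / 2 : ℝ) ^ (H.card - 1 - i) ≤ (1 / 2) ^ (H.card - 1 - j) :=
    pow_le_pow_of_le_one (by norm_num) (by norm_num) (by omega)
  refine mul_le_mul h1 (by linarith) (zero_le_one.trans (one_le_nearS j))
    (zero_le_one.trans (one_le_prod_nearG hc _))

theorem sum_half_pow_Ioo_le (i L : ℕ) : ∑ j ∈ Ioo i L, (1 / 2 : ℝ) ^ (j - i - 1) ≤ 2 := by
  rw [← sum_image (f := fun k => (1 / 2 : ℝ) ^ k) (s := Ioo i L) (g := fun j => j - i - 1)]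
  · refine le_trans (sum_le_sum_of_subset_of_nonneg (t := range L) ?_ fun _ _ _ => by positivity) ?_
    · intro k hk
      obtain ⟨j, hj, rfl⟩ := mem_image.1 hk
      rw [mem_Ioo] at hj
      rw [mem_range]
      omega
    · exact (sum_geometric_two_le L)
  · intro j hj j' hj' h
    simp only [coe_Ioo, Set.mem_Ioo] at hj hj' h
    omega

/-- A switch from `d` can only occur at an end of an edge outside `P`, so the position of `d` is in
`branchIdx` and the switch weight may be taken 0 elsewhere. Linked successors contribute at most 1 +
2x times the potential at the next position, and jumps at most 4c times it, because the halves sum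
to at most 2. -/
theorem potential_near (hP : TwoClasses H P) {c : ℝ} (hc : 0 ≤ c)
    {d : Fin (K + 1) × Fin (K + 1)} (hd : d ∈ dedges H) :
    nearEnd u d + ∑ d' ∈ (dedges H).filter (fun d' => dix u d < dix u d'),
      nearTrans P u c d d' * nearV P u c (dix u d') ≤ nearV P u c (dix u d) := by
  classical
  set i := dix u d with hi
  have hiL : i < H.card := idx_lt u (mem_dedges.1 hd)
  set x : ℝ := if i ∈ branchIdx P u then 1 else 0 with hx
  have hx0 : 0 ≤ x := by rw [hx]; split_ifs <;> norm_num
  have hg : nearG P u c i = 1 + 4 * c + 2 * x := by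
    rw [nearG, hx]; split_ifs <;> ring
  have e1 : ∑ d' ∈ (dedges H).filter (fun d' => i < dix u d'),
      nearTrans P u c d d' * nearV P u c (dix u d') =
      ∑ d' ∈ (dedges H).filter (fun d' => i < dix u d'),
      trans P c 1 x d d' * ((1 / 2) ^ (dix u d' - i - 1) * nearV P u c (dix u d')) := by
    refine sum_congr rfl fun d' hd' => ?_
    rw [mem_filter] at hd'
    rw [nearTrans, mul_assoc]
    congr 1
    by_cases hl : d.2 = d'.1
    · by_cases hs : Sw P d d'
      · have : i ∈ branchIdx P u := by
          rw [branchIdx, mem_image]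
          refine ⟨s(d.1, d.2), mem_filter.2 ⟨mem_dedges.1 hd, d.2, ?_, by simp⟩, rfl⟩
          by_contra hv
          exact not_sw_of_notMem_branchVerts hd hd'.1 hl hv hs
        simp [trans, hl, hx, this]
      · simp [trans, hl, hs]
    · simp [trans, hl]
  rw [e1]
  by_cases hlast : i + 1 < H.card
  · set V' := nearV P u c (i + 1) with hV'
    have hV0 : 0 ≤ V' := nearV_nonneg hc _
    have h := sum_trans_succ_le (u := u) hP hc zero_le_one hx0 hd
      (fun j => (1 / 2) ^ (j - i - 1) * nearV P u c j)
      (fun j => mul_nonneg (by positivity) (nearV_nonneg hc j)) V' ?_ hV0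
    · have h2 : ∑ j ∈ Ioo i H.card, (1 / 2) ^ (j - i - 1) * nearV P u c j ≤ 2 * V' := by
        calc _ ≤ ∑ j ∈ Ioo i H.card, (1 / 2) ^ (j - i - 1) * V' := by
              refine sum_le_sum fun j hj => ?_
              rw [mem_Ioo] at hj
              exact mul_le_mul_of_nonneg_left (nearV_anti hc (by omega)) (by positivity)
          _ = (∑ j ∈ Ioo i H.card, (1 / 2) ^ (j - i - 1)) * V' := by rw [sum_mul]
          _ ≤ 2 * V' := mul_le_mul_of_nonneg_right (sum_half_pow_Ioo_le i _) hV0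
      have h3 : c * (2 * ∑ j ∈ Ioo i H.card, (1 / 2) ^ (j - i - 1) * nearV P u c j) ≤
          c * (2 * (2 * V')) := by gcongr
      -- With ε the end weight at `i`, the second factor of the potential is 2-ε = (2-2ε) + ε: the
      -- value at i+1 plus exactly the end weight.
      have h4 : nearV P u c i = nearG P u c i *
          ((∏ k ∈ Ico (i + 1) H.card, nearG P u c k) * (2 - (1 / 2) ^ (H.card - 1 - (i + 1)))) +
          nearG P u c i * (∏ k ∈ Ico (i + 1) H.card, nearG P u c k) * nearEnd u d := by
        rw [nearV, nearEnd, ← hi, prod_eq_prod_Ico_succ_bot hiL]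
        have : H.card - 1 - i = (H.card - 1 - (i + 1)) + 1 := by omega
        rw [this, pow_succ]
        ring
      have h5 : nearEnd u d ≤ nearG P u c i * (∏ k ∈ Ico (i + 1) H.card, nearG P u c k) *
          nearEnd u d := by
        refine le_mul_of_one_le_left (by unfold nearEnd; positivity) ?_
        exact one_le_mul_of_one_le_of_one_le (one_le_nearG hc i) (one_le_prod_nearG hc _)
      have h6 : (∏ k ∈ Ico (i + 1) H.card, nearG P u c k) *
          (2 - (1 / 2) ^ (H.card - 1 - (i + 1))) = V' := rfl
      rw [h4, h6, hg] at *
      linarith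
    · intro j hj _
      refine le_trans (mul_le_of_le_one_left (nearV_nonneg hc j)
        (pow_le_one₀ (by norm_num) (by norm_num))) (nearV_anti hc (by omega))
  · have hemp : (dedges H).filter (fun d' => i < dix u d') = ∅ := by
      rw [filter_eq_empty_iff]
      intro d' hd'
      have : dix u d' < H.card := idx_lt u (mem_dedges.1 hd')
      omega
    rw [hemp, sum_empty, add_zero, nearEnd, ← hi, nearV]
    have : H.card - 1 - i = 0 := by omega
    rw [this]
    have := one_le_prod_nearG (P := P) (u := u) hc (Ico i H.card)
    norm_num
    linarith

/-- The extra growth, at most a factor 3, happens only at the at most 8|H \ P| branch positions; all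
other growth is bounded because c is of order 1/|H| in the application. -/
theorem nearV_le (hP : TwoClasses H P) {c : ℝ} (hc : 0 ≤ c) (i : ℕ) :
    nearV P u c i ≤ 2 * (Real.exp (4 * c * H.card) * 3 ^ (8 * (H \ P).card)) := by
  classical
  refine (nearV_anti hc (Nat.zero_le i)).trans ?_
  unfold nearV
  have h1 : ∏ k ∈ Ico 0 H.card, nearG P u c k ≤
      ∏ k ∈ Ico 0 H.card, ((1 + 4 * c) * if k ∈ branchIdx P u then 3 else 1) := by
    refine prod_le_prod (fun k _ => zero_le_one.trans (one_le_nearG hc k)) fun k _ => ?_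
    unfold nearG
    split_ifs <;> linarith
  have h2 : ∏ k ∈ Ico 0 H.card, ((1 + 4 * c) * if k ∈ branchIdx P u then (3 : ℝ) else 1) ≤
      Real.exp (4 * c * H.card) * 3 ^ (8 * (H \ P).card) := by
    rw [prod_mul_distrib, prod_const, Nat.card_Ico, Nat.sub_zero, prod_ite]
    simp only [prod_const, one_pow, mul_one]
    refine mul_le_mul (one_add_pow_le_exp (by positivity) _) ?_ (by positivity) (by positivity)
    refine pow_le_pow_right₀ (by norm_num) (le_trans (card_le_card ?_) (card_branchIdx_le (u := u) hP))
    intro k hk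
    exact (mem_filter.1 hk).2
  have h3 : (0 : ℝ) ≤ (1 / 2) ^ (H.card - 1 - 0) := by positivity
  have h4 := one_le_prod_nearG (P := P) (u := u) hc (Ico 0 H.card)
  nlinarith [h1.trans h2]

theorem sum_near_lists_le (hP : TwoClasses H P) {c : ℝ} (hc : 0 ≤ c) (S : Finset (List _))
    (hS : ∀ l ∈ S, IsChainIn (dedges H) (dix u) l) (g : List (Fin (K + 1) × Fin (K + 1)) → ℝ)
    (hg0 : g [] = 0)
    (hg : ∀ d l, g (d :: l) = (1 / 2) ^ dix u d * chainWeight (nearTrans P u c) (nearEnd u) d l) :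
    ∑ l ∈ S, g l ≤ 8 * (Real.exp (4 * c * H.card) * 3 ^ (8 * (H \ P).card)) := by
  classical
  refine (sum_lists_le S (dedges H) g hg0.ge fun d l hl => (hS _ hl).1 d (by simp)).trans ?_
  simp only [hg, hg0, zero_add, ← mul_sum]
  have hM : ∀ d d', 0 ≤ nearTrans P u c d d' := fun d d' =>
    mul_nonneg (trans_nonneg hc zero_le_one zero_le_one d d') (by positivity)
  set B := Real.exp (4 * c * H.card) * 3 ^ (8 * (H \ P).card)
  have hB : 0 ≤ B := by positivity
  calc _ ≤ ∑ d ∈ dedges H, (1 / 2) ^ dix u d * (2 * B) := by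
        refine sum_le_sum fun d hd => mul_le_mul_of_nonneg_left ?_ (by positivity)
        refine (sum_chainWeight_le hM (fun d => by unfold nearEnd; positivity)
          (V := fun d => nearV P u c (dix u d)) (fun d hd => potential_near hP hc hd) H.card
          (fun d hd => idx_lt u (mem_dedges.1 hd)) H.card d hd (by omega) _ ?_).trans (nearV_le hP hc _)
        intro l hl
        exact hS _ (mem_image_tail.1 hl)
    _ = (∑ d ∈ dedges H, (1 / 2) ^ dix u d) * (2 * B) := by rw [sum_mul]
    _ ≤ (2 * ∑ j ∈ range H.card, (1 / 2) ^ j) * (2 * B) := by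
        refine mul_le_mul_of_nonneg_right ?_ (by positivity)
        exact sum_dedges_le (u := u) (range H.card) (dedges H)
          (fun d hd => ⟨hd, mem_range.2 (idx_lt u (mem_dedges.1 hd))⟩)
          (fun j => (1 / 2) ^ j) (fun i => by positivity)
    _ ≤ (2 * 2) * (2 * B) := by
        refine mul_le_mul_of_nonneg_right ?_ (by positivity)
        have := sum_geometric_two_le H.card
        linarith
    _ = 8 * B := by ring

theorem sum_near_le (hP : TwoClasses H P) (hPH : H.card = K + (H \ P).card) (hL : H.card ≤ 2 * K)
    (u : EdgeOrder H) {D : ℕ} (hD : 1 ≤ D) (𝒞 : Finset (HamPath (K + 1)))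
    (h𝒞 : ∀ C ∈ 𝒞, 0 < common H C ∧ 16 * D * (K - common H C + 1) ≤ K + 1) :
    ∑ C ∈ 𝒞, (D : ℝ) ^ (K - common H C) * extWeight u C ≤
      16 * Real.exp (128 * D) * (4 ^ 9) ^ (H \ P).card := by
  classical
  have hn : (0 : ℝ) < K + 1 := by positivity
  set N := (H \ P).card with hN
  set c : ℝ := 16 * D / (K + 1) with hc
  have hc0 : 0 ≤ c := by positivity
  -- The first edge of a trail pays a half for every edge of `H` below it. The empty trail gets
  -- weight 0, since the paths in `𝒞` have an edge in `H`.
  set g : List (Fin (K + 1) × Fin (K + 1)) → ℝ := fun l => match l with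
    | [] => 0
    | d :: l => (1 / 2) ^ dix u d * chainWeight (nearTrans P u c) (nearEnd u) d l with hg
  refine sum_paths_le u 𝒞 (fun l => (D : ℝ) ^ (K - l.length)) (fun l => by positivity)
    (fun l => 2 * 4 ^ N * g l) _ ?_ ?_
  · intro C hC hch
    obtain ⟨h1, h2⟩ := h𝒞 C hC
    have hd := trailData H C
    have hlt : nlinks (trail H C) < (trail H C).length := by
      rcases hd.links_lt with h0 | h0
      · unfold common at h1; omega
      · exact h0
    refine (W_near_le hd hlt hPH hD h2).trans ?_
    refine mul_le_mul_of_nonneg_left ?_ (by positivity)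
    rcases hl : trail H C with _ | ⟨d, l⟩
    · rw [hl] at hlt; simp at hlt
    · rw [hl] at hch
      simp only [hg]
      rw [chainWeight_near c d l hch, chainWeight_trans]
      have h3 := chain_length_le hch
      have e1 : H.card - (d :: l).length = dix u d + (H.card - 1 - dix u d - l.length) := by
        rw [List.length_cons]; omega
      have e2 : (d :: l).length - nlinks (d :: l) - 1 = l.length - nlinks (d :: l) := by
        rw [List.length_cons]; omega
      rw [e1, e2, pow_add, one_pow, one_pow]
      apply le_of_eq
      ring
  · intro S hS
    rw [← mul_sum]
    have h := sum_near_lists_le (u := u) hP hc0 S (fun l hl => (hS l hl).1) g rfl fun d l => rfl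
    have h2 : Real.exp (4 * c * H.card) ≤ Real.exp (128 * D) := by
      refine Real.exp_le_exp.2 ?_
      rw [hc]
      have : (H.card : ℝ) ≤ 2 * (K + 1) := by exact_mod_cast (by omega : H.card ≤ 2 * (K + 1))
      calc 4 * (16 * D / (K + 1)) * (H.card : ℝ) ≤ 4 * (16 * D / (K + 1)) * (2 * (K + 1)) := by
            gcongr
        _ = 128 * D := by field_simp; ring
    calc 2 * 4 ^ N * ∑ l ∈ S, g l ≤ 2 * 4 ^ N * (8 * (Real.exp (128 * D) * 4 ^ (8 * N))) := by
          refine mul_le_mul_of_nonneg_left (h.trans ?_) (by positivity)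
          gcongr
          norm_num
      _ = _ := by rw [← pow_mul]; ring

/-- At a switch vertex some edge lies outside `P`, and those edges have at most 2|H \ P| end points.
-/
theorem switches_le (C : HamPath (K + 1)) : switches H P C ≤ 2 * (H \ P).card := by
  classical
  unfold switches
  rw [isPathList_trail.links_eq]
  refine (card_le_card fun v hv => ?_).trans card_branchVerts_le
  obtain ⟨d, hd, d', hd', rfl, h2, h3⟩ := mem_linkVerts.1 hv
  by_contra hno
  have hmem : ∀ d ∈ trail H C, d ∈ dedges H := by
    intro d hd
    obtain ⟨k, hk, rfl⟩ := mem_trail.1 hd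
    exact mem_dedges.2 hk
  exact not_sw_of_notMem_branchVerts (hmem d hd) (hmem d' hd') h2.symm hno h3

end Near

/-! ### Overlaps of paths -/

section Overlap
variable {K : ℕ}

open Classical in
theorem card_pathEdges_at_le (C : HamPath (K + 1)) (v : Fin (K + 1)) :
    ((pathEdges C).filter fun e => v ∈ e).card ≤ 2 := by
  rw [pathEdges_eq_image, filter_image]
  refine card_image_le.trans ?_
  have h : ((univ : Finset (Fin K)).filter fun k => v ∈ edge C k).card ≤
      ({(C.symm v : ℕ), (C.symm v : ℕ) - 1} : Finset ℕ).card := by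
    refine card_le_card_of_injOn (fun k => (k : ℕ)) ?_ (fun _ _ _ _ h => Fin.ext h)
    intro k hk
    simp only [coe_filter, mem_univ, true_and, Set.mem_ofPred_eq, edge, Sym2.mem_iff] at hk
    rcases hk with rfl | rfl
    · simp
    · simp
  exact h.trans card_le_two

theorem twoClasses_self (A : HamPath (K + 1)) : TwoClasses (pathEdges A) (pathEdges A) := by
  classical
  intro v
  constructor
  · refine (card_le_card fun e he => ?_).trans (card_pathEdges_at_le A v)
    simp only [mem_filter] at he ⊢
    exact ⟨he.1, he.2.1⟩
  · refine (card_le_card fun e he => ?_).trans (card_pathEdges_at_le A v)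
    simp only [mem_filter] at he ⊢
    exact ⟨he.1, he.2.1⟩

theorem twoClasses_left (A B : HamPath (K + 1)) :
    TwoClasses (pathEdges A ∪ pathEdges B) (pathEdges A) := by
  classical
  intro v
  constructor
  · refine (card_le_card fun e he => ?_).trans (card_pathEdges_at_le A v)
    simp only [mem_filter] at he ⊢
    exact ⟨he.2.2, he.2.1⟩
  · refine (card_le_card fun e he => ?_).trans (card_pathEdges_at_le B v)
    simp only [mem_filter, mem_union] at he ⊢
    exact ⟨he.1.resolve_left he.2.2, he.2.1⟩

theorem twoClasses_right (A B : HamPath (K + 1)) :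
    TwoClasses (pathEdges A ∪ pathEdges B) (pathEdges B) := by
  rw [union_comm]; exact twoClasses_left B A

theorem common_eq (H : Finset (Sym2 (Fin (K + 1)))) (C : HamPath (K + 1)) :
    common H C = (pathEdges C ∩ H).card := length_trail_eq

theorem common_comm (A B : HamPath (K + 1)) :
    common (pathEdges A) B = common (pathEdges B) A := by
  rw [common_eq, common_eq, inter_comm]

theorem common_le (H : Finset (Sym2 (Fin (K + 1)))) (C : HamPath (K + 1)) : common H C ≤ K :=
  length_trail_le

theorem common_union_le (A B C : HamPath (K + 1)) :
    common (pathEdges A ∪ pathEdges B) C ≤ common (pathEdges A) C + common (pathEdges B) C := by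
  simp only [common_eq]
  rw [inter_union_distrib_left]
  exact card_union_le _ _

theorem common_mono {H H' : Finset (Sym2 (Fin (K + 1)))} (h : H ⊆ H') (C : HamPath (K + 1)) :
    common H C ≤ common H' C := by
  simp only [common_eq]
  exact card_le_card (inter_subset_inter le_rfl h)

theorem card_union_le_two_mul (A B : HamPath (K + 1)) :
    (pathEdges A ∪ pathEdges B).card ≤ 2 * K := by
  have := card_union_le (pathEdges A) (pathEdges B)
  rw [card_pathEdges, card_pathEdges] at this
  omega

theorem card_union_sdiff_left (A B : HamPath (K + 1)) :
    ((pathEdges A ∪ pathEdges B) \ pathEdges A).card = K - common (pathEdges A) B := by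
  rw [union_sdiff_left, card_sdiff, common_comm, common_eq, card_pathEdges]

theorem card_union_eq (A B : HamPath (K + 1)) : (pathEdges A ∪ pathEdges B).card =
    K + ((pathEdges A ∪ pathEdges B) \ pathEdges A).card := by
  rw [← card_sdiff_add_card_eq_card (s := pathEdges A) subset_union_left, card_pathEdges, add_comm]

/-- At a switch of `C` one of its two edges lies in `B` and the other does not. So the vertex is on
an edge of B ∩ C but is not interior to a run of `B` in `C`, whose two edges there would be both
edges of `C`. It is therefore an end of a run, and each run has two ends. -/
theorem switches_le_runs (A B C : HamPath (K + 1)) :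
    switches (pathEdges A ∪ pathEdges B) (pathEdges B) C ≤ 2 * runs (pathEdges C) B := by
  classical
  unfold switches runs
  rw [isPathList_trail.links_eq]
  have hB := isPathList_trail (H := pathEdges C) (C := B)
  have h1 := hB.card_listVerts nodup_trail
  have h2 := hB.links_eq (fun _ _ => True)
  have hsub : linkVerts (Sw (pathEdges B)) (trail (pathEdges A ∪ pathEdges B) C) ⊆
      listVerts (trail (pathEdges C) B) \ linkVerts (fun _ _ => True) (trail (pathEdges C) B) := by
    intro v hv
    obtain ⟨d, hd, d', hd', h3, h4, h5⟩ := mem_linkVerts.1 hv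
    obtain ⟨i, -, rfl⟩ := mem_trail.1 hd
    obtain ⟨j, -, rfl⟩ := mem_trail.1 hd'
    have hvi : v ∈ edge C i := by rw [← h3]; simp [dedge, edge]
    have hvj : v ∈ edge C j := by rw [← h4]; simp [dedge, edge]
    have hs : ¬ (edge C i ∈ pathEdges B ↔ edge C j ∈ pathEdges B) := h5
    have hin : ∀ k, v ∈ edge C k → edge C k ∈ pathEdges B →
        v ∈ listVerts (trail (pathEdges C) B) := by
      intro k hvk hk
      obtain ⟨k', hk'⟩ := mem_pathEdges.1 hk
      have hmem : dedge B k' ∈ trail (pathEdges C) B :=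
        mem_trail.2 ⟨k', hk' ▸ edge_mem C k, rfl⟩
      rw [← hk', edge, Sym2.mem_iff] at hvk
      simp only [listVerts, mem_union, mem_image, List.mem_toFinset]
      rcases hvk with h | h
      · exact Or.inl ⟨_, hmem, h.symm⟩
      · exact Or.inr ⟨_, hmem, h.symm⟩
    rw [Finset.mem_sdiff]
    constructor
    · by_cases hi : edge C i ∈ pathEdges B
      · exact hin i hvi hi
      · exact hin j hvj (by by_contra hj; exact hs (iff_of_false hi hj))
    · intro hl
      obtain ⟨a, ha, a', ha', g1, g2, -⟩ := mem_linkVerts.1 hl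
      obtain ⟨k, hk, rfl⟩ := mem_trail.1 ha
      obtain ⟨k', hk', rfl⟩ := mem_trail.1 ha'
      have hkk : k ≠ k' := by
        rintro rfl
        have := g1.trans g2.symm
        simp [dedge] at this
        exact Fin.castSucc_lt_succ.ne' this
      have hvk : v ∈ edge B k := by rw [← g1]; simp [dedge, edge]
      have hvk' : v ∈ edge B k' := by rw [← g2]; simp [dedge, edge]
      have heq : ({edge B k, edge B k'} : Finset _) = (pathEdges C).filter fun e => v ∈ e := by
        refine eq_of_subset_of_card_le ?_ ?_
        · intro e he
          rw [mem_insert, mem_singleton] at he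
          rw [mem_filter]
          rcases he with rfl | rfl
          · exact ⟨hk, hvk⟩
          · exact ⟨hk', hvk'⟩
        · rw [card_pair fun h => hkk (edge_injective B h)]
          exact card_pathEdges_at_le C v
      have hall : ∀ e ∈ (pathEdges C).filter (fun e => v ∈ e), e ∈ pathEdges B := by
        intro e he
        rw [← heq, mem_insert, mem_singleton] at he
        rcases he with rfl | rfl
        · exact edge_mem B k
        · exact edge_mem B k'
      exact hs (iff_of_true (hall _ (mem_filter.2 ⟨edge_mem C i, hvi⟩))
        (hall _ (mem_filter.2 ⟨edge_mem C j, hvj⟩)))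
  have h3 := card_le_card hsub
  have h4 : linkVerts (fun _ _ => True) (trail (pathEdges C) B) ⊆
      listVerts (trail (pathEdges C) B) := by
    intro v hv
    obtain ⟨a, ha, -, -, g1, -⟩ := mem_linkVerts.1 hv
    simp only [listVerts, mem_union, mem_image, List.mem_toFinset]
    exact Or.inr ⟨a, ha, g1⟩
  rw [card_sdiff_of_subset h4, ← h2] at h3
  have h5 := (trailData (pathEdges C) B).links_le
  simp only [nlinks] at h5 ⊢
  omega

/-- An edge of `A ∩ B` shares a vertex with an edge of `B ∩ C`. -/
def Bad (A B C : HamPath (K + 1)) : Prop :=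
  ∃ g ∈ pathEdges A ∩ pathEdges B, ∃ f ∈ pathEdges B ∩ pathEdges C, ∃ v, v ∈ g ∧ v ∈ f

theorem Bad.symm {A B C : HamPath (K + 1)} (h : Bad A B C) : Bad C B A := by
  obtain ⟨g, hg, f, hf, v, h1, h2⟩ := h
  exact ⟨f, by rwa [inter_comm], g, by rwa [inter_comm], v, h2, h1⟩

/-- A switch of `C` is a vertex where an edge of A ∩ C meets an edge of B ∩ C. -/
theorem switches_eq_zero {A B C : HamPath (K + 1)} (h : ¬ Bad A C B) :
    switches (pathEdges A ∪ pathEdges B) (pathEdges B) C = 0 := by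
  classical
  unfold switches
  rw [isPathList_trail.links_eq, card_eq_zero, eq_empty_iff_forall_notMem]
  intro v hv
  obtain ⟨d, hd, d', hd', h3, h4, h5⟩ := mem_linkVerts.1 hv
  obtain ⟨i, hi, rfl⟩ := mem_trail.1 hd
  obtain ⟨j, hj, rfl⟩ := mem_trail.1 hd'
  have hvi : v ∈ edge C i := by rw [← h3]; simp [dedge, edge]
  have hvj : v ∈ edge C j := by rw [← h4]; simp [dedge, edge]
  have hs : ¬ (edge C i ∈ pathEdges B ↔ edge C j ∈ pathEdges B) := h5
  rw [mem_union] at hi hj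
  apply h
  by_cases hiB : edge C i ∈ pathEdges B
  · have hjB : edge C j ∉ pathEdges B := fun hj => hs (iff_of_true hiB hj)
    exact ⟨_, mem_inter.2 ⟨hj.resolve_right hjB, edge_mem C j⟩, _,
      mem_inter.2 ⟨edge_mem C i, hiB⟩, v, hvj, hvi⟩
  · have hjB : edge C j ∈ pathEdges B := by by_contra hj; exact hs (iff_of_false hiB hj)
    exact ⟨_, mem_inter.2 ⟨hi.resolve_right hiB, edge_mem C i⟩, _,
      mem_inter.2 ⟨edge_mem C j, hjB⟩, v, hvi, hvj⟩

open Classical in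
/-- The edges of `A ∪ B` that share a vertex with an edge of `A ∩ B`. -/
def touchSet (A B : HamPath (K + 1)) : Finset (Sym2 (Fin (K + 1))) :=
  (pathEdges A ∪ pathEdges B).filter fun e =>
    ∃ v ∈ (pathEdges A ∩ pathEdges B).biUnion (fun g => g.toFinset), v ∈ e

theorem card_touchSet_le (A B : HamPath (K + 1)) :
    (touchSet A B).card ≤ 8 * common (pathEdges A) B := by
  classical
  refine (card_incident_le (twoClasses_left A B) _).trans ?_
  have : ((pathEdges A ∩ pathEdges B).biUnion fun g => g.toFinset).card ≤
      (pathEdges A ∩ pathEdges B).card * 2 := by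
    refine card_biUnion_le_card_mul _ _ _ fun e _ => ?_
    by_cases h : e.IsDiag
    · rw [Sym2.card_toFinset_of_isDiag e h]; norm_num
    · rw [Sym2.card_toFinset_of_not_isDiag e h]
  rw [common_eq, inter_comm (pathEdges B)]
  omega

theorem Bad.touch {A B C : HamPath (K + 1)} (h : Bad A B C) :
    ∃ e ∈ touchSet A B, e ∈ pathEdges C := by
  classical
  obtain ⟨g, hg, f, hf, v, h1, h2⟩ := h
  rw [mem_inter] at hf
  refine ⟨f, mem_filter.2 ⟨mem_union_right _ hf.1, v, ?_, h2⟩, hf.2⟩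
  rw [mem_biUnion]
  exact ⟨g, hg, by simpa using h1⟩

end Overlap

/-! ### Sums over triples -/

section TripleSums
variable {K : ℕ}

open Classical in
/-- The indicator of a proposition. -/
def ind (p : Prop) : ℝ := if p then 1 else 0

theorem ind_nonneg (p : Prop) : 0 ≤ ind p := by unfold ind; split_ifs <;> norm_num

theorem ind_of {p : Prop} (h : p) : ind p = 1 := if_pos h

theorem ind_of_not {p : Prop} (h : ¬ p) : ind p = 0 := if_neg h

/-- Weighted sum over all triples of paths. -/
def tsum3 (f : HamPath (K + 1) → HamPath (K + 1) → HamPath (K + 1) → ℝ) : ℝ :=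
  ∑ A, ∑ B, ∑ C, w3 A B C * f A B C

variable {f g : HamPath (K + 1) → HamPath (K + 1) → HamPath (K + 1) → ℝ}

theorem tsum3_mono (h : ∀ A B C, f A B C ≤ g A B C) : tsum3 f ≤ tsum3 g :=
  sum_le_sum fun A _ => sum_le_sum fun B _ => sum_le_sum fun C _ =>
    mul_le_mul_of_nonneg_left (h A B C) (w3_nonneg A B C)

theorem tsum3_add : tsum3 (fun A B C => f A B C + g A B C) = tsum3 f + tsum3 g := by
  simp only [tsum3, mul_add, sum_add_distrib]

theorem tsum3_mul (c : ℝ) : tsum3 (fun A B C => c * f A B C) = c * tsum3 f := by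
  simp only [tsum3, mul_sum]
  refine sum_congr rfl fun A _ => sum_congr rfl fun B _ => sum_congr rfl fun C _ => by ring

theorem tsum3_swap_left (f : HamPath (K + 1) → HamPath (K + 1) → HamPath (K + 1) → ℝ) :
    tsum3 (fun A B C => f B A C) = tsum3 f := by
  unfold tsum3
  rw [sum_comm]
  refine sum_congr rfl fun A _ => sum_congr rfl fun B _ => sum_congr rfl fun C _ => ?_
  rw [w3_swap_left]

theorem tsum3_swap_right (f : HamPath (K + 1) → HamPath (K + 1) → HamPath (K + 1) → ℝ) :
    tsum3 (fun A B C => f A C B) = tsum3 f := by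
  unfold tsum3
  refine sum_congr rfl fun A _ => ?_
  rw [sum_comm]
  refine sum_congr rfl fun B _ => sum_congr rfl fun C _ => ?_
  rw [w3_swap_right]

theorem tsum3_reverse (f : HamPath (K + 1) → HamPath (K + 1) → HamPath (K + 1) → ℝ) :
    tsum3 (fun A B C => f C B A) = tsum3 f :=
  (tsum3_swap_left fun A B C => f C A B).trans
    ((tsum3_swap_right fun A B C => f B A C).trans (tsum3_swap_left f))

/-- Exposing `A`, then `B`, then `C`. -/
theorem tsum3_le (F₂ B₃ : HamPath (K + 1) → HamPath (K + 1) → ℝ)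
    (F₃ : HamPath (K + 1) → HamPath (K + 1) → HamPath (K + 1) → ℝ) (B₂ : ℝ) (hB₂ : 0 ≤ B₂)
    (hF₂ : ∀ A B, 0 ≤ F₂ A B)
    (h₃ : ∀ A B, F₂ A B ≠ 0 → ∀ u : EdgeOrder (pathEdges A ∪ pathEdges B),
      ∑ C, F₃ A B C * extWeight u C ≤ B₃ A B)
    (h₂ : ∀ A, ∀ u : EdgeOrder (pathEdges A), ∑ B, F₂ A B * B₃ A B * extWeight u B ≤ B₂) :
    tsum3 (fun A B C => F₂ A B * F₃ A B C) ≤ (K + 1) * B₂ := by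
  unfold tsum3
  have h : ∀ A, ∑ B, ∑ C, w3 A B C * (F₂ A B * F₃ A B C) ≤ w1 A * B₂ := by
    intro A
    refine le_trans (sum_le_sum fun B _ => ?_) (sum_w2_le A (fun B => F₂ A B * B₃ A B) B₂ (h₂ A))
    by_cases h0 : F₂ A B = 0
    · simp [h0]
    · have := sum_w3_le A B (F₃ A B) (B₃ A B) (h₃ A B h0)
      calc ∑ C, w3 A B C * (F₂ A B * F₃ A B C) = F₂ A B * ∑ C, w3 A B C * F₃ A B C := by
            rw [mul_sum]; exact sum_congr rfl fun C _ => by ring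
        _ ≤ F₂ A B * (w2 A B * B₃ A B) := mul_le_mul_of_nonneg_left this (hF₂ A B)
        _ = _ := by ring
  calc _ ≤ ∑ A, w1 A * B₂ := sum_le_sum fun A _ => h A
    _ = (∑ A : HamPath (K + 1), w1 A) * B₂ := by rw [sum_mul]
    _ ≤ _ := mul_le_mul_of_nonneg_right sum_w1_le hB₂

theorem sum_ind_mul {H : Finset (Sym2 (Fin (K + 1)))} (u : EdgeOrder H)
    (p : HamPath (K + 1) → Prop) [DecidablePred p] (F : HamPath (K + 1) → ℝ) :
    ∑ C, ind (p C) * F C * extWeight u C = ∑ C ∈ univ.filter p, F C * extWeight u C := by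
  rw [sum_filter]
  refine sum_congr rfl fun C _ => ?_
  unfold ind
  split_ifs <;> ring

/-! ### Triples with small overlaps -/

/-- Two paths with few common edges. -/
def Far (A B : HamPath (K + 1)) : Prop := 40 * common (pathEdges A) B ≤ K + 1

/-- Three paths with few common edges. -/
def AllFar (A B C : HamPath (K + 1)) : Prop := Far A B ∧ Far A C ∧ Far B C

theorem Far.symm {A B : HamPath (K + 1)} (h : Far A B) : Far B A := by
  unfold Far at *; rwa [common_comm]

theorem AllFar.swap_left {A B C : HamPath (K + 1)} (h : AllFar A B C) : AllFar B A C :=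
  ⟨h.1.symm, h.2.2, h.2.1⟩

theorem AllFar.swap_right {A B C : HamPath (K + 1)} (h : AllFar A B C) : AllFar A C B :=
  ⟨h.2.1, h.1, h.2.2.symm⟩

theorem AllFar.third {A B C : HamPath (K + 1)} (h : AllFar A B C) :
    20 * common (pathEdges A ∪ pathEdges B) C ≤ K + 1 := by
  obtain ⟨-, h2, h3⟩ := h
  have := common_union_le A B C
  unfold Far at *
  omega

theorem farF_eq (H P : Finset (Sym2 (Fin (K + 1)))) (C : HamPath (K + 1)) :
    farF P (trail H C) = (1 / 30) ^ switches H P C * (11 / 10) ^ common H C * 900 ^ runs H C := rfl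

theorem switches_self (A B : HamPath (K + 1)) :
    switches (pathEdges A) (pathEdges A) B = 0 := by
  have := switches_le (H := pathEdges A) (P := pathEdges A) B
  rw [sdiff_self, bot_eq_empty, card_empty] at this
  omega

theorem farConst_pos : 0 < farConst := Real.exp_pos _

theorem sum_far_pair_le (A : HamPath (K + 1)) (u : EdgeOrder (pathEdges A)) (c : ℝ) :
    ∑ B, ind (Far A B) * (c * farF (pathEdges A) (trail (pathEdges A) B)) * extWeight u B ≤
      |c| * (farConst * (K + 1)) := by
  classical
  rw [sum_ind_mul u]
  have h := sum_far_le (twoClasses_self A) (by rw [card_pathEdges]; omega) u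
    (univ.filter fun B => Far A B) (by
      intro B hB
      have := (mem_filter.1 hB).2
      unfold Far at this
      omega)
  simp_rw [mul_assoc]
  rw [← mul_sum]
  refine le_trans (mul_le_mul_of_nonneg_right (le_abs_self c) ?_)
    (mul_le_mul_of_nonneg_left h (abs_nonneg c))
  exact sum_nonneg fun B _ => mul_nonneg (farF_nonneg _) (extWeight_nonneg u B)

/-- Without `Bad A C B` the last path has no switches, so its switch weight is trivial. The weights
(11/10) per common edge then exceed (11/10)^M in total, which is divided out. -/
theorem tsum3_far_le (M : ℕ) :
    tsum3 (fun A B C : HamPath (K + 1) => ind (AllFar A B C ∧ ¬ Bad A C B ∧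
      M ≤ common (pathEdges A) B + common (pathEdges A ∪ pathEdges B) C)) ≤
    farConst ^ 2 * (K + 1) ^ 3 * (11 / 10 : ℝ)⁻¹ ^ M := by
  classical
  have hz : (0 : ℝ) ≤ (11 / 10 : ℝ)⁻¹ ^ M := by positivity
  have h1 := tsum3_le (K := K)
    (fun A B => ind (Far A B) * farF (pathEdges A) (trail (pathEdges A) B))
    (fun _ _ => farConst * (K + 1))
    (fun A B C => ind (20 * common (pathEdges A ∪ pathEdges B) C ≤ K + 1) *
      farF (pathEdges B) (trail (pathEdges A ∪ pathEdges B) C))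
    (farConst * (K + 1) * (farConst * (K + 1)))
    (by have := farConst_pos; positivity)
    (fun A B => mul_nonneg (ind_nonneg _) (farF_nonneg _)) ?_ ?_
  · have h2 : tsum3 (fun A B C : HamPath (K + 1) => ind (AllFar A B C ∧ ¬ Bad A C B ∧
        M ≤ common (pathEdges A) B + common (pathEdges A ∪ pathEdges B) C)) ≤
        tsum3 (fun A B C : HamPath (K + 1) => (11 / 10 : ℝ)⁻¹ ^ M *
          (ind (Far A B) * farF (pathEdges A) (trail (pathEdges A) B) *
          (ind (20 * common (pathEdges A ∪ pathEdges B) C ≤ K + 1) *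
          farF (pathEdges B) (trail (pathEdges A ∪ pathEdges B) C)))) := by
      refine tsum3_mono fun A B C => ?_
      by_cases hc : AllFar A B C ∧ ¬ Bad A C B ∧
        M ≤ common (pathEdges A) B + common (pathEdges A ∪ pathEdges B) C
      · obtain ⟨h, hb, hM⟩ := hc
        rw [ind_of ⟨h, hb, hM⟩, ind_of h.1, ind_of h.third, farF_eq, farF_eq, switches_self,
          switches_eq_zero hb]
        have e1 : (1 : ℝ) ≤ 900 ^ runs (pathEdges A) B := one_le_pow₀ (by norm_num)
        have e2 : (1 : ℝ) ≤ 900 ^ runs (pathEdges A ∪ pathEdges B) C := one_le_pow₀ (by norm_num)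
        set p := common (pathEdges A) B
        set t := common (pathEdges A ∪ pathEdges B) C
        have e3 : (1 : ℝ) ≤ (11 / 10 : ℝ)⁻¹ ^ M * ((11 / 10) ^ p * (11 / 10) ^ t) := by
          rw [← pow_add, inv_pow, ← div_eq_inv_mul, one_le_div (by positivity)]
          exact pow_le_pow_right₀ (by norm_num) hM
        calc (1 : ℝ) ≤ (11 / 10 : ℝ)⁻¹ ^ M * ((11 / 10) ^ p * (11 / 10) ^ t) *
            (900 ^ runs (pathEdges A) B * 900 ^ runs (pathEdges A ∪ pathEdges B) C) :=
              one_le_mul_of_one_le_of_one_le e3 (one_le_mul_of_one_le_of_one_le e1 e2)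
          _ = _ := by ring
      · rw [ind_of_not hc]
        exact mul_nonneg hz (mul_nonneg (mul_nonneg (ind_nonneg _) (farF_nonneg _))
          (mul_nonneg (ind_nonneg _) (farF_nonneg _)))
    rw [tsum3_mul] at h2
    calc _ ≤ _ := h2
      _ ≤ (11 / 10 : ℝ)⁻¹ ^ M * ((K + 1) * (farConst * (K + 1) * (farConst * (K + 1)))) :=
          mul_le_mul_of_nonneg_left h1 hz
      _ = _ := by ring
  · intro A B _ u
    rw [sum_ind_mul u]
    exact sum_far_le (twoClasses_right A B) (card_union_le_two_mul A B) u _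
      fun C hC => (mem_filter.1 hC).2
  · intro A u
    have h := sum_far_pair_le A u (farConst * (K + 1))
    rw [abs_of_nonneg (by have := farConst_pos; positivity)] at h
    refine le_trans (le_of_eq (sum_congr rfl fun B _ => ?_)) h
    ring

/-- Let p = (1/30)^b 900^k for the exposure A, B, C and q the same for C, B, A. As b ≤ 2k' and b' ≤
2k, cross-pairing the factors with 900 = 30² gives pq ≥ 1, hence 1 ≤ (p+q)/2. Both terms have the
same sum by symmetry. In it the last path must use an edge touching A ∩ B, which replaces a factor n
by O(|A ∩ B|), and this is absorbed by the weight (11/10) per common edge. -/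
theorem tsum3_far_bad_le :
    tsum3 (fun A B C : HamPath (K + 1) => ind (AllFar A B C ∧ Bad A B C)) ≤
      63360000 * farConst ^ 2 * (K + 1) ^ 2 := by
  classical
  have hfc := farConst_pos
  set f₁ : HamPath (K + 1) → HamPath (K + 1) → HamPath (K + 1) → ℝ := fun A B C =>
    ind (AllFar A B C ∧ Bad A B C) * ((1 / 30) ^ switches (pathEdges A ∪ pathEdges B) (pathEdges B) C *
      900 ^ runs (pathEdges A) B) with hf₁
  have h1 : tsum3 (fun A B C : HamPath (K + 1) => ind (AllFar A B C ∧ Bad A B C)) ≤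
      tsum3 (fun A B C => 1 / 2 * (f₁ A B C + f₁ C B A)) := by
    refine tsum3_mono fun A B C => ?_
    by_cases h : AllFar A B C ∧ Bad A B C
    · have h' : AllFar C B A ∧ Bad C B A :=
        ⟨h.1.swap_left.swap_right.swap_left, h.2.symm⟩
      simp only [hf₁]
      rw [ind_of h, ind_of h', one_mul, one_mul]
      have s1 := switches_le_runs A B C
      have s2 := switches_le_runs C B A
      set b := switches (pathEdges A ∪ pathEdges B) (pathEdges B) C
      set b' := switches (pathEdges C ∪ pathEdges B) (pathEdges B) A
      set k := runs (pathEdges A) B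
      set k' := runs (pathEdges C) B
      have key : ∀ b k : ℕ, b ≤ 2 * k → (1 : ℝ) ≤ (1 / 30) ^ b * 900 ^ k := by
        intro b k hbk
        have e : (900 : ℝ) ^ k = 30 ^ (2 * k) := by rw [pow_mul]; norm_num
        have e2 : (30 : ℝ) ^ b ≤ 30 ^ (2 * k) := pow_le_pow_right₀ (by norm_num) hbk
        rw [e, div_pow, one_pow, div_mul_eq_mul_div, one_mul, one_le_div (by positivity)]
        exact e2
      have e1 := key b k' s1
      have e2 := key b' k s2
      have e3 : (1 : ℝ) ≤ ((1 / 30) ^ b * 900 ^ k) * ((1 / 30) ^ b' * 900 ^ k') := by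
        calc (1 : ℝ) ≤ ((1 / 30) ^ b * 900 ^ k') * ((1 / 30) ^ b' * 900 ^ k) :=
              one_le_mul_of_one_le_of_one_le e1 e2
          _ = _ := by ring
      have p1 : (0 : ℝ) ≤ (1 / 30) ^ b * 900 ^ k := by positivity
      have p2 : (0 : ℝ) ≤ (1 / 30) ^ b' * 900 ^ k' := by positivity
      nlinarith [sq_nonneg ((1 / 30 : ℝ) ^ b * 900 ^ k - (1 / 30) ^ b' * 900 ^ k')]
    · rw [ind_of_not h]
      have n1 : ∀ A B C, 0 ≤ f₁ A B C := fun A B C => mul_nonneg (ind_nonneg _) (by positivity)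
      have := n1 A B C
      have := n1 C B A
      linarith
  rw [tsum3_mul, tsum3_add, tsum3_reverse f₁] at h1
  have h2 := tsum3_le (K := K)
    (fun A B => ind (Far A B) * 900 ^ runs (pathEdges A) B)
    (fun A B => 792000 * farConst * (8 * common (pathEdges A) B))
    (fun A B C => ind (20 * common (pathEdges A ∪ pathEdges B) C ≤ K + 1 ∧
        ∃ e ∈ touchSet A B, e ∈ pathEdges C) *
      farF (pathEdges B) (trail (pathEdges A ∪ pathEdges B) C))
    (63360000 * farConst * (farConst * (K + 1))) (by positivity)
    (fun A B => mul_nonneg (ind_nonneg _) (by positivity)) ?_ ?_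
  · have h3 : tsum3 f₁ ≤ tsum3 (fun A B C : HamPath (K + 1) =>
        ind (Far A B) * 900 ^ runs (pathEdges A) B *
        (ind (20 * common (pathEdges A ∪ pathEdges B) C ≤ K + 1 ∧
          ∃ e ∈ touchSet A B, e ∈ pathEdges C) *
          farF (pathEdges B) (trail (pathEdges A ∪ pathEdges B) C))) := by
      refine tsum3_mono fun A B C => ?_
      simp only [hf₁]
      by_cases h : AllFar A B C ∧ Bad A B C
      · rw [ind_of h, ind_of h.1.1, ind_of ⟨h.1.third, h.2.touch⟩, farF_eq]
        have e1 : (1 : ℝ) ≤ (11 / 10) ^ common (pathEdges A ∪ pathEdges B) C :=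
          one_le_pow₀ (by norm_num)
        have e2 : (1 : ℝ) ≤ 900 ^ runs (pathEdges A ∪ pathEdges B) C := one_le_pow₀ (by norm_num)
        set b := switches (pathEdges A ∪ pathEdges B) (pathEdges B) C
        set k := runs (pathEdges A) B
        have p1 : (0 : ℝ) ≤ (1 / 30) ^ b * 900 ^ k := by positivity
        calc 1 * ((1 / 30 : ℝ) ^ b * 900 ^ k) ≤ ((11 / 10) ^ common (pathEdges A ∪ pathEdges B) C *
            900 ^ runs (pathEdges A ∪ pathEdges B) C) * ((1 / 30 : ℝ) ^ b * 900 ^ k) :=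
              mul_le_mul_of_nonneg_right (one_le_mul_of_one_le_of_one_le e1 e2) p1
          _ = _ := by ring
      · rw [ind_of_not h, zero_mul]
        exact mul_nonneg (mul_nonneg (ind_nonneg _) (by positivity))
          (mul_nonneg (ind_nonneg _) (farF_nonneg _))
    have h4 := h3.trans h2
    calc _ ≤ _ := h1
      _ = tsum3 f₁ := by ring
      _ ≤ _ := h4
      _ = _ := by ring
  · intro A B _ u
    rw [sum_ind_mul u]
    refine (sum_far_touch_le (twoClasses_right A B) (card_union_le_two_mul A B) u _
      (fun C hC => (mem_filter.1 hC).2.1) (touchSet A B) (filter_subset _ _)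
      (fun C hC => (mem_filter.1 hC).2.2)).trans ?_
    have : ((touchSet A B).card : ℝ) ≤ 8 * common (pathEdges A) B := by
      exact_mod_cast card_touchSet_le A B
    gcongr
  · intro A u
    have h := sum_far_pair_le A u (63360000 * farConst)
    rw [abs_of_nonneg (by positivity)] at h
    refine le_trans (sum_le_sum fun B _ => mul_le_mul_of_nonneg_right ?_ (extWeight_nonneg u B)) h
    rw [mul_assoc]
    refine mul_le_mul_of_nonneg_left ?_ (ind_nonneg _)
    rw [farF_eq, switches_self]
    have hp : (common (pathEdges A) B : ℝ) ≤ 10 * (11 / 10) ^ common (pathEdges A) B := by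
      have := one_add_mul_le_pow (a := (1 / 10 : ℝ)) (by norm_num) (common (pathEdges A) B)
      norm_num at this ⊢
      linarith
    calc (900 : ℝ) ^ runs (pathEdges A) B * (792000 * farConst * (8 * common (pathEdges A) B)) ≤
        900 ^ runs (pathEdges A) B *
          (792000 * farConst * (8 * (10 * (11 / 10) ^ common (pathEdges A) B))) := by gcongr
      _ = _ := by ring

end TripleSums

/-! ### Triples with large overlaps -/

section Large
variable {K : ℕ}

/-- Two paths that agree in nearly all edges. -/
def Near (A B : HamPath (K + 1)) : Prop :=
  8388608 * (K - common (pathEdges A) B) ≤ K + 1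

/-- Two paths with an intermediate overlap. -/
def Mid (A B : HamPath (K + 1)) : Prop := ¬ Far A B ∧ ¬ Near A B

theorem Near.symm {A B : HamPath (K + 1)} (h : Near A B) : Near B A := by
  unfold Near at *; rwa [common_comm]

/-- The base is 262144 = 4^9, the cost per differing edge in `sum_near_le`. The threshold 8388608 =
2·16·4^9 makes 16D(m+1) ≤ K+1: one half for m, the other half, by `hK`, for the summand 1. -/
theorem sum_near_pair_le (A : HamPath (K + 1)) (u : EdgeOrder (pathEdges A)) (hK : 8388608 ≤ K)
    {c : ℝ} (hc : 0 ≤ c) :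
    ∑ B, ind (Near A B) * (c * (262144 : ℕ) ^ (K - common (pathEdges A) B)) * extWeight u B ≤
      c * (16 * Real.exp (128 * (262144 : ℕ))) := by
  classical
  rw [sum_ind_mul u]
  have hs : (pathEdges A \ pathEdges A).card = 0 := by simp
  have h := sum_near_le (twoClasses_self A) (by rw [hs, card_pathEdges]; rfl)
    (by rw [card_pathEdges]; omega) u (D := 262144) (by norm_num) (univ.filter fun B => Near A B) (by
      intro B hB
      have h1 := (mem_filter.1 hB).2
      have h2 := common_le (pathEdges A) B
      unfold Near at h1
      constructor <;> omega)
  rw [hs, pow_zero, mul_one] at h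
  simp_rw [mul_assoc c]
  rw [← mul_sum]
  exact mul_le_mul_of_nonneg_left h hc

/-- The third path has at most 2m switches, where m is the number of edges of `A` missing in `B`. A
factor 900^m pays for them, and the sum over near paths `B` tolerates 262144^m. -/
theorem tsum3_near_far_le (hK : 8388608 ≤ K) :
    tsum3 (fun A B C : HamPath (K + 1) => ind (Near A B ∧
      20 * common (pathEdges A ∪ pathEdges B) C ≤ K + 1)) ≤
    farConst * (16 * Real.exp (128 * (262144 : ℕ))) * (K + 1) ^ 2 := by
  classical
  have hfc := farConst_pos
  have h1 := tsum3_le (K := K) (fun A B => ind (Near A B))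
    (fun A B => farConst * (K + 1) * (262144 : ℕ) ^ (K - common (pathEdges A) B))
    (fun A B C => ind (20 * common (pathEdges A ∪ pathEdges B) C ≤ K + 1) * 1)
    (farConst * (K + 1) * (16 * Real.exp (128 * (262144 : ℕ))))
    (by positivity) (fun A B => ind_nonneg _) ?_ ?_
  · refine (tsum3_mono fun A B C => ?_).trans (h1.trans (le_of_eq (by ring)))
    by_cases h : Near A B ∧ 20 * common (pathEdges A ∪ pathEdges B) C ≤ K + 1
    · rw [ind_of h, ind_of h.1, ind_of h.2]; norm_num
    · rw [ind_of_not h]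
      exact mul_nonneg (ind_nonneg _) (mul_nonneg (ind_nonneg _) zero_le_one)
  · intro A B _ u
    rw [sum_ind_mul u]
    set m := K - common (pathEdges A) B with hm
    have h2 := sum_far_le (twoClasses_left A B) (card_union_le_two_mul A B) u
      (univ.filter fun C => 20 * common (pathEdges A ∪ pathEdges B) C ≤ K + 1)
      (fun C hC => (mem_filter.1 hC).2)
    have h3 : ∀ C, (1 : ℝ) ≤ 900 ^ m * farF (pathEdges A) (trail (pathEdges A ∪ pathEdges B) C) := by
      intro C
      rw [farF_eq]
      have hs := switches_le (H := pathEdges A ∪ pathEdges B) (P := pathEdges A) C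
      rw [card_union_sdiff_left, ← hm] at hs
      set b := switches (pathEdges A ∪ pathEdges B) (pathEdges A) C
      have e : (900 : ℝ) ^ m = 30 ^ (2 * m) := by rw [pow_mul]; norm_num
      have e2 : (30 : ℝ) ^ b ≤ 30 ^ (2 * m) := pow_le_pow_right₀ (by norm_num) hs
      have e3 : (1 : ℝ) ≤ 900 ^ m * (1 / 30) ^ b := by
        rw [e, div_pow, one_pow, mul_one_div, one_le_div (by positivity)]
        exact e2
      have e4 : (1 : ℝ) ≤ (11 / 10) ^ common (pathEdges A ∪ pathEdges B) C :=
        one_le_pow₀ (by norm_num)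
      have e5 : (1 : ℝ) ≤ 900 ^ runs (pathEdges A ∪ pathEdges B) C := one_le_pow₀ (by norm_num)
      rw [← mul_assoc, ← mul_assoc]
      exact one_le_mul_of_one_le_of_one_le (one_le_mul_of_one_le_of_one_le e3 e4) e5
    calc _ ≤ ∑ C ∈ univ.filter (fun C => 20 * common (pathEdges A ∪ pathEdges B) C ≤ K + 1),
          900 ^ m * (farF (pathEdges A) (trail (pathEdges A ∪ pathEdges B) C) * extWeight u C) := by
          refine sum_le_sum fun C _ => ?_
          rw [← mul_assoc]
          exact mul_le_mul_of_nonneg_right (h3 C) (extWeight_nonneg u C)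
      _ ≤ 900 ^ m * (farConst * (K + 1)) := by
          rw [← mul_sum]
          exact mul_le_mul_of_nonneg_left h2 (by positivity)
      _ ≤ (262144 : ℕ) ^ m * (farConst * (K + 1)) := by
          gcongr
          norm_num
      _ = _ := by ring
  · intro A u
    refine le_trans (le_of_eq (sum_congr rfl fun B _ => ?_))
      (sum_near_pair_le A u hK (c := farConst * (K + 1)) (by positivity))
    rfl

/-- The third path nearly coincides with A ∪ B and costs (4^9)^m, exactly the weight tolerated in
the sum over `B`. -/
theorem tsum3_near_near_le (hK : 8388608 ≤ K) :
    tsum3 (fun A B C : HamPath (K + 1) => ind (Near A B ∧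
      8388608 * (K - common (pathEdges A ∪ pathEdges B) C) ≤ K + 1)) ≤
    16 * Real.exp (128 * (1 : ℕ)) * (16 * Real.exp (128 * (262144 : ℕ))) * (K + 1) := by
  classical
  have h1 := tsum3_le (K := K) (fun A B => ind (Near A B))
    (fun A B => 16 * Real.exp (128 * (1 : ℕ)) * (262144 : ℕ) ^ (K - common (pathEdges A) B))
    (fun A B C => ind (8388608 * (K - common (pathEdges A ∪ pathEdges B) C) ≤ K + 1) * 1)
    (16 * Real.exp (128 * (1 : ℕ)) * (16 * Real.exp (128 * (262144 : ℕ))))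
    (by positivity) (fun A B => ind_nonneg _) ?_ ?_
  · refine (tsum3_mono fun A B C => ?_).trans (h1.trans (le_of_eq (by ring)))
    by_cases h : Near A B ∧ 8388608 * (K - common (pathEdges A ∪ pathEdges B) C) ≤ K + 1
    · rw [ind_of h, ind_of h.1, ind_of h.2]; norm_num
    · rw [ind_of_not h]
      exact mul_nonneg (ind_nonneg _) (mul_nonneg (ind_nonneg _) zero_le_one)
  · intro A B _ u
    rw [sum_ind_mul u]
    have h2 := sum_near_le (twoClasses_left A B) (card_union_eq A B) (card_union_le_two_mul A B) u
      (D := 1) le_rfl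
      (univ.filter fun C => 8388608 * (K - common (pathEdges A ∪ pathEdges B) C) ≤ K + 1) (by
      intro C hC
      have h1 := (mem_filter.1 hC).2
      have h2 := common_le (pathEdges A ∪ pathEdges B) C
      constructor <;> omega)
    rw [card_union_sdiff_left] at h2
    refine le_trans (le_of_eq (sum_congr rfl fun C _ => ?_)) (h2.trans (le_of_eq ?_))
    · rw [Nat.cast_one, one_pow]
    · norm_num
  · intro A u
    exact sum_near_pair_le A u hK (c := 16 * Real.exp (128 * (1 : ℕ))) (by positivity)

/-- There are suitable parameters for the intermediate range. -/
theorem exists_mid_params {E : ℕ} (hE : 0 < E) : ∃ τ h : ℝ, 0 < τ ∧ τ < 1 ∧ 0 < h ∧ h ≤ 1 ∧ (1 + h) ^ 3 * τ ≤ 1 ∧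
    τ ^ (4 * E) = 78 / 79 := by
  set τ : ℝ := (78 / 79 : ℝ) ^ (((4 * E : ℕ) : ℝ)⁻¹) with hτ
  have hτ0 : 0 < τ := Real.rpow_pos_of_pos (by norm_num) _
  have hτ1 : τ < 1 := Real.rpow_lt_one (by norm_num) (by norm_num) (by positivity)
  have hpow : τ ^ (4 * E) = 78 / 79 :=
    Real.rpow_inv_natCast_pow (by norm_num) (by omega)
  -- For h ≤ 1 one has (1+h)³ ≤ 1+7h = 2-τ, and (2-τ)τ = 1-(1-τ)² ≤ 1.
  set h : ℝ := (1 - τ) / 7 with hh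
  have h0 : 0 < h := by rw [hh]; linarith
  have h1 : h ≤ 1 := by rw [hh]; linarith
  refine ⟨τ, h, hτ0, hτ1, h0, h1, ?_, hpow⟩
  have e1 : (1 + h) ^ 3 ≤ 1 + 7 * h := by nlinarith [mul_nonneg h0.le (sub_nonneg.2 h1), mul_nonneg (mul_nonneg h0.le h0.le) (sub_nonneg.2 h1)]
  have e2 : 1 + 7 * h = 2 - τ := by rw [hh]; ring
  calc (1 + h) ^ 3 * τ ≤ (2 - τ) * τ := by
        rw [← e2]; exact mul_le_mul_of_nonneg_right e1 hτ0.le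
    _ ≤ 1 := by nlinarith [sq_nonneg (1 - τ)]

/-- The third path is only bounded by the lossy (1+h)^(2n), since A ∪ B has at most 2K edges. Any
exponential gain has to come from `S`. -/
theorem tsum3_gen_le {h y : ℝ} (h0 : 0 < h) (h1 : h ≤ 1) (hy : 0 ≤ y)
    (G : HamPath (K + 1) → HamPath (K + 1) → Prop) (S : ℝ) (hS0 : 0 ≤ S)
    (hS : ∀ A, ∀ u : EdgeOrder (pathEdges A), ∑ B, ind (G A B) *
      genF (pathEdges A) (h / 12) y (trail (pathEdges A) B) * extWeight u B ≤ S) :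
    tsum3 (fun A B C : HamPath (K + 1) => ind (G A B) * (y ^ runs (pathEdges A) B *
      (h / 12) ^ switches (pathEdges A ∪ pathEdges B) (pathEdges B) C)) ≤
    (K + 1) * ((K + 1) * genConst h 1 * (1 + h) ^ (2 * (K + 1)) * S) := by
  have hc : 0 ≤ genConst h 1 := zero_le_one.trans (one_le_genConst h0 zero_le_one)
  have hg : ∀ A B : HamPath (K + 1), genF (pathEdges A) (h / 12) y (trail (pathEdges A) B) =
      y ^ runs (pathEdges A) B := by
    intro A B
    have : genF (pathEdges A) (h / 12) y (trail (pathEdges A) B) =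
      (h / 12) ^ switches (pathEdges A) (pathEdges A) B * y ^ runs (pathEdges A) B := rfl
    rw [this, switches_self, pow_zero, one_mul]
  have h2 := tsum3_le (K := K) (fun A B => ind (G A B) * y ^ runs (pathEdges A) B)
    (fun A B => (K + 1) * genConst h 1 * (1 + h) ^ (2 * (K + 1)))
    (fun A B C => genF (pathEdges B) (h / 12) 1 (trail (pathEdges A ∪ pathEdges B) C))
    ((K + 1) * genConst h 1 * (1 + h) ^ (2 * (K + 1)) * S) (by positivity)
    (fun A B => mul_nonneg (ind_nonneg _) (by positivity)) ?_ ?_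
  · refine le_trans (le_of_eq ?_) h2
    congr 1
    ext A B C
    have : genF (pathEdges B) (h / 12) 1 (trail (pathEdges A ∪ pathEdges B) C) =
      (h / 12) ^ switches (pathEdges A ∪ pathEdges B) (pathEdges B) C *
        1 ^ runs (pathEdges A ∪ pathEdges B) C := rfl
    rw [this, one_pow]
    ring
  · intro A B _ u
    refine (sum_gen_le (twoClasses_right A B) u h0 h1 zero_le_one univ).trans ?_
    have := card_union_le_two_mul A B
    refine mul_le_mul_of_nonneg_left ?_ (by positivity)
    exact pow_le_pow_right₀ (by linarith) (by omega)
  · intro A u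
    calc _ = (K + 1) * genConst h 1 * (1 + h) ^ (2 * (K + 1)) *
        ∑ B, ind (G A B) * genF (pathEdges A) (h / 12) y (trail (pathEdges A) B) *
          extWeight u B := by
          rw [mul_sum]
          refine sum_congr rfl fun B _ => ?_
          rw [hg]
          ring
      _ ≤ _ := mul_le_mul_of_nonneg_left (hS A u) (by positivity)

theorem tsum3_mid_le : ∃ c : ℝ, 0 ≤ c ∧ ∀ K : ℕ,
    tsum3 (fun A B _ : HamPath (K + 1) => ind (Mid A B)) ≤ c := by
  classical
  obtain ⟨E, hE⟩ : ∃ E : ℕ, E = 8388608 := ⟨_, rfl⟩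
  obtain ⟨τ, h, hτ0, hτ1, h0, h1, hτh, hτp⟩ := exists_mid_params (E := E) (by omega)
  set x := h / 12 with hx
  have hx0 : 0 < x := by positivity
  set y := (x ^ 2)⁻¹ with hy
  have hy0 : 0 < y := by positivity
  set G1 := genConst h 1
  set G2 := genConst h (2 * y)
  set G3 := genConst h y
  have hG1 : 0 ≤ G1 := zero_le_one.trans (one_le_genConst h0 zero_le_one)
  have hG2 : 0 ≤ G2 := zero_le_one.trans (one_le_genConst h0 (by positivity))
  have hG3 : 0 ≤ G3 := zero_le_one.trans (one_le_genConst h0 hy0.le)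
  -- Three exposures cost n³; it is killed by one spare power τ^n.
  have hlim := tendsto_pow_const_mul_const_pow_of_lt_one 3 hτ0.le hτ1
  obtain ⟨c, hc⟩ := hlim.bddAbove_range
  have hc' : ∀ n : ℕ, (n : ℝ) ^ 3 * τ ^ n ≤ c := fun n => hc ⟨n, rfl⟩
  have hc0 : 0 ≤ c := by simpa using hc' 0
  refine ⟨c * (G1 * G2 + G1 * G3 / 2), by positivity, fun K => ?_⟩
  have hn : (0 : ℝ) < K + 1 := by positivity
  set f₁ : HamPath (K + 1) → HamPath (K + 1) → HamPath (K + 1) → ℝ := fun A B C =>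
    ind (Mid A B) * (y ^ runs (pathEdges A) B *
      x ^ switches (pathEdges A ∪ pathEdges B) (pathEdges B) C) with hf₁
  set f₂ : HamPath (K + 1) → HamPath (K + 1) → HamPath (K + 1) → ℝ := fun A B C =>
    ind True * (y ^ runs (pathEdges A) B *
      x ^ switches (pathEdges A ∪ pathEdges B) (pathEdges B) C) with hf₂
  -- In the reversed exposure the pair (A, B) is exposed last, so its gain from `Mid` is not
  -- available and `f₂` carries no restriction. The gain τ^(4n) of the first term is shared by
  -- weighting the two means with s and 1/s, which leaves τ^(2n) for each.
  set s := (τ ^ (2 * (K + 1)))⁻¹ with hs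
  have hs0 : 0 < s := by positivity
  have e1 : tsum3 (fun A B C : HamPath (K + 1) => ind (Mid A B)) ≤
      tsum3 (fun A B C => s / 2 * f₁ A B C + s⁻¹ / 2 * f₂ C B A) := by
    refine tsum3_mono fun A B C => ?_
    by_cases hm : Mid A B
    · simp only [hf₁, hf₂]
      rw [ind_of hm, ind_of trivial, one_mul, one_mul]
      have s1 := switches_le_runs A B C
      have s2 := switches_le_runs C B A
      set b := switches (pathEdges A ∪ pathEdges B) (pathEdges B) C
      set b' := switches (pathEdges C ∪ pathEdges B) (pathEdges B) A
      set k := runs (pathEdges A) B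
      set k' := runs (pathEdges C) B
      have key : ∀ b k : ℕ, b ≤ 2 * k → (1 : ℝ) ≤ x ^ b * y ^ k := by
        intro b k hbk
        rw [hy, inv_pow, ← pow_mul, ← div_eq_mul_inv, one_le_div (by positivity)]
        exact pow_le_pow_of_le_one hx0.le (by rw [hx]; linarith) hbk
      have e1 := key b k' s1
      have e2 := key b' k s2
      have e3 : (1 : ℝ) ≤ (y ^ k * x ^ b) * (y ^ k' * x ^ b') := by
        calc (1 : ℝ) ≤ (x ^ b * y ^ k') * (x ^ b' * y ^ k) :=
              one_le_mul_of_one_le_of_one_le e1 e2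
          _ = _ := by ring
      set p := y ^ k * x ^ b
      set q := y ^ k' * x ^ b'
      have hp : 0 < p := by positivity
      have hss : s * s⁻¹ = 1 := mul_inv_cancel₀ hs0.ne'
      have hpq : (1 : ℝ) ≤ (s * p) * (s⁻¹ * q) := by
        calc (1 : ℝ) ≤ p * q := e3
          _ = (s * s⁻¹) * (p * q) := by rw [hss, one_mul]
          _ = _ := by ring
      have hsp : 0 < s * p := by positivity
      have hsq : 0 < s⁻¹ * q := by positivity
      nlinarith [sq_nonneg (s * p - s⁻¹ * q)]
    · simp only [hf₁, hf₂]
      rw [ind_of_not hm, ind_of trivial]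
      have : 0 ≤ s⁻¹ / 2 * (1 * (y ^ runs (pathEdges C) B *
        x ^ switches (pathEdges C ∪ pathEdges B) (pathEdges B) A)) := by positivity
      linarith
  rw [tsum3_add, tsum3_mul, tsum3_mul, tsum3_reverse f₂] at e1
  -- The value β = 79/78 is allowed because a pair that is not far has 40m ≤ 39K. A pair that is not
  -- near has Em ≥ K+1, so (78/79)^m = τ^(4Em) ≤ τ^(4(K+1)).
  have e2 := tsum3_gen_le (K := K) h0 h1 hy0.le Mid
    (2 * (K + 1) * τ ^ (4 * (K + 1)) * G2 * (1 + h) ^ (K + 1)) (by positivity) (by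
      intro A u
      rw [sum_ind_mul u]
      refine sum_mid_le (twoClasses_self A) (card_pathEdges A) u h0 h1 hy0.le (β := 79 / 78)
        (by norm_num) (by positivity) _ ?_
      intro B hB
      obtain ⟨g1, g2⟩ := (mem_filter.1 hB).2
      unfold Far at g1
      unfold Near at g2
      have g3 := common_le (pathEdges A) B
      refine ⟨by omega, ?_, ?_⟩
      · have : 40 * (K - common (pathEdges A) B) ≤ 39 * K := by omega
        have : (40 : ℝ) * ((K - common (pathEdges A) B : ℕ) : ℝ) ≤ 39 * K := by exact_mod_cast this
        linarith
      · have e : (79 / 78 : ℝ)⁻¹ = τ ^ (4 * E) := by rw [hτp]; norm_num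
        rw [e, ← pow_mul]
        exact pow_le_pow_of_le_one hτ0.le hτ1.le (by subst hE; omega))
  have e3 := tsum3_gen_le (K := K) h0 h1 hy0.le (fun _ _ => True)
    ((K + 1) * G3 * (1 + h) ^ (K + 1)) (by positivity) (by
      intro A u
      rw [sum_ind_mul u]
      refine (sum_gen_le (twoClasses_self A) u h0 h1 hy0.le _).trans ?_
      rw [card_pathEdges])
  have e2' : tsum3 f₁ ≤ _ := e2
  have e3' : tsum3 f₂ ≤ _ := e3
  refine e1.trans ?_
  clear e1 e2 e3
  generalize tsum3 f₁ = t₁ at e2' ⊢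
  generalize tsum3 f₂ = t₂ at e3' ⊢
  obtain ⟨n, hnK⟩ : ∃ n, n = K + 1 := ⟨_, rfl⟩
  have hnc : (K + 1 : ℝ) = (n : ℝ) := by rw [hnK]; push_cast; ring
  rw [← hnK, hnc] at e2' e3'
  rw [← hnK] at hs
  have hhτ : ((1 + h) ^ n) ^ 3 * τ ^ n ≤ 1 := by
    rw [← pow_mul, mul_comm n 3, pow_mul, ← mul_pow]
    exact pow_le_one₀ (by positivity) hτh
  set q := (1 + h) ^ n with hq
  have hq2 : (1 + h) ^ (2 * n) = q ^ 2 := by rw [hq, ← pow_mul, mul_comm]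
  have hτ4 : τ ^ (4 * n) = (τ ^ n) ^ 4 := by rw [← pow_mul, mul_comm]
  have hτ2 : τ ^ (2 * n) = (τ ^ n) ^ 2 := by rw [← pow_mul, mul_comm]
  have hq0 : 0 < q := by positivity
  rw [hq2, hτ4] at e2'
  rw [hq2] at e3'
  have hsn : s = ((τ ^ n) ^ 2)⁻¹ := by rw [hs, hτ2]
  have hcn := hc' n
  set T := τ ^ n with hT
  have hT0 : 0 < T := by positivity
  have hn0 : (0 : ℝ) ≤ (n : ℝ) := by positivity
  have b1 : s / 2 * t₁ ≤ c * (G1 * G2) := by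
    calc s / 2 * t₁ ≤ s / 2 * (n * (n * G1 * q ^ 2 * (2 * n * T ^ 4 * G2 * q))) := by gcongr
      _ = (n ^ 3 * T) * (q ^ 3 * T) * (G1 * G2) := by rw [hsn]; field_simp
      _ ≤ c * 1 * (G1 * G2) := by gcongr
      _ = _ := by ring
  have b2 : s⁻¹ / 2 * t₂ ≤ c * (G1 * G3 / 2) := by
    calc s⁻¹ / 2 * t₂ ≤ s⁻¹ / 2 * (n * (n * G1 * q ^ 2 * (n * G3 * q))) := by gcongr
      _ = (n ^ 3 * T) * (q ^ 3 * T) * (G1 * G3 / 2) := by rw [hsn, inv_inv]; ring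
      _ ≤ c * 1 * (G1 * G3 / 2) := by gcongr
      _ = _ := by ring
  linarith

theorem ind_le_of_imp {p q : Prop} (h : p → q) : ind p ≤ ind q := by
  by_cases hp : p
  · rw [ind_of hp, ind_of (h hp)]
  · rw [ind_of_not hp]; exact ind_nonneg q

/-- Triples that are not pairwise far contribute little. -/
theorem tsum3_not_allFar_le : ∃ c : ℝ, 0 ≤ c ∧ ∀ K : ℕ, 8388608 ≤ K →
    tsum3 (fun A B C : HamPath (K + 1) => ind (¬ AllFar A B C)) ≤ c * (K + 1) ^ 2 := by
  obtain ⟨c, hc0, hc⟩ := tsum3_mid_le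
  set c₁ := farConst * (16 * Real.exp (128 * (262144 : ℕ)))
  set c₂ := 16 * Real.exp (128 * (1 : ℕ)) * (16 * Real.exp (128 * (262144 : ℕ)))
  have h₁ : 0 ≤ c₁ := by have := farConst_pos; positivity
  have h₂ : 0 ≤ c₂ := by positivity
  refine ⟨3 * (c + c₁ + c₂), by positivity, fun K hK => ?_⟩
  set g : HamPath (K + 1) → HamPath (K + 1) → HamPath (K + 1) → ℝ := fun A B C =>
    ind (Mid A B) + (ind (Near A B ∧ 20 * common (pathEdges A ∪ pathEdges B) C ≤ K + 1) +
      ind (Near A B ∧ 8388608 * (K - common (pathEdges A ∪ pathEdges B) C) ≤ K + 1)) with hg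
  have hn : (1 : ℝ) ≤ K + 1 := by
    have : (0 : ℝ) ≤ K := by positivity
    linarith
  have hgle : tsum3 g ≤ (c + c₁ + c₂) * (K + 1) ^ 2 := by
    rw [hg, tsum3_add, tsum3_add]
    have a1 := hc K
    have a2 := tsum3_near_far_le hK
    have a3 := tsum3_near_near_le hK
    have a4 : c ≤ c * (K + 1 : ℝ) ^ 2 := le_mul_of_one_le_right hc0 (one_le_pow₀ hn)
    have a5 : c₂ * (K + 1 : ℝ) ≤ c₂ * (K + 1) ^ 2 :=
      mul_le_mul_of_nonneg_left (le_self_pow₀ hn two_ne_zero) h₂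
    calc _ ≤ c * (K + 1 : ℝ) ^ 2 + (c₁ * (K + 1) ^ 2 + c₂ * (K + 1) ^ 2) :=
          add_le_add (a1.trans a4) (add_le_add a2 (a3.trans a5))
      _ = _ := by ring
  have hpt : ∀ A B C : HamPath (K + 1), ind (¬ AllFar A B C) ≤ g A B C + (g A C B + g C B A) := by
    intro A B C
    have hg0 : ∀ A B C, 0 ≤ g A B C := fun A B C =>
      add_nonneg (ind_nonneg _) (add_nonneg (ind_nonneg _) (ind_nonneg _))
    have hmid : ∀ A B C, Mid A B → 1 ≤ g A B C := by
      intro A B C h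
      simp only [hg]
      rw [ind_of h]
      linarith [ind_nonneg (Near A B ∧ 20 * common (pathEdges A ∪ pathEdges B) C ≤ K + 1),
        ind_nonneg (Near A B ∧ 8388608 * (K - common (pathEdges A ∪ pathEdges B) C) ≤ K + 1)]
    -- If no pair is intermediate and A, B are near, then C is either near one of them, hence near
    -- their union, or far from both, hence far from the union.
    have hnear : ∀ A B C, Near A B → ¬ Mid A C → ¬ Mid B C → 1 ≤ g A B C := by
      intro A B C h h1 h2
      have hor : 20 * common (pathEdges A ∪ pathEdges B) C ≤ K + 1 ∨
          8388608 * (K - common (pathEdges A ∪ pathEdges B) C) ≤ K + 1 := by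
        unfold Mid at h1 h2
        by_cases n1 : Near A C
        · right
          have := common_mono (subset_union_left (s₁ := pathEdges A) (s₂ := pathEdges B)) C
          unfold Near at n1
          omega
        · by_cases n2 : Near B C
          · right
            have := common_mono (subset_union_right (s₁ := pathEdges A) (s₂ := pathEdges B)) C
            unfold Near at n2
            omega
          · left
            have f1 : Far A C := by tauto
            have f2 : Far B C := by tauto
            have := common_union_le A B C
            unfold Far at f1 f2
            omega
      simp only [hg]
      rcases hor with h3 | h3
      · rw [ind_of (p := Near A B ∧ 20 * common (pathEdges A ∪ pathEdges B) C ≤ K + 1) ⟨h, h3⟩]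
        linarith [ind_nonneg (Mid A B),
          ind_nonneg (Near A B ∧ 8388608 * (K - common (pathEdges A ∪ pathEdges B) C) ≤ K + 1)]
      · rw [ind_of (p := Near A B ∧ 8388608 * (K - common (pathEdges A ∪ pathEdges B) C) ≤ K + 1)
          ⟨h, h3⟩]
        linarith [ind_nonneg (Mid A B),
          ind_nonneg (Near A B ∧ 20 * common (pathEdges A ∪ pathEdges B) C ≤ K + 1)]
    have mid_symm : ∀ {A B : HamPath (K + 1)}, Mid A B → Mid B A := fun h =>
      ⟨fun f => h.1 f.symm, fun f => h.2 f.symm⟩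
    by_cases hall : AllFar A B C
    · rw [ind_of_not (not_not.2 hall)]
      have := hg0 A B C
      have := hg0 A C B
      have := hg0 C B A
      linarith
    · rw [ind_of hall]
      have n1 := hg0 A B C
      have n2 := hg0 A C B
      have n3 := hg0 C B A
      by_cases m1 : Mid A B
      · linarith [hmid A B C m1]
      by_cases m2 : Mid A C
      · linarith [hmid A C B m2]
      by_cases m3 : Mid B C
      · linarith [hmid C B A (mid_symm m3)]
      by_cases f1 : Near A B
      · linarith [hnear A B C f1 m2 m3]
      by_cases f2 : Near A C
      · linarith [hnear A C B f2 m1 fun h => m3 (mid_symm h)]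
      by_cases f3 : Near B C
      · linarith [hnear C B A f3.symm (fun h => m2 (mid_symm h)) fun h => m1 (mid_symm h)]
      exfalso
      apply hall
      unfold Mid at m1 m2 m3
      exact ⟨by tauto, by tauto, by tauto⟩
  refine (tsum3_mono hpt).trans ?_
  rw [tsum3_add (f := g) (g := fun A B C => g A C B + g C B A),
    tsum3_add (f := fun A B C => g A C B) (g := fun A B C => g C B A), tsum3_swap_right g,
    tsum3_reverse g]
  calc _ ≤ (c + c₁ + c₂) * (K + 1 : ℝ) ^ 2 + ((c + c₁ + c₂) * (K + 1) ^ 2 +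
        (c + c₁ + c₂) * (K + 1) ^ 2) := add_le_add hgle (add_le_add hgle hgle)
    _ = _ := by ring

/-- Some two of the paths have edges in common that touch common edges of another two. -/
def AnyBad (A B C : HamPath (K + 1)) : Prop := Bad A B C ∨ Bad A C B ∨ Bad B A C

/-- Triples that are not pairwise far and the three positions of a bad pair are O(n²). What remains
has many common edges and no switch of the last path. -/
theorem tsum3_exceptional_le : ∃ c₁ c₂ : ℝ, ∀ K : ℕ, 8388608 ≤ K → ∀ M : ℕ,
    tsum3 (fun A B C : HamPath (K + 1) => ind (AnyBad A B C ∨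
      M ≤ common (pathEdges A) B + common (pathEdges A ∪ pathEdges B) C)) ≤
    c₁ * (K + 1) ^ 3 * (11 / 10 : ℝ)⁻¹ ^ M + c₂ * (K + 1) ^ 2 := by
  obtain ⟨c, hc0, hc⟩ := tsum3_not_allFar_le
  refine ⟨farConst ^ 2, c + 3 * (63360000 * farConst ^ 2), fun K hK M => ?_⟩
  have h1 := hc K hK
  have h2 := tsum3_far_le (K := K) M
  have h3 := tsum3_far_bad_le (K := K)
  set g : HamPath (K + 1) → HamPath (K + 1) → HamPath (K + 1) → ℝ := fun A B C =>
    ind (AllFar A B C ∧ Bad A B C) with hg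
  have hpt : ∀ A B C : HamPath (K + 1), ind (AnyBad A B C ∨
      M ≤ common (pathEdges A) B + common (pathEdges A ∪ pathEdges B) C) ≤
      ind (¬ AllFar A B C) + (ind (AllFar A B C ∧ ¬ Bad A C B ∧
        M ≤ common (pathEdges A) B + common (pathEdges A ∪ pathEdges B) C) +
        (g A B C + (g A C B + g B A C))) := by
    intro A B C
    have i1 := ind_nonneg (¬ AllFar A B C)
    have i2 := ind_nonneg (AllFar A B C ∧ ¬ Bad A C B ∧
        M ≤ common (pathEdges A) B + common (pathEdges A ∪ pathEdges B) C)
    have i3 : ∀ A B C, 0 ≤ g A B C := fun A B C => ind_nonneg _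
    have j1 := i3 A B C
    have j2 := i3 A C B
    have j3 := i3 B A C
    by_cases hall : AllFar A B C
    · by_cases h : AnyBad A B C ∨
          M ≤ common (pathEdges A) B + common (pathEdges A ∪ pathEdges B) C
      · rw [ind_of h]
        by_cases b1 : Bad A B C
        · have : g A B C = 1 := ind_of ⟨hall, b1⟩
          linarith
        by_cases b2 : Bad A C B
        · have : g A C B = 1 := ind_of ⟨hall.swap_right, b2⟩
          linarith
        by_cases b3 : Bad B A C
        · have : g B A C = 1 := ind_of ⟨hall.swap_left, b3⟩
          linarith
        · have hM : M ≤ common (pathEdges A) B + common (pathEdges A ∪ pathEdges B) C := by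
            unfold AnyBad at h; tauto
          rw [ind_of (p := AllFar A B C ∧ ¬ Bad A C B ∧ _) ⟨hall, b2, hM⟩]
          linarith
      · rw [ind_of_not h]; linarith
    · rw [ind_of hall]
      have : ind (AnyBad A B C ∨
          M ≤ common (pathEdges A) B + common (pathEdges A ∪ pathEdges B) C) ≤ 1 := by
        unfold ind; split_ifs <;> norm_num
      linarith
  refine (tsum3_mono hpt).trans ?_
  rw [tsum3_add, tsum3_add, tsum3_add, tsum3_add, tsum3_swap_right g, tsum3_swap_left g]
  calc _ ≤ c * (K + 1 : ℝ) ^ 2 + (farConst ^ 2 * (K + 1) ^ 3 * (11 / 10 : ℝ)⁻¹ ^ M +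
        (63360000 * farConst ^ 2 * (K + 1) ^ 2 + (63360000 * farConst ^ 2 * (K + 1) ^ 2 +
        63360000 * farConst ^ 2 * (K + 1) ^ 2))) :=
        add_le_add h1 (add_le_add h2 (add_le_add h3 (add_le_add h3 h3)))
    _ = _ := by ring

end Large

/-! ### Triples whose reduced common edge graph is good -/

theorem exists_two_neighbors {V : Type*} {G : SimpleGraph V} {u w v : V} (p : G.Walk u w)
    (hp : p.IsPath) (hv : v ∈ p.support) (hu : v ≠ u) (hw : v ≠ w) :
    ∃ x y, x ≠ y ∧ G.Adj v x ∧ G.Adj v y := by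
  classical
  have hq : ¬ (p.takeUntil v hv).Nil := fun h => hu h.eq.symm
  have hr : ¬ (p.dropUntil v hv).Nil := fun h => hw h.eq
  refine ⟨(p.takeUntil v hv).penultimate, (p.dropUntil v hv).snd, ?_,
    ((p.takeUntil v hv).adj_penultimate hq).symm, (p.dropUntil v hv).adj_snd hr⟩
  have hnd := hp.support_nodup
  rw [← p.take_spec hv, SimpleGraph.Walk.support_append] at hnd
  have h1 : (p.takeUntil v hv).penultimate ∈ (p.takeUntil v hv).support :=
    SimpleGraph.Walk.getVert_mem_support _ _
  have h2 : (p.dropUntil v hv).snd ∈ (p.dropUntil v hv).support.tail :=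
    SimpleGraph.Walk.snd_mem_tail_support hr
  intro e
  exact List.disjoint_of_nodup_append hnd h1 (e ▸ h2)

section Good
variable {K : ℕ} {t : EdgeOrderedTriple (K + 1)}

theorem mem_pathEdges_iff {n : ℕ} {C : HamPath n} {u v : Fin n} :
    s(u, v) ∈ pathEdges C ↔ Traverses C u v ∨ Traverses C v u := by
  classical
  simp only [pathEdges, mem_filter, mem_univ, true_and]
  constructor
  · rintro ⟨a, b, h, ht⟩
    rw [Sym2.eq_iff] at h
    rcases h with ⟨rfl, rfl⟩ | ⟨rfl, rfl⟩
    · exact Or.inl ht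
    · exact Or.inr ht
  · rintro (h | h)
    · exact ⟨u, v, rfl, h⟩
    · exact ⟨v, u, Sym2.eq_swap, h⟩

theorem mem_commonEdges {n : ℕ} {t : EdgeOrderedTriple n} {e : Sym2 (Fin n)} :
    e ∈ t.commonEdges ↔ ∃ i j, i ≠ j ∧ e ∈ pathEdges (t.path i) ∧ e ∈ pathEdges (t.path j) := by
  simp only [EdgeOrderedTriple.commonEdges, mem_union, mem_inter]
  constructor
  · rintro ((h | h) | h)
    · exact ⟨0, 1, by decide, h⟩
    · exact ⟨0, 2, by decide, h⟩
    · exact ⟨1, 2, by decide, h⟩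
  · rintro ⟨i, j, hij, h1, h2⟩
    fin_cases i <;> fin_cases j <;> simp [EdgeOrderedTriple.path] at hij h1 h2 ⊢ <;> tauto

theorem adj_iff {n : ℕ} {t : EdgeOrderedTriple n} {x y : t.commonEdgeGraph.V} :
    t.commonEdgeGraph.graph.Adj x y ↔ s(x.1, y.1) ∈ t.commonEdges := by
  simp only [LabelledGraph.graph, SimpleGraph.fromRel_adj]
  constructor
  · rintro ⟨-, ⟨i, h⟩ | ⟨i, h⟩⟩
    · exact h.1
    · rw [Sym2.eq_swap]; exact h.1
  · intro h
    obtain ⟨i, -, -, h1, -⟩ := mem_commonEdges.1 h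
    refine ⟨?_, ?_⟩
    · rintro rfl
      rcases mem_pathEdges_iff.1 h1 with h | h <;> simp [Traverses] at h
    · rcases mem_pathEdges_iff.1 h1 with h2 | h2
      · exact Or.inl ⟨i, h, h2⟩
      · exact Or.inr ⟨i, by rw [Sym2.eq_swap]; exact h, h2⟩

theorem mem_paths_iff {n : ℕ} {t : EdgeOrderedTriple n} {x y : t.commonEdgeGraph.V}
    (h : s(x.1, y.1) ∈ t.commonEdges) (i : Fin 3) :
    i ∈ t.commonEdgeGraph.paths s(x, y) ↔ s(x.1, y.1) ∈ pathEdges (t.path i) := by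
  rw [mem_pathEdges_iff]
  simp only [LabelledGraph.paths, Set.mem_ofPred_eq]
  constructor
  · rintro ⟨a, b, hab, -, ht⟩
    rw [Sym2.eq_iff] at hab
    rcases hab with ⟨rfl, rfl⟩ | ⟨rfl, rfl⟩
    · exact Or.inl ht
    · exact Or.inr ht
  · rintro (ht | ht)
    · exact ⟨x, y, rfl, h, ht⟩
    · exact ⟨y, x, Sym2.eq_swap, by rw [Sym2.eq_swap]; exact h, ht⟩

/-- Common edges that share a vertex are contained in the same paths. -/
def SameType {n : ℕ} (t : EdgeOrderedTriple n) : Prop :=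
  ∀ e ∈ t.commonEdges, ∀ f ∈ t.commonEdges, ∀ v, v ∈ e → v ∈ f → ∀ i,
    e ∈ pathEdges (t.path i) → f ∈ pathEdges (t.path i)

/-- Adjacent common edges lie in the same paths, so the type is constant along walks and hence on
components. -/
theorem SameType.reachable {n : ℕ} {t : EdgeOrderedTriple n} (h : SameType t)
    {x y : t.commonEdgeGraph.V} (hr : t.commonEdgeGraph.graph.Reachable x y) :
    ∀ e ∈ t.commonEdges, ∀ f ∈ t.commonEdges, x.1 ∈ e → y.1 ∈ f → ∀ i,
      e ∈ pathEdges (t.path i) → f ∈ pathEdges (t.path i) := by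
  obtain ⟨p⟩ := hr
  induction p with
  | nil => intro e he f hf hx hy i; exact h e he f hf _ hx hy i
  | @cons a b c hab p ih =>
    intro e he f hf hx hy i hei
    have hc := adj_iff.1 hab
    exact ih _ hc f hf (by simp) hy i (h e he _ hc a.1 hx (by simp) i hei)

theorem SameType.isUniform {n : ℕ} {t : EdgeOrderedTriple n} (h : SameType t)
    {x y : t.commonEdgeGraph.V} (p : t.commonEdgeGraph.graph.Walk x y) (hp : p.IsPath)
    (hl : 0 < p.length) : t.commonEdgeGraph.IsUniform p := by
  refine ⟨hp, hl, ?_⟩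
  have key : ∀ e ∈ p.edges, ∀ f ∈ p.edges, t.commonEdgeGraph.paths e ⊆
      t.commonEdgeGraph.paths f := by
    intro e he f hf i hi
    induction e using Sym2.ind with
    | _ a b =>
    induction f using Sym2.ind with
    | _ c d =>
    have h1 := adj_iff.1 (p.adj_of_mem_edges he)
    have h2 := adj_iff.1 (p.adj_of_mem_edges hf)
    rw [mem_paths_iff h1] at hi
    rw [mem_paths_iff h2]
    have r1 : t.commonEdgeGraph.graph.Reachable a c := by
      classical
      exact (p.takeUntil a (p.fst_mem_support_of_mem_edges he)).reachable.symm.trans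
        (p.takeUntil c (p.fst_mem_support_of_mem_edges hf)).reachable
    exact h.reachable r1 _ h1 _ h2 (by simp) (by simp) i hi
  exact fun e he f hf => Set.Subset.antisymm (key e he f hf) (key f hf e he)

/-- The position of a vertex of the common edge graph on the path `i`. -/
def vpos {n : ℕ} (t : EdgeOrderedTriple n) (i : Fin 3) (x : t.commonEdgeGraph.V) : ℕ :=
  ((t.path i).symm x.1 : ℕ)

theorem vpos_injective {n : ℕ} (t : EdgeOrderedTriple n) (i : Fin 3) :
    Function.Injective (vpos t i) := fun _ _ h =>
  Subtype.ext ((t.path i).symm.injective (Fin.ext h))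

/-- The edge at position `j` of the path `i` exists and is a common edge. -/
def CommonAt (t : EdgeOrderedTriple (K + 1)) (i : Fin 3) (j : ℕ) : Prop :=
  ∃ x y : t.commonEdgeGraph.V, vpos t i x = j ∧ vpos t i y = j + 1 ∧ s(x.1, y.1) ∈ t.commonEdges

theorem CommonAt.traverses {i : Fin 3} {x y : t.commonEdgeGraph.V}
    (h : CommonAt t i (vpos t i x)) (hy : vpos t i y = vpos t i x + 1) :
    t.commonEdgeGraph.trav i x y := by
  obtain ⟨x', y', hx', hy', hc⟩ := h
  obtain rfl := vpos_injective t i hx'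
  obtain rfl := vpos_injective t i (hy.trans hy'.symm)
  exact ⟨hc, hy.symm⟩

theorem commonAt_of_adj {i : Fin 3} {x y : t.commonEdgeGraph.V}
    (h : s(x.1, y.1) ∈ t.commonEdges) (hi : s(x.1, y.1) ∈ pathEdges (t.path i)) :
    (vpos t i y = vpos t i x + 1 ∧ CommonAt t i (vpos t i x)) ∨
      (vpos t i x = vpos t i y + 1 ∧ CommonAt t i (vpos t i y)) := by
  rcases mem_pathEdges_iff.1 hi with h1 | h1
  · exact Or.inl ⟨h1.symm, x, y, rfl, h1.symm, h⟩
  · exact Or.inr ⟨h1.symm, y, x, rfl, h1.symm, by rw [Sym2.eq_swap]; exact h⟩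

theorem exists_maximal_interval {c : ℕ → Prop} {K k : ℕ} (hK : ∀ j, c j → j < K) (hk : c k) :
    ∃ p q, p ≤ k ∧ k < q ∧ (∀ j, p ≤ j → j < q → c j) ∧ ¬ c q ∧ ∀ j, j + 1 = p → ¬ c j := by
  classical
  have hq : ∃ d, ¬ c (k + d) := ⟨K, fun h => by have := hK _ h; omega⟩
  have hp : ∃ p, p ≤ k ∧ ∀ j, p ≤ j → j ≤ k → c j := ⟨k, le_rfl, fun j h1 h2 => by
    have : j = k := by omega
    rwa [this]⟩
  have hd := Nat.find_spec hq
  have hd0 : Nat.find hq ≠ 0 := by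
    intro h0
    rw [h0] at hd
    exact hd hk
  refine ⟨Nat.find hp, k + Nat.find hq, (Nat.find_spec hp).1, by omega, ?_, hd, ?_⟩
  · intro j h1 h2
    by_cases hjk : j ≤ k
    · exact (Nat.find_spec hp).2 j h1 hjk
    · have := Nat.find_min hq (m := j - k) (by omega)
      rw [not_not] at this
      have e : k + (j - k) = j := by omega
      rwa [e] at this
  · intro j hj hc
    have hs := Nat.find_spec hp
    refine Nat.find_min hp (m := j) (by omega) ⟨by omega, fun j' h1 h2 => ?_⟩
    by_cases e : j' = j
    · rwa [e]
    · exact hs.2 j' (by omega) h2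

/-- The walk follows the path `i`; bounding the positions of its support shows that each new vertex
is new. -/
theorem exists_segment_walk {i : Fin 3} {u : t.commonEdgeGraph.V} {q : ℕ}
    (hc : ∀ j, vpos t i u ≤ j → j < q → CommonAt t i j) : ∀ m, vpos t i u + m ≤ q →
    ∃ (w : t.commonEdgeGraph.V) (W : t.commonEdgeGraph.graph.Walk u w),
      vpos t i w = vpos t i u + m ∧ W.IsPath ∧ W.length = m ∧
      (∀ d ∈ W.darts, t.commonEdgeGraph.trav i d.fst d.snd) ∧
      ∀ x ∈ W.support, vpos t i x ≤ vpos t i u + m := by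
  intro m
  induction m with
  | zero =>
    intro _
    exact ⟨u, SimpleGraph.Walk.nil, rfl, SimpleGraph.Walk.IsPath.nil, rfl, by simp, by simp⟩
  | succ m ih =>
    intro hm
    obtain ⟨w, W, hw, hW, hl, hd, hs⟩ := ih (by omega)
    have hcw := hc (vpos t i w) (by omega) (by omega)
    obtain ⟨x, y, hx, hy, hxy⟩ := id hcw
    obtain rfl := vpos_injective t i hx
    have htr := hcw.traverses hy
    refine ⟨y, W.concat (adj_iff.2 hxy), by omega, hW.concat (fun hmem => ?_) _, by
      rw [SimpleGraph.Walk.length_concat, hl], ?_, ?_⟩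
    · have := hs y hmem
      omega
    · intro d hd'
      rw [SimpleGraph.Walk.darts_concat, List.concat_eq_append, List.mem_append] at hd'
      rcases hd' with h | h
      · exact hd d h
      · rw [List.mem_singleton] at h
        subst h
        exact htr
    · intro z hz
      rw [SimpleGraph.Walk.support_concat, List.mem_append] at hz
      rcases hz with h | h
      · have := hs z h
        omega
      · rw [List.mem_singleton] at h
        subst h
        omega

/-- An interior vertex has two distinct neighbours. Here all neighbours of `v` are neighbours on the
path `i`, and on one side the edge is not common. -/
theorem not_isInterior {i : Fin 3} {v : t.commonEdgeGraph.V}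
    (hi : ∀ x, t.commonEdgeGraph.graph.Adj v x → s(v.1, x.1) ∈ pathEdges (t.path i))
    (h : (∀ j, j + 1 = vpos t i v → ¬ CommonAt t i j) ∨ ¬ CommonAt t i (vpos t i v)) :
    ¬ t.commonEdgeGraph.IsInterior v := by
  rintro ⟨a, b, p, hp, hv, ha, hb⟩
  obtain ⟨x, y, hxy, hx, hy⟩ := exists_two_neighbors p hp.1 hv ha hb
  have cx := commonAt_of_adj (adj_iff.1 hx) (hi x hx)
  have cy := commonAt_of_adj (adj_iff.1 hy) (hi y hy)
  have hne : vpos t i x ≠ vpos t i y := fun e => hxy (vpos_injective t i e)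
  rcases h with h | h
  · have h1 : vpos t i x = vpos t i v + 1 := by
      rcases cx with c | c
      · exact c.1
      · exact absurd c.2 (h _ c.1.symm)
    have h2 : vpos t i y = vpos t i v + 1 := by
      rcases cy with c | c
      · exact c.1
      · exact absurd c.2 (h _ c.1.symm)
    omega
  · have h1 : vpos t i v = vpos t i x + 1 := by
      rcases cx with c | c
      · exact absurd c.2 h
      · exact c.1
    have h2 : vpos t i v = vpos t i y + 1 := by
      rcases cy with c | c
      · exact absurd c.2 h
      · exact c.1
    omega

/-- Each common edge lies on a maximal segment, whose ends are the only vertices in its component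
that are not interior. -/
theorem SameType.exists_segment (h : SameType t) {i : Fin 3} {x₀ y₀ : t.commonEdgeGraph.V}
    (htr : t.commonEdgeGraph.trav i x₀ y₀) :
    ∃ u v : t.commonEdgeGraph.collapse.V, u ≠ v ∧ t.commonEdgeGraph.collapse.trav i u v ∧
      t.commonEdgeGraph.graph.Reachable u.1 x₀ ∧
      ∀ w : t.commonEdgeGraph.collapse.V, t.commonEdgeGraph.graph.Reachable u.1 w.1 →
        w = u ∨ w = v := by
  have hc₀ : CommonAt t i (vpos t i x₀) := ⟨x₀, y₀, rfl, htr.2.symm, htr.1⟩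
  have he₀ : s(x₀.1, y₀.1) ∈ pathEdges (t.path i) := mem_pathEdges_iff.2 (Or.inl htr.2)
  obtain ⟨p, q, hpk, hkq, hint, hq, hp⟩ := exists_maximal_interval (c := CommonAt t i) (K := K)
    (fun j ⟨x, y, _, hy, _⟩ => by
      have : vpos t i y < K + 1 := ((t.path i).symm y.1).2
      omega) hc₀
  obtain ⟨u, u', hu, -, huc⟩ := hint p le_rfl (by omega)
  have hint' : ∀ j, vpos t i u ≤ j → j < q → CommonAt t i j := fun j h1 h2 =>
    hint j (by omega) h2
  obtain ⟨v, W, hv, hW, hl, hd, -⟩ := exists_segment_walk hint' (q - p) (by omega)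
  have hvq : vpos t i v = q := by omega
  obtain ⟨x₁, W₁, hx₁, -, -, -, -⟩ :=
    exists_segment_walk hint' (vpos t i x₀ - p) (by omega)
  have hx₀ : x₁ = x₀ := vpos_injective t i (by omega)
  subst hx₀
  have hreach : t.commonEdgeGraph.graph.Reachable u x₁ := W₁.reachable
  have htype : ∀ a b : t.commonEdgeGraph.V, t.commonEdgeGraph.graph.Reachable u a →
      t.commonEdgeGraph.graph.Adj a b → s(a.1, b.1) ∈ pathEdges (t.path i) := by
    intro a b ha hab
    exact h.reachable (hreach.symm.trans ha) _ htr.1 _ (adj_iff.1 hab) (by simp) (by simp) i he₀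
  -- The component cannot leave the interval: all its edges belong to the path `i`, and by
  -- maximality the edges just before `p` and at `q` are not common.
  have hclosed : ∀ a, t.commonEdgeGraph.graph.Reachable u a → p ≤ vpos t i a ∧ vpos t i a ≤ q := by
    rintro a ⟨r⟩
    have key : ∀ (b c : t.commonEdgeGraph.V) (r : t.commonEdgeGraph.graph.Walk b c),
        t.commonEdgeGraph.graph.Reachable u b → (p ≤ vpos t i b ∧ vpos t i b ≤ q) →
        p ≤ vpos t i c ∧ vpos t i c ≤ q := by
      intro b c r
      induction r with
      | nil => exact fun _ hb => hb
      | @cons b b' c hbb r ih =>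
        intro hub hb
        refine ih (hub.trans hbb.reachable) ?_
        rcases commonAt_of_adj (adj_iff.1 hbb) (htype b b' hub hbb) with ⟨h1, h2⟩ | ⟨h1, h2⟩
        · have : vpos t i b ≠ q := fun e => hq (e ▸ h2)
          omega
        · have : vpos t i b ≠ p := fun e => hp _ (by omega) h2
          omega
    exact key u a r (SimpleGraph.Reachable.refl u) ⟨by omega, by omega⟩
  have hui : ¬ t.commonEdgeGraph.IsInterior u :=
    not_isInterior (i := i) (fun x hx => htype u x (SimpleGraph.Reachable.refl u) hx)
      (Or.inl fun j hj => hp j (by omega))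
  have hvi : ¬ t.commonEdgeGraph.IsInterior v :=
    not_isInterior (i := i) (fun x hx => htype v x W.reachable hx) (Or.inr (by rwa [hvq]))
  refine ⟨⟨u, hui⟩, ⟨v, hvi⟩, ?_, ⟨W, h.isUniform W hW (by omega), hd⟩, hreach, ?_⟩
  · intro e
    have : u = v := congrArg Subtype.val e
    rw [this] at hu
    omega
  · rintro ⟨w, hw⟩ hr
    obtain ⟨h1, h2⟩ := hclosed w hr
    by_contra hno
    push Not at hno
    have hwu : vpos t i w ≠ p := fun e => hno.1 (Subtype.ext (vpos_injective t i (e.trans hu.symm)))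
    have hwv : vpos t i w ≠ q := fun e => hno.2 (Subtype.ext (vpos_injective t i (e.trans hvq.symm)))
    apply hw
    -- Any vertex strictly inside the interval is the middle of a uniform path with two edges.
    obtain ⟨a, b, ha, hb, hab⟩ := hint (vpos t i w - 1) (by omega) (by omega)
    obtain rfl : b = w := vpos_injective t i (by omega)
    obtain ⟨b', c, hb', hc, hbc⟩ := hint (vpos t i b) (by omega) (by omega)
    obtain rfl := vpos_injective t i hb'
    have hab' := adj_iff.2 hab
    have hbc' := adj_iff.2 hbc
    have hac : a ≠ c := by
      rintro rfl
      omega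
    refine ⟨a, c, SimpleGraph.Walk.cons hab' (SimpleGraph.Walk.cons hbc' SimpleGraph.Walk.nil),
      h.isUniform _ ?_ (by simp), by simp, hab'.ne', hbc'.ne⟩
    simp [SimpleGraph.Walk.cons_isPath_iff, hab'.ne, hbc'.ne, hac]

theorem reachable_of_collapse {G : LabelledGraph} {x y : G.collapse.V}
    (h : G.collapse.graph.Reachable x y) : G.graph.Reachable x.1 y.1 := by
  obtain ⟨p⟩ := h
  induction p with
  | nil => exact SimpleGraph.Reachable.refl _
  | @cons a b c hab p ih =>
    refine SimpleGraph.Reachable.trans ?_ ih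
    simp only [LabelledGraph.graph, SimpleGraph.fromRel_adj] at hab
    obtain ⟨-, ⟨i, W, -⟩ | ⟨i, W, -⟩⟩ := hab
    · exact W.reachable
    · exact W.reachable.symm

/-- Every component is a segment of one path, and only its two ends survive the collapse. The
collapsed edge lies in the same paths as any edge of the component. -/
theorem SameType.isGood_collapse (h : SameType t)
    (h2 : ∀ e ∈ t.commonEdges, {i | e ∈ pathEdges (t.path i)}.ncard = 2) :
    t.commonEdgeGraph.collapse.IsGood := by
  intro Kc
  induction Kc using SimpleGraph.ConnectedComponent.ind with
  | _ a =>
  obtain ⟨e, he, hae⟩ := a.1.2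
  obtain ⟨z, rfl⟩ := Sym2.mem_iff_exists.1 hae
  let b : t.commonEdgeGraph.V := ⟨z, _, he, by simp⟩
  have hab : s(a.1.1, b.1) ∈ t.commonEdges := he
  have hadj : t.commonEdgeGraph.graph.Adj a.1 b := adj_iff.2 hab
  have hseg : ∀ i, s(a.1.1, b.1) ∈ pathEdges (t.path i) →
      ∃ u v : t.commonEdgeGraph.collapse.V, u ≠ v ∧ t.commonEdgeGraph.collapse.trav i u v ∧
      t.commonEdgeGraph.graph.Reachable u.1 a.1 ∧
      ∀ w : t.commonEdgeGraph.collapse.V, t.commonEdgeGraph.graph.Reachable u.1 w.1 →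
        w = u ∨ w = v := by
    intro i hi
    rcases mem_pathEdges_iff.1 hi with htr | htr
    · exact h.exists_segment (x₀ := a.1) (y₀ := b) ⟨hab, htr⟩
    · obtain ⟨u, v, h1, h2, h3, h4⟩ := h.exists_segment (i := i) (x₀ := b) (y₀ := a.1)
        ⟨by rw [Sym2.eq_swap]; exact hab, htr⟩
      exact ⟨u, v, h1, h2, h3.trans hadj.symm.reachable, h4⟩
  obtain ⟨i, -, -, hi, -⟩ := mem_commonEdges.1 hab
  obtain ⟨u, v, huv, htr, hua, hw⟩ := hseg i hi
  have hAdj : t.commonEdgeGraph.collapse.graph.Adj u v := by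
    simp only [LabelledGraph.graph, SimpleGraph.fromRel_adj]
    exact ⟨huv, Or.inl ⟨i, htr⟩⟩
  have huvr := reachable_of_collapse hAdj.reachable
  have ha := hw a hua
  have hau : t.commonEdgeGraph.collapse.graph.Reachable u a := by
    rcases ha with rfl | rfl
    · exact SimpleGraph.Reachable.refl _
    · exact hAdj.reachable
  refine ⟨u, v, hAdj, ?_, ?_⟩
  · ext w
    rw [SimpleGraph.ConnectedComponent.mem_supp_iff, SimpleGraph.ConnectedComponent.eq]
    simp only [Set.mem_insert_iff, Set.mem_singleton_iff]
    constructor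
    · intro hwa
      exact hw w (hua.trans (reachable_of_collapse hwa.symm))
    · rintro (rfl | rfl)
      · exact hau
      · exact hAdj.symm.reachable.trans hau
  · rw [← h2 _ hab]
    congr 1
    ext j
    simp only [LabelledGraph.paths, Set.mem_ofPred_eq]
    constructor
    · rintro ⟨x, y, hxy, W, hW, hd⟩
      have hx : t.commonEdgeGraph.graph.Reachable u.1 x.1 := by
        rw [Sym2.eq_iff] at hxy
        rcases hxy with ⟨rfl, -⟩ | ⟨-, rfl⟩
        · exact SimpleGraph.Reachable.refl _
        · exact huvr
      have hnil : ¬ W.Nil := by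
        rw [SimpleGraph.Walk.not_nil_iff_lt_length]; exact hW.2.1
      have hfd := hd (W.firstDart hnil) (SimpleGraph.Walk.firstDart_mem_darts hnil)
      have e1 : (W.firstDart hnil).fst = x.1 := rfl
      rw [e1] at hfd
      have hje := mem_pathEdges_iff.2 (Or.inl hfd.2)
      exact h.reachable (hx.symm.trans hua) _ hfd.1 _ hab (by simp) (by simp) j hje
    · intro hj
      -- The segment of the same component along the path `j` has the same two ends, possibly in
      -- reversed direction.
      obtain ⟨u', v', huv', htr', hua', hw'⟩ := hseg j hj
      have c1 := hw u' (hua.trans hua'.symm)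
      have c2 := hw v' ((hua.trans hua'.symm).trans
        (by obtain ⟨W', -⟩ := htr'; exact W'.reachable))
      refine ⟨u', v', ?_, htr'⟩
      rw [Sym2.eq_iff]
      rcases c1 with rfl | rfl <;> rcases c2 with rfl | rfl
      · exact absurd rfl huv'
      · exact Or.inl ⟨rfl, rfl⟩
      · exact Or.inr ⟨rfl, rfl⟩
      · exact absurd rfl huv'

/-- Suppose a common edge of paths i and j touches a common edge f in the third path k. As f lies in
two paths, it also lies in i or j, and with that path in the middle the triple is bad. So touching
common edges have the same type. -/
theorem isGood_collapse (h : ¬ AnyBad t.A t.B t.C) : t.commonEdgeGraph.collapse.IsGood := by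
  have hbad : ∀ i j k : Fin 3, i ≠ j → j ≠ k → i ≠ k → ¬ Bad (t.path i) (t.path j) (t.path k) := by
    unfold AnyBad at h
    push Not at h
    obtain ⟨h1, h2, h3⟩ := h
    have h1' : ¬ Bad t.C t.B t.A := fun hb => h1 hb.symm
    have h2' : ¬ Bad t.B t.C t.A := fun hb => h2 hb.symm
    have h3' : ¬ Bad t.C t.A t.B := fun hb => h3 hb.symm
    intro i j k hij hjk hik
    fin_cases i <;> fin_cases j <;> fin_cases k <;>
      simp [EdgeOrderedTriple.path] at hij hjk hik ⊢ <;> assumption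
  have key : ∀ e ∈ t.commonEdges, ∀ f ∈ t.commonEdges, ∀ v, v ∈ e → v ∈ f → ∀ i j k : Fin 3,
      i ≠ j → j ≠ k → i ≠ k → e ∈ pathEdges (t.path i) → e ∈ pathEdges (t.path j) →
      f ∉ pathEdges (t.path k) := by
    intro e he f hf v hve hvf i j k hij hjk hik hi hj hk
    obtain ⟨a, b, hab, hfa, hfb⟩ := mem_commonEdges.1 hf
    have : f ∈ pathEdges (t.path i) ∨ f ∈ pathEdges (t.path j) := by
      have h3 : ∀ a b i j k : Fin 3, a ≠ b → i ≠ j → j ≠ k → i ≠ k →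
          (a = i ∨ a = j) ∨ (b = i ∨ b = j) := by decide
      rcases h3 a b i j k hab hij hjk hik with (rfl | rfl) | (rfl | rfl) <;> tauto
    rcases this with hfi | hfj
    · exact hbad j i k hij.symm hik hjk
        ⟨e, mem_inter.2 ⟨hj, hi⟩, f, mem_inter.2 ⟨hfi, hk⟩, v, hve, hvf⟩
    · exact hbad i j k hij hjk hik
        ⟨e, mem_inter.2 ⟨hi, hj⟩, f, mem_inter.2 ⟨hfj, hk⟩, v, hve, hvf⟩
  have h3 : ∀ i j : Fin 3, i ≠ j → ∃ k, j ≠ k ∧ i ≠ k ∧ ∀ l, l = i ∨ l = j ∨ l = k := by decide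
  have pair : ∀ e ∈ t.commonEdges, ∀ f ∈ t.commonEdges, ∀ v, v ∈ e → v ∈ f → ∀ i,
      e ∈ pathEdges (t.path i) → f ∈ pathEdges (t.path i) := by
    intro e he f hf v hve hvf i hi
    by_contra hfi
    obtain ⟨a, b, hab, ha, hb⟩ := mem_commonEdges.1 hf
    have hai : a ≠ i := by rintro rfl; exact hfi ha
    have hbi : b ≠ i := by rintro rfl; exact hfi hb
    exact key f hf e he v hvf hve a b i hab hbi hai ha hb hi
  refine SameType.isGood_collapse pair fun e he => ?_
  obtain ⟨a, b, hab, ha, hb⟩ := mem_commonEdges.1 he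
  obtain ⟨c, hbc, hac, hall⟩ := h3 a b hab
  -- An edge touches itself, so no edge lies in all three paths.
  have hc : e ∉ pathEdges (t.path c) := by
    induction e using Sym2.ind with
    | _ x y => exact key _ he _ he x (by simp) (by simp) a b c hab hbc hac ha hb
  rw [Set.ncard_eq_two]
  refine ⟨a, b, hab, ?_⟩
  ext l
  simp only [Set.mem_ofPred_eq, Set.mem_insert_iff, Set.mem_singleton_iff]
  constructor
  · intro hl
    rcases hall l with rfl | rfl | rfl
    · exact Or.inl rfl
    · exact Or.inr rfl
    · exact absurd hl hc
  · rintro (rfl | rfl)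
    · exact ha
    · exact hb

end Good

/-! ### The sum over patterns and the main estimates -/

/-- The weight `1 / |A ∪ B ∪ C| !` of an edge-ordered triple. -/
def EdgeOrderedTriple.weight {n : ℕ} (t : EdgeOrderedTriple n) : ℝ :=
  1 / ((pathEdges t.A ∪ pathEdges t.B ∪ pathEdges t.C).card.factorial : ℝ)

theorem EdgeOrderedTriple.weight_nonneg {n : ℕ} (t : EdgeOrderedTriple n) : 0 ≤ t.weight := by
  unfold weight; positivity

/-- The reduced common edge graph and the common edge counts of an edge-ordered triple. -/
def EdgeOrderedTriple.pattern {n : ℕ} (t : EdgeOrderedTriple n) : ReducedGraph × EdgeCounts :=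
  (⟨t.reducedClass, n, t, rfl⟩, t.counts)

instance (n : ℕ) : Fintype (EdgeOrderedTriple n) := Fintype.ofFinite _

theorem card_inter_eq {α : Type*} [DecidableEq α] (X Y Z : Finset α) :
    (X ∩ Y).card = ((X ∩ Y) \ Z).card + (X ∩ Y ∩ Z).card := by
  rw [add_comm, card_inter_add_card_sdiff]

theorem card_union₃ {α : Type*} [DecidableEq α] (X Y Z : Finset α) :
    (X ∪ Y ∪ Z).card + ((X ∩ Y) \ Z).card + ((X ∩ Z) \ Y).card + ((Y ∩ Z) \ X).card +
      2 * (X ∩ Y ∩ Z).card = X.card + Y.card + Z.card := by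
  have h1 := card_union_add_card_inter (X ∪ Y) Z
  have h2 := card_union_add_card_inter X Y
  have h3 := card_union_add_card_inter (X ∩ Z) (Y ∩ Z)
  rw [union_inter_distrib_right] at h1
  have e1 : (X ∩ Z) ∩ (Y ∩ Z) = X ∩ Y ∩ Z := (inter_inter_distrib_right X Y Z).symm
  have e2 : X ∩ Z ∩ Y = X ∩ Y ∩ Z := inter_right_comm X Z Y
  have e3 : Y ∩ Z ∩ X = X ∩ Y ∩ Z := by rw [inter_comm, inter_assoc]
  rw [e1] at h3
  have h4 := card_inter_eq X Y Z
  have h5 := card_inter_eq X Z Y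
  have h6 := card_inter_eq Y Z X
  rw [e2] at h5
  rw [e3] at h6
  omega

/-! ### Edge counts and patterns of triples -/

section
variable {K : ℕ}

theorem EdgeOrderedTriple.card_union (t : EdgeOrderedTriple (K + 1)) :
    (pathEdges t.A ∪ pathEdges t.B ∪ pathEdges t.C).card =
      3 * (K + 1) - 3 - t.counts.AB - t.counts.AC - t.counts.BC - 2 * t.counts.ABC := by
  have h := card_union₃ (pathEdges t.A) (pathEdges t.B) (pathEdges t.C)
  rw [card_pathEdges, card_pathEdges, card_pathEdges] at h
  simp only [counts]
  omega

/-- The edges in exactly A, C and those in exactly B, C are disjoint sets of edges of `C` inside A ∪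
B. -/
theorem EdgeOrderedTriple.counts_le_common (t : EdgeOrderedTriple (K + 1)) :
    t.counts.AB + t.counts.AC + t.counts.BC ≤
      common (pathEdges t.A) t.B + common (pathEdges t.A ∪ pathEdges t.B) t.C := by
  rw [common_eq, common_eq, add_assoc]
  simp only [counts]
  refine add_le_add (card_le_card fun e he => ?_) ?_
  · simp only [Finset.mem_sdiff, mem_inter] at he ⊢
    tauto
  · rw [← card_union_of_disjoint]
    · refine card_le_card fun e he => ?_
      simp only [Finset.mem_sdiff, mem_inter, mem_union] at he ⊢
      tauto
    · rw [disjoint_left]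
      intro e he hf
      simp only [Finset.mem_sdiff, mem_inter] at he hf
      tauto

open Classical in
theorem term_eq_sum (p : ReducedGraph × EdgeCounts) :
    term (K + 1) p.1 p.2 =
      ∑ t : EdgeOrderedTriple (K + 1), if p = t.pattern then t.weight else 0 := by
  obtain ⟨G, c⟩ := p
  have h1 : ∀ t : EdgeOrderedTriple (K + 1), (G, c) = t.pattern ↔
      t.reducedClass = G.1 ∧ t.counts = c := by
    intro t
    constructor
    · rintro h
      exact ⟨(congrArg (fun q => q.1.1) h).symm, (congrArg Prod.snd h).symm⟩
    · rintro ⟨h1, h2⟩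
      exact Prod.ext (Subtype.ext h1.symm) h2.symm
  rw [← sum_filter]
  have h2 : ∀ t ∈ univ.filter (fun t : EdgeOrderedTriple (K + 1) => (G, c) = t.pattern),
      t.weight = 1 / (Nat.factorial (3 * (K + 1) - 3 - c.AB - c.AC - c.BC - 2 * c.ABC) : ℝ) := by
    intro t ht
    obtain ⟨-, rfl⟩ := (h1 t).1 (mem_filter.1 ht).2
    rw [EdgeOrderedTriple.weight, t.card_union]
  rw [sum_congr rfl h2, sum_const, nsmul_eq_mul, mul_one_div, term, tripleCount,
    Nat.card_eq_fintype_card, Fintype.card_subtype]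
  simp only [h1]

open Classical in
-- Each triple has exactly one pattern, so the series is a finite sum, over triples, of functions
-- supported at one point.
theorem hasSum_indicator_term (E : Set (ReducedGraph × EdgeCounts)) :
    HasSum (E.indicator fun p => term (K + 1) p.1 p.2)
      (∑ t : EdgeOrderedTriple (K + 1), t.weight * ind (t.pattern ∈ E)) := by
  have h : (E.indicator fun p => term (K + 1) p.1 p.2) = fun p =>
      ∑ t : EdgeOrderedTriple (K + 1),
        if p = t.pattern then t.weight * ind (t.pattern ∈ E) else 0 := by
    funext p
    by_cases hp : p ∈ E
    · rw [Set.indicator_of_mem hp, term_eq_sum]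
      refine sum_congr rfl fun t _ => ?_
      split_ifs with h
      · rw [ind_of (h ▸ hp), mul_one]
      · rfl
    · rw [Set.indicator_of_notMem hp]
      refine (sum_eq_zero fun t _ => ?_).symm
      split_ifs with h
      · rw [ind_of_not (h ▸ hp), mul_zero]
      · rfl
  rw [h]
  exact hasSum_sum fun t _ => hasSum_ite_eq _ _

end

/-- An edge-ordered triple amounts to three paths and an order making all of them increasing. -/
def tripleEquiv (n : ℕ) : EdgeOrderedTriple n ≃ Σ A : HamPath n, Σ B : HamPath n, Σ C : HamPath n,
    {σ : EdgeOrder (pathEdges A ∪ pathEdges B ∪ pathEdges C) //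
      IsIncreasing A σ ∧ IsIncreasing B σ ∧ IsIncreasing C σ} where
  toFun t := ⟨t.A, t.B, t.C, t.order, t.incA, t.incB, t.incC⟩
  invFun x := ⟨x.1, x.2.1, x.2.2.1, x.2.2.2.1, x.2.2.2.2.1, x.2.2.2.2.2.1, x.2.2.2.2.2.2⟩
  left_inv _ := rfl
  right_inv _ := rfl

theorem sum_weight_mul {n : ℕ} (f : HamPath n → HamPath n → HamPath n → ℝ) :
    ∑ t : EdgeOrderedTriple n, t.weight * f t.A t.B t.C =
      ∑ A : HamPath n, ∑ B : HamPath n, ∑ C : HamPath n, w3 A B C * f A B C := by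
  classical
  rw [Fintype.sum_equiv (tripleEquiv n) (fun t => t.weight * f t.A t.B t.C) (fun x => 1 /
    ((pathEdges x.1 ∪ pathEdges x.2.1 ∪ pathEdges x.2.2.1).card.factorial : ℝ) *
      f x.1 x.2.1 x.2.2.1) (fun _ => rfl)]
  simp only [Fintype.sum_sigma]
  refine sum_congr rfl fun A _ => sum_congr rfl fun B _ => sum_congr rfl fun C _ => ?_
  rw [sum_const, nsmul_eq_mul, ← mul_assoc, mul_one_div, w3, card_univ, Fintype.card_subtype]

/-! ### From the series to sums over triples of paths -/

section
variable {K : ℕ}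

theorem hasSum_term : HasSum (fun p : ReducedGraph × EdgeCounts => term (K + 1) p.1 p.2)
    (thirdMoment (K + 1)) := by
  have h := hasSum_indicator_term (K := K) Set.univ
  have e := sum_weight_mul (n := K + 1) fun _ _ _ => 1
  simp only [mul_one] at e
  simp only [Set.indicator_univ, Set.mem_univ, ind_of, mul_one] at h
  rwa [e, ← thirdMoment_eq] at h

/-- The converse of goodness: if the reduced graph is not good, some common edges of different pairs
must touch, by `isGood_collapse`. -/
theorem exceptional_imp (t : EdgeOrderedTriple (K + 1)) {M : ℕ}
    (ht : t.pattern ∈ exceptionalPairs M) : AnyBad t.A t.B t.C ∨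
      M ≤ common (pathEdges t.A) t.B + common (pathEdges t.A ∪ pathEdges t.B) t.C := by
  rcases ht with h | h
  · left
    by_contra hb
    exact h (isGood_collapse hb)
  · exact Or.inr (h.le.trans t.counts_le_common)

theorem tsum_exceptionalPairs (M : ℕ) :
    ∑' p : exceptionalPairs M, term (K + 1) p.1.1 p.1.2 =
      ∑ t : EdgeOrderedTriple (K + 1), t.weight * ind (t.pattern ∈ exceptionalPairs M) := by
  rw [← (hasSum_indicator_term (exceptionalPairs M)).tsum_eq]
  exact tsum_subtype _ fun p : ReducedGraph × EdgeCounts => term (K + 1) p.1 p.2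

theorem tsum_exceptionalPairs_le (M : ℕ) :
    ∑' p : exceptionalPairs M, term (K + 1) p.1.1 p.1.2 ≤
      tsum3 fun A B C : HamPath (K + 1) => ind (AnyBad A B C ∨
        M ≤ common (pathEdges A) B + common (pathEdges A ∪ pathEdges B) C) := by
  rw [tsum_exceptionalPairs, tsum3, ← sum_weight_mul]
  exact sum_le_sum fun t _ =>
    mul_le_mul_of_nonneg_left (ind_le_of_imp (exceptional_imp t)) t.weight_nonneg

theorem tsum_exceptionalPairs_le_thirdMoment (M : ℕ) :
    ∑' p : exceptionalPairs M, term (K + 1) p.1.1 p.1.2 ≤ thirdMoment (K + 1) := by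
  have e := sum_weight_mul (n := K + 1) fun _ _ _ => 1
  simp only [mul_one] at e
  rw [tsum_exceptionalPairs, thirdMoment_eq, ← e]
  refine sum_le_sum fun t _ => ?_
  conv_rhs => rw [← mul_one t.weight]
  refine mul_le_mul_of_nonneg_left ?_ t.weight_nonneg
  rw [← ind_of (p := True) trivial]
  exact ind_le_of_imp fun _ => trivial

theorem thirdMoment_eq_tsum3 : thirdMoment (K + 1) =
    tsum3 fun A B C : HamPath (K + 1) => ind (AnyBad A B C ∨
        0 ≤ common (pathEdges A) B + common (pathEdges A ∪ pathEdges B) C) := by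
  rw [thirdMoment_eq, tsum3]
  simp only [Nat.zero_le, or_true, ind_of, mul_one]

end

/-! ### The asymptotic statements -/

theorem thirdMoment_nonneg (n : ℕ) : 0 ≤ thirdMoment n := by
  unfold thirdMoment
  exact Finset.expect_nonneg fun ω _ => by positivity

theorem exists_bound : ∃ (N : ℕ) (c : ℝ), 0 ≤ c ∧ ∀ K, N ≤ K → ∀ M : ℕ,
    (tsum3 fun A B C : HamPath (K + 1) => ind (AnyBad A B C ∨
      M ≤ common (pathEdges A) B + common (pathEdges A ∪ pathEdges B) C)) ≤
    c * ((K + 1 : ℕ) : ℝ) ^ 3 * Real.exp (-Real.log (11 / 10) * M) +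
      c * ((K + 1 : ℕ) : ℝ) ^ 2 := by
  obtain ⟨c₁, c₂, h⟩ := tsum3_exceptional_le
  refine ⟨8388608, max |c₁| |c₂|, (abs_nonneg _).trans (le_max_left _ _), fun K hK M => ?_⟩
  refine (h K hK M).trans ?_
  have he : Real.exp (-Real.log (11 / 10) * M) = ((11 / 10 : ℝ)⁻¹) ^ M := by
    rw [← Real.log_inv, mul_comm, Real.exp_nat_mul, Real.exp_log (by norm_num)]
  rw [he]
  push_cast
  gcongr
  · exact (le_abs_self _).trans (le_max_left _ _)
  · exact (le_abs_self _).trans (le_max_right _ _)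

/-- For M = 0 the condition on the overlap is always satisfied, so the exceptional bound covers all
triples. -/
theorem thirdMoment_isBigO :
    (fun n : ℕ => thirdMoment n) =O[atTop] fun n : ℕ => (n : ℝ) ^ 3 := by
  obtain ⟨N, c, hc, h⟩ := exists_bound
  refine IsBigO.of_bound (c + c) ?_
  filter_upwards [eventually_ge_atTop (N + 1)] with n hn
  obtain ⟨K, rfl⟩ : ∃ K, n = K + 1 := ⟨n - 1, by omega⟩
  rw [Real.norm_of_nonneg (thirdMoment_nonneg _), Real.norm_of_nonneg (by positivity),
    thirdMoment_eq_tsum3]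
  refine (h K (by omega) 0).trans ?_
  rw [Nat.cast_zero, mul_zero, Real.exp_zero, mul_one, add_mul]
  gcongr
  · simp
  · norm_num

theorem exists_exceptional_bound : ∃ K₁ K₂ δ : ℝ, 0 < δ ∧ ∀ n : ℕ, 1 ≤ n → ∀ M : ℕ,
    ∑' p : exceptionalPairs M, term n p.1.1 p.1.2 ≤
      K₁ * (n : ℝ) ^ 3 * Real.exp (-δ * (M : ℝ)) + K₂ * (n : ℝ) ^ 2 := by
  obtain ⟨N, c, hc, h⟩ := exists_bound
  have hS : 0 ≤ ∑ k ∈ range N, thirdMoment (k + 1) := sum_nonneg fun _ _ => thirdMoment_nonneg _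
  -- The rate δ = log(11/10) comes from the weight per common edge. The summand in K₂ bounds the
  -- whole third moment for each of the finitely many n not covered by `exists_bound`.
  refine ⟨c, c + ∑ k ∈ range N, thirdMoment (k + 1), Real.log (11 / 10),
    Real.log_pos (by norm_num), fun n hn M => ?_⟩
  obtain ⟨K, rfl⟩ : ∃ K, n = K + 1 := ⟨n - 1, by omega⟩
  have hn1 : (1 : ℝ) ≤ ((K + 1 : ℕ) : ℝ) ^ 2 := one_le_pow₀ (by exact_mod_cast hn)
  rcases le_or_gt N K with hK | hK
  · refine (tsum_exceptionalPairs_le M).trans ((h K hK M).trans ?_)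
    gcongr
    exact le_add_of_nonneg_right hS
  · refine (tsum_exceptionalPairs_le_thirdMoment M).trans ?_
    have h1 : thirdMoment (K + 1) ≤ ∑ k ∈ range N, thirdMoment (k + 1) :=
      single_le_sum (f := fun k => thirdMoment (k + 1)) (fun _ _ => thirdMoment_nonneg _)
        (mem_range.2 hK)
    have h2 : 0 ≤ c * ((K + 1 : ℕ) : ℝ) ^ 3 * Real.exp (-Real.log (11 / 10) * M) := by
      have := Real.exp_pos (-Real.log (11 / 10) * M)
      positivity
    nlinarith

end HamTriples
end

theorem mainTheorem6 :
    ((fun n : ℕ => HamTriples.thirdMoment n) =O[atTop] fun n : ℕ => (n : ℝ) ^ 3) ∧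
    (∀ n : ℕ, 1 ≤ n →
      HasSum (fun p : HamTriples.ReducedGraph × HamTriples.EdgeCounts =>
        HamTriples.term n p.1 p.2) (HamTriples.thirdMoment n)) ∧
    ∃ K₁ K₂ δ : ℝ, 0 < δ ∧ ∀ n : ℕ, 1 ≤ n → ∀ M : ℕ,
      ∑' p : HamTriples.exceptionalPairs M, HamTriples.term n p.1.1 p.1.2 ≤
        K₁ * (n : ℝ) ^ 3 * Real.exp (-δ * (M : ℝ)) + K₂ * (n : ℝ) ^ 2 := by
  refine ⟨HamTriples.thirdMoment_isBigO, fun n hn => ?_, HamTriples.exists_exceptional_bound⟩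
  obtain ⟨K, rfl⟩ : ∃ K, n = K + 1 := ⟨n - 1, by omega⟩
  exact HamTriples.hasSum_term
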